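/- **Model.** Let $A$ be a disk of radius $\rho>0$. Primary and secondary nodes form independent homogeneous Poisson processes on $A$ of densities $\lambda^{(p)}$ and $\lambda^{(s)}=(\lambda^{(p)})^{\beta}$, where $0<\beta<1$. The transmission ranges are $R_r^{(p)}=K_p\sqrt{\log\lambda^{(p)}/\lambda^{(p)}}$, $R_r^{(s)}=K_s\sqrt{\log\lambda^{(s)}/\lambda^{(s)}}$ with $K_p,K_s>0$, and the interference ranges are $R_I^{(p)}=\sqrt{1+l^{(p)}}\,R_r^{(p)}$, $R_I^{(s)}=\sqrt{1+l^{(s)}}\,R_r^{(s)}$ with constants $l^{(p)},l^{(s)}\ge 0$. The range $R_I^{(ps)}$ (interference from primary transmitters at secondary receivers), with $0\le R_I^{(ps)}\le R_I^{(p)}$, and the detection range $R_D\ge 0$ may depend on $\lambda^{(p)}$. In a time slot each primary node transmits independently with probability $q^{(p)}$; each secondary node transmits, independently, with probability $q^{(s)}$ if no primary node within distance $R_D$ of it transmits, and is silent otherwise. The packet at the head of the queue of a secondary node $X_i$ is either its own, and then its destination is uniform among all other secondary nodes, or a relayed one. Its law given the secondary node positions is arbitrary (independent of the primary nodes and of the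 transmission decisions of the slot), except that for every fixed $M$ the expected number of nodes whose head packet is a relayed packet at distance at most $M R_r^{(s)}$ from its destination is $o(\lambda^{(s)})$. If the destination is within $R_r^{(s)}$ of $X_i$, the next relay is the destination; otherwise it is uniform among the other nodes in the half-disk of radius $R_r^{(s)}$ centered at $X_i$ and oriented towards the destination (if there are none, nothing is transmitted successfully). The progress $Y_i$ is the decrease of the distance to the destination. The transmission is successful (event $\Lambda_i$) if $X_i$ transmits, no secondary node other than $X_i$ within $R_I^{(s)}$ of the next relay (the relay included) transmits, and no primary node within $R_I^{(ps)}$ of the next relay transmits. The secondary throughput is $C^{(s)}=\mathbb E\big[\sum_i Y_i\mathbf 1_{\Lambda_i}\big]$, the sum being over all secondary nodes. Let $C_0$ denote the same quantity for the secondary network alone (no primary nodes) with access probability $1/(\lambda^{(s)}\pi (R_I^{(s)})^2)$, and let $f=\sqrt{\lambda^{(s)}/\log\lambda^{(s)}}$. The asymptotic multiplexing gain (AMG) of a throughput $C$ is $\lim C/f$. All limits are for $\lambda^{(p)}\to\infty$. **Claims.** 1. If $R_D=\omega(R_r^{(p)})$, $q^{(p)}=\Theta(1/\log\lambda^{(p)})$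 and $q^{(s)}=O(1/\log\lambda^{(s)})$, then the secondary throughput normalized by the single-network scaling tends to zero: $C^{(s)}=o\big(\sqrt{\lambda^{(s)}/\log\lambda^{(s)}}\big)$. 2. If $R_D=O(R_r^{(p)})$, $q^{(p)}=O(1/\log\lambda^{(p)})$ and $q^{(s)}=\Theta(1/\log\lambda^{(s)})$, then $C^{(s)}=\Theta\big(\sqrt{\lambda^{(s)}/\log\lambda^{(s)}}\big)$, and $C^{(s)}$ is eventually positive. 3. Let $R_D=O(R_r^{(p)})$, $q^{(p)}=1/(\lambda^{(p)}\pi(R_I^{(p)})^2)$, and let either $q^{(s)}$ or the effective access probability $\tilde q^{(s)}=q^{(s)}\exp(-\lambda^{(p)}q^{(p)}\pi R_D^2)$ be equal to $1/(\lambda^{(s)}\pi (R_I^{(s)})^2)$. Then the single-network AMG $\chi=\lim C_0/f$ exists and is positive, and for every $\varepsilon>0$ and all sufficiently large $\lambda^{(p)}$ $$\exp\Big(-\frac{(R_I^{(ps)}+R_D)^2}{(R_I^{(p)})^2}\Big)-\varepsilon\;\le\;\frac{C^{(s)}}{\chi f}\;\le\;2\exp\Big(-\Big(\frac{R_I^{(ps)}}{R_I^{(p)}}\Big)^2\Big)+\varepsilon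 .$$ If moreover $R_I^{(ps)}/R_I^{(p)}\to a$ and $R_D/R_I^{(p)}\to d$, then the secondary AMG $\chi^{(s)}=\lim C^{(s)}/f$ exists and $e^{-(a+d)^2}\le\chi^{(s)}/\chi\le 2e^{-a^2}$. -/

import Mathlib

open Filter Topology Asymptotics MeasureTheory

noncomputable section

namespace OverlaidNetwork

/-- The plane, with its Euclidean distance. -/
abbrev Plane := EuclideanSpace ℝ (Fin 2)

/-- The circular area in which both networks live. -/
def region (ρ : ℝ) : Set Plane := Metric.closedBall 0 ρ

/-- A realization of a network in one time slot: the number `n` of nodes and, for each node, its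
position and its ALOHA variable (uniform on `[0, 1]`); a node whose ALOHA variable is below the
access probability `q` attempts to transmit. -/
abbrev Config := Σ n : ℕ, (Fin n → Plane × ℝ)

/-- The law of one node: a uniform position in the region and an independent uniform variable
on `[0, 1]`. -/
def nodeLaw (ρ : ℝ) : Measure (Plane × ℝ) :=
  (ProbabilityTheory.cond volume (region ρ)).prod (volume.restrict (Set.Icc 0 1))

/-- The homogeneous Poisson point process of density `dens` on the region, with independent
ALOHA variables attached to its points: the number of nodes is Poisson with mean `dens * |A|`
and, given this number, the nodes are independent with law `nodeLaw`. -/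
def poissonLaw (ρ dens : ℝ) : Measure Config :=
  Measure.sum fun n : ℕ =>
    ENNReal.ofReal (Real.exp (-(dens * volume.real (region ρ))) *
        (dens * volume.real (region ρ)) ^ n / (n.factorial : ℝ)) •
      (Measure.pi fun _ : Fin n => nodeLaw ρ).map (Sigma.mk n)

/-- The positions of the nodes. -/
def Config.pos (ω : Config) : Fin ω.1 → Plane := fun i => (ω.2 i).1

/-- Node `i` attempts to transmit, for the access probability `q`. -/
def Config.attempts (ω : Config) (q : ℝ) (i : Fin ω.1) : Prop := (ω.2 i).2 < q

/-- The transmission range `K √(log dens / dens)` of a network of density `dens`. -/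
def txRange (K dens : ℝ) : ℝ := K * Real.sqrt (Real.log dens / dens)

/-- The interference range `√(1 + l) R_r` of a network. -/
def intRange (l K dens : ℝ) : ℝ := Real.sqrt (1 + l) * txRange K dens

/-! ### Packets and routing -/

/-- The packets at the heads of the queues. Every node always has a packet to transmit, which is
either its own (and then its destination is uniform among all other nodes) or one that it relays.
Queueing is left arbitrary: given the positions `x` of the `n` nodes, the packet at the head of the
queue of node `i` is its own with probability `own n x i`, and if it is relayed, its destination is
node `j` with probability `relayed n x i j`. The packets do not depend on the ALOHA variables of
the current slot. -/
structure Traffic where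
  own : (n : ℕ) → (Fin n → Plane) → Fin n → ℝ
  relayed : (n : ℕ) → (Fin n → Plane) → Fin n → Fin n → ℝ
  own_mem : ∀ n x i, own n x i ∈ Set.Icc (0 : ℝ) 1
  relayed_nonneg : ∀ n x i j, 0 ≤ relayed n x i j
  relayed_self : ∀ n x i, relayed n x i i = 0
  relayed_sum : ∀ n x i, 2 ≤ n → ∑ j, relayed n x i j = 1
  own_measurable : ∀ n i, Measurable fun x => own n x i
  relayed_measurable : ∀ n i j, Measurable fun x => relayed n x i j

open Classical in
/-- The probability that the packet at the head of the queue of node `i` is destined to node `j`. -/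
def Traffic.destProb (T : Traffic) {n : ℕ} (x : Fin n → Plane) (i j : Fin n) : ℝ :=
  if j = i then 0
  else T.own n x i * (1 / ((n : ℝ) - 1)) + (1 - T.own n x i) * T.relayed n x i j

open Classical in
/-- The expected number of nodes whose head-of-queue packet is a relayed packet with remaining
distance at most `r` to its destination. -/
def Traffic.relayedNear (T : Traffic) (ρ dens r : ℝ) : ℝ :=
  ∫ ω : Config, ∑ i, ∑ j with dist (ω.pos i) (ω.pos j) ≤ r,
    (1 - T.own ω.1 ω.pos i) * T.relayed ω.1 ω.pos i j ∂(poissonLaw ρ dens)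

/-- Multi-hop relaying: at a proportion of nodes that tends to one, the packet at the head of the
queue is not a relayed packet which is already within a bounded number of transmission ranges of
its destination. Here `dens t` is the density of the network and `R t` its transmission range. -/
def MultiHop (ρ : ℝ) (T : ℝ → Traffic) (dens R : ℝ → ℝ) : Prop :=
  ∀ M : ℝ, 0 < M →
    Tendsto (fun t => (T t).relayedNear ρ (dens t) (M * R t) / dens t) atTop (𝓝 0)

/-- The transmission half-disk of radius `R` centered at `c` and oriented towards `d`. -/
def halfDisk (c d : Plane) (R : ℝ) : Set Plane :=
  {y | dist y c ≤ R ∧ 0 ≤ inner ℝ (y - c) (d - c)}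

open Classical in
/-- The candidates for the next relay of a packet at node `i` destined to node `j`: the destination
itself if it is in the transmission range, and otherwise all nodes in the half-disk of node `i`
oriented towards the destination. The next relay is uniform among the candidates. -/
def candidates {n : ℕ} (x : Fin n → Plane) (R : ℝ) (i j : Fin n) : Finset (Fin n) :=
  if dist (x i) (x j) ≤ R then {j}
  else Finset.univ.filter fun k => k ≠ i ∧ x k ∈ halfDisk (x i) (x j) R

/-- The progress, i.e. the decrement of the distance to the destination `j`, of a packet that is
transmitted from node `i` to node `k`. -/
def progress {n : ℕ} (x : Fin n → Plane) (i j k : Fin n) : ℝ :=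
  dist (x i) (x j) - dist (x k) (x j)

open Classical in
/-- The total progress of the successfully transmitted head-of-queue packets, averaged over their
destinations and over the choices of the next relays; `success i k` is the event that a
transmission from node `i` to node `k` is successful. -/
def totalProgress (T : Traffic) (R : ℝ) {n : ℕ} (x : Fin n → Plane)
    (success : Fin n → Fin n → Prop) : ℝ :=
  ∑ i, ∑ j, T.destProb x i j *
    ((∑ k ∈ candidates x R i j, progress x i j k * (if success i k then 1 else 0)) /
      ((candidates x R i j).card : ℝ))

/-! ### Single-tier network -/

/-- Node `i` transmits, and neither the receiver `k` nor any other node within the interference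
range `RI` of `k`, except `i`, does. -/
def tierSuccess {n : ℕ} (x : Fin n → Plane) (transmits : Fin n → Prop) (RI : ℝ)
    (i k : Fin n) : Prop :=
  transmits i ∧ ∀ m, m ≠ i → dist (x m) (x k) ≤ RI → ¬ transmits m

/-- The spatial throughput of a network that is alone in the region. -/
def singleThroughput (ρ dens : ℝ) (T : Traffic) (R RI q : ℝ) : ℝ :=
  ∫ ω : Config, totalProgress T R ω.pos (tierSuccess ω.pos (ω.attempts q) RI)
    ∂(poissonLaw ρ dens)

/-! ### Secondary network in the presence of the primary network -/

/-- No primary node within distance `r` of `y` transmits (`ωp` is the primary network and `qp` its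
access probability). -/
def primaryFree (ωp : Config) (qp r : ℝ) (y : Plane) : Prop :=
  ∀ k, ωp.attempts qp k → r < dist (ωp.pos k) y

/-- A secondary node transmits if it attempts to and senses no primary transmitter within the
detection range `RD`. -/
def secondaryTransmits (ωp ωs : Config) (qp qs RD : ℝ) (i : Fin ωs.1) : Prop :=
  ωs.attempts qs i ∧ primaryFree ωp qp RD (ωs.pos i)

/-- A transmission from secondary node `i` to secondary node `k` is successful: there is no
interference from other secondary nodes, and there are no primary transmitters within the
inter-network interference range `RIps` of the receiver. -/
def secondarySuccess (ωp ωs : Config) (qp qs RD RI RIps : ℝ) (i k : Fin ωs.1) : Prop :=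
  tierSuccess ωs.pos (secondaryTransmits ωp ωs qp qs RD) RI i k ∧
    primaryFree ωp qp RIps (ωs.pos k)

/-- The spatial throughput of the secondary network (density `densS`, transmission range `R`,
interference range `RI`, access probability `qs`) overlaid with the primary network (density
`densP`, access probability `qp`). -/
def secondaryThroughput (ρ densP densS : ℝ) (T : Traffic) (R RI RIps RD qp qs : ℝ) : ℝ :=
  ∫ ω : Config × Config,
    totalProgress T R ω.2.pos (secondarySuccess ω.1 ω.2 qp qs RD RI RIps)
    ∂((poissonLaw ρ densP).prod (poissonLaw ρ densS))

/-! ### Scaling -/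

/-- The throughput scaling `√(dens / log dens)`. -/
def scaling (dens : ℝ) : ℝ := Real.sqrt (dens / Real.log dens)

/-- `χ` is the asymptotic multiplexing gain of the throughput `C` with respect to the scaling `f`. -/
def IsAMG (C f : ℝ → ℝ) (χ : ℝ) : Prop := Tendsto (fun t => C t / f t) atTop (𝓝 χ)

/-- The ALOHA access probability `1 / (dens π R_I ^ 2)`, which maximizes the probability of
successful transmission in a single-tier network. -/
def optAccess (dens RI : ℝ) : ℝ := 1 / (dens * Real.pi * RI ^ 2)

end OverlaidNetwork

end

/-! Given the secondary positions, the throughput is linear in the success probabilities of the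
pairs (transmitter `i`, relay `k`), averaged over the ALOHA variables and the primary network
(`secondaryThroughput_eq`, `weightedProgress`). Two facts determine it: for most pairs this
probability is close to the access probability times a deterministic number, `typicalReach`, and the
mean progress towards any distant destination is close to `meanProgress * R`, with R the secondary
transmission range.

Success probability. As β < 1, the primary ranges are of smaller order than the secondary ones
(`tendsto_txRange_div`), provided that the detection range is at most of the order of the primary
transmission range. For most pairs the detection disk of the transmitter and the disk of radius
`RIps` around the relay are then disjoint, and by the void probability of a Poisson process both are
free of primary transmitters with probability exp(-t qp π (RD² + RIps²)). In the secondary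
interference disk of the relay, the area on which nodes sense no primary transmitter decorrelates
beyond distance 2 RD, so it concentrates at the fraction exp(-t qp π RD²) of the disk
(`meanLE_abs_freeArea_sub`). The number of free secondary nodes in that disk concentrates as well,
hence the probability that all of them are silent is close to `quietProb` (`meanLE_quiet`).

Progress. A half-disk contains of order log λ nodes, with λ the secondary density, so the number of
candidates and the sum of their projections on a direction fluctuate relatively by 1/√(log λ). A
finite net of directions makes the estimate simultaneous in all directions (`exists_testFns`); the
law of the destinations is then irrelevant as long as few of them are near. For relayed packets this
is `MultiHop`, for own packets it follows from uniformity (`meanLE_sum_nearProb`).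

All errors are first absolute moments summed over the nodes. Mecke's formula (`lintegral_sum_rest`)
reduces each sum to one node added to an independent process, where standard deviations suffice.
Stating the bounds by `MeanLE`, with integrals in [0, ∞], lets them be added without integrability
conditions. They combine into `exists_abs_secondaryThroughput_sub_le`. Since R λ = Ks log λ · f,
this gives `tendsto_secondaryThroughput_div`: C / f differs by o(1) from a constant times (qs log λ)
· `typicalReach`.

The second claim follows because every exponent in `typicalReach` stays bounded. For the third, put
x = RIps / RIP and y = RD / RIP. The ratio to the single network is asymptotic to exp(-(x² + y²) + 1
- exp(-y²)) if qs is the optimal access probability, and to exp(-x²) if the effective one is. Both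
lie between exp(-(x² + y²)) and exp(-x²). The first claim needs only a crude bound: a transmitter
must sense no primary transmitter, which has vanishing probability when RD is large
(`abs_secondaryThroughput_le`, `tendsto_detection`). -/

open scoped ENNReal

noncomputable section

namespace OverlaidNetwork

/-! ### Poisson processes on a measurable space -/

section Poisson

variable {Z : Type*} [MeasurableSpace Z]

/-- Finite labelled configurations of points of `Z`. -/
abbrev Conf (Z : Type*) := Σ n : ℕ, (Fin n → Z)

/-- The Poisson weight of the number `n`. -/
def poissonWeight (Λ : ℝ) (n : ℕ) : ℝ≥0∞ :=
  ENNReal.ofReal (Real.exp (-Λ) * Λ ^ n / (n.factorial : ℝ))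

/-- The Poisson process with intensity `Λ • ν`. -/
def poissonProcess (Λ : ℝ) (ν : Measure Z) : Measure (Conf Z) :=
  Measure.sum fun n : ℕ => poissonWeight Λ n • (Measure.pi fun _ : Fin n => ν).map (Sigma.mk n)

theorem poissonLaw_eq (ρ dens : ℝ) :
    poissonLaw ρ dens = poissonProcess (dens * volume.real (region ρ)) (nodeLaw ρ) := rfl

theorem measurable_sigmaMk {ι : Type*} {X : ι → Type*} [∀ i, MeasurableSpace (X i)] (i : ι) :
    Measurable (Sigma.mk i : X i → Sigma X) :=
  fun _ hs => MeasurableSpace.measurableSet_iInf.1 hs i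

theorem measurable_of_sigma {ι : Type*} {X : ι → Type*} [∀ i, MeasurableSpace (X i)]
    {Y : Type*} [MeasurableSpace Y] {f : Sigma X → Y}
    (h : ∀ i, Measurable fun x : X i => f ⟨i, x⟩) : Measurable f :=
  fun _ hs => MeasurableSpace.measurableSet_iInf.2 fun i => h i hs

/-- The image of a measurable set of the `i`-th summand. -/
theorem measurableSet_sigmaMk_image {ι : Type*} {X : ι → Type*} [∀ i, MeasurableSpace (X i)]
    {i : ι} {s : Set (X i)} (hs : MeasurableSet s) : MeasurableSet (Sigma.mk i '' s) := by
  refine MeasurableSpace.measurableSet_iInf.2 fun j => ?_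
  by_cases h : j = i
  · subst h
    have : Sigma.mk j ⁻¹' (Sigma.mk j '' s) = s :=
      Set.preimage_image_eq _ sigma_mk_injective
    change MeasurableSet (Sigma.mk j ⁻¹' _)
    rwa [this]
  · have : Sigma.mk j ⁻¹' (Sigma.mk i '' s) = ∅ := by
      ext x; simp only [Set.mem_preimage, Set.mem_image, Set.mem_empty_iff_false, iff_false]
      rintro ⟨y, _, hy⟩
      exact h (congrArg Sigma.fst hy).symm
    change MeasurableSet (Sigma.mk j ⁻¹' _)
    exact this ▸ MeasurableSet.empty

theorem measurableEmbedding_sigmaMk {ι : Type*} {X : ι → Type*} [∀ i, MeasurableSpace (X i)]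
    (i : ι) : MeasurableEmbedding (Sigma.mk i : X i → Sigma X) :=
  ⟨sigma_mk_injective, measurable_sigmaMk i, fun _ hs => measurableSet_sigmaMk_image hs⟩

/-- The σ-algebra of a sigma type is defined layer by layer, which says nothing directly about its
products. A preimage is the union over `i` of images under measurable embeddings; countability of
`ι` makes this union measurable. -/
theorem measurable_of_sigma_prod {ι : Type*} [Countable ι] {X : ι → Type*}
    [∀ i, MeasurableSpace (X i)] {W Y : Type*} [MeasurableSpace W] [MeasurableSpace Y]
    {f : Sigma X × W → Y} (h : ∀ i, Measurable fun x : X i × W => f (⟨i, x.1⟩, x.2)) :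
    Measurable f := by
  intro s hs
  have : f ⁻¹' s = ⋃ i, Prod.map (Sigma.mk i) id '' ((fun x : X i × W => f (⟨i, x.1⟩, x.2)) ⁻¹' s) := by
    ext ⟨⟨i, x⟩, w⟩
    simp only [Set.mem_preimage, Set.mem_iUnion, Set.mem_image, Prod.exists, Prod.map_apply, id,
      Prod.mk.injEq]
    constructor
    · intro hx; exact ⟨i, x, w, hx, rfl, rfl⟩
    · rintro ⟨j, y, w', hy, h1, rfl⟩; rw [h1] at hy; exact hy
  rw [this]
  exact MeasurableSet.iUnion fun i =>
    ((measurableEmbedding_sigmaMk i).prodMap MeasurableEmbedding.id).measurableSet_image.2 (h i hs)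

theorem measurable_of_prod_sigma {ι : Type*} [Countable ι] {X : ι → Type*}
    [∀ i, MeasurableSpace (X i)] {W Y : Type*} [MeasurableSpace W] [MeasurableSpace Y]
    {f : W × Sigma X → Y} (h : ∀ i, Measurable fun x : W × X i => f (x.1, ⟨i, x.2⟩)) :
    Measurable f := by
  have : Measurable fun p : Sigma X × W => f (p.2, p.1) :=
    measurable_of_sigma_prod fun i => (h i).comp measurable_swap
  exact this.comp measurable_swap

variable {Λ : ℝ} {ν : Measure Z}

theorem lintegral_poissonProcess {f : Conf Z → ℝ≥0∞} (hf : Measurable f) :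
    ∫⁻ ω, f ω ∂(poissonProcess Λ ν) =
      ∑' n, poissonWeight Λ n * ∫⁻ x, f ⟨n, x⟩ ∂(Measure.pi fun _ : Fin n => ν) := by
  rw [poissonProcess, lintegral_sum_measure]
  congr with n
  rw [lintegral_smul_measure, lintegral_map hf (measurable_sigmaMk n), smul_eq_mul]

/-- This recursion characterizes the Poisson weights and is the whole analytic content of Mecke's
formula. -/
theorem poissonWeight_succ (hΛ : 0 ≤ Λ) (n : ℕ) :
    poissonWeight Λ (n + 1) * ((n + 1 : ℕ) : ℝ≥0∞) = ENNReal.ofReal Λ * poissonWeight Λ n := by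
  rw [poissonWeight, poissonWeight, ← ENNReal.ofReal_natCast, ← ENNReal.ofReal_mul (by positivity),
    ← ENNReal.ofReal_mul hΛ]
  congr 1
  rw [Nat.factorial_succ, pow_succ]
  push_cast
  field_simp

/-- The generating function serves twice: `a = 1` gives total mass one, and taking for `a` the mass
of a complement gives void probabilities. -/
theorem tsum_poissonWeight_mul_pow (hΛ : 0 ≤ Λ) {a : ℝ} (ha : 0 ≤ a) :
    ∑' n, poissonWeight Λ n * ENNReal.ofReal a ^ n = ENNReal.ofReal (Real.exp (-(Λ * (1 - a)))) := by
  have h : HasSum (fun n : ℕ => Real.exp (-Λ) * Λ ^ n / (n.factorial : ℝ) * a ^ n)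
      (Real.exp (-(Λ * (1 - a)))) := by
    have h0 := (NormedSpace.expSeries_div_hasSum_exp (𝔸 := ℝ) (Λ * a)).mul_left (Real.exp (-Λ))
    rw [← Real.exp_eq_exp_ℝ, ← Real.exp_add] at h0
    convert! h0 using 1
    · ext n; rw [mul_pow]; ring
    · congr 1; ring
  rw [← h.tsum_eq, ENNReal.ofReal_tsum_of_nonneg (fun n => by positivity) h.summable]
  congr with n
  rw [poissonWeight, ← ENNReal.ofReal_pow ha, ← ENNReal.ofReal_mul (by positivity)]

/-- The probability that no point of the process lies in `E`. -/
theorem poissonProcess_void [IsProbabilityMeasure ν] (hΛ : 0 ≤ Λ) {E : Set Z}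
    (hE : MeasurableSet E) :
    poissonProcess Λ ν {ω | ∀ k, ω.2 k ∉ E} = ENNReal.ofReal (Real.exp (-(Λ * ν.real E))) := by
  have hset (n : ℕ) : {x : Fin n → Z | ∀ k, x k ∉ E} = Set.univ.pi fun _ => Eᶜ := by
    ext x; simp
  have hm : MeasurableSet {ω : Conf Z | ∀ k, ω.2 k ∉ E} := by
    refine MeasurableSpace.measurableSet_iInf.2 fun n => ?_
    change MeasurableSet {x : Fin n → Z | ∀ k, x k ∉ E}
    rw [hset]
    exact MeasurableSet.univ_pi fun _ => hE.compl
  rw [poissonProcess, Measure.sum_apply _ hm]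
  have : 1 - ν.real Eᶜ = ν.real E := by
    rw [probReal_compl_eq_one_sub hE]; ring
  rw [← this, ← tsum_poissonWeight_mul_pow hΛ measureReal_nonneg]
  congr with n
  rw [Measure.smul_apply, Measure.map_apply (measurable_sigmaMk n) hm, smul_eq_mul]
  change _ * (Measure.pi fun _ => ν) {x : Fin n → Z | ∀ k, x k ∉ E} = _
  rw [hset, Measure.pi_pi]
  simp

theorem isProbabilityMeasure_poissonProcess [IsProbabilityMeasure ν] (hΛ : 0 ≤ Λ) :
    IsProbabilityMeasure (poissonProcess Λ ν) := by
  constructor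
  have := poissonProcess_void (ν := ν) hΛ (E := ∅) MeasurableSet.empty
  simpa using this

/-- The configuration without the point labelled `i`. -/
def rest : (ω : Conf Z) → Fin ω.1 → Conf Z
  | ⟨0, _⟩, i => i.elim0
  | ⟨_ + 1, x⟩, i => ⟨_, i.removeNth x⟩

/-- Mecke's formula. -/
theorem lintegral_sum_rest [IsProbabilityMeasure ν] (hΛ : 0 ≤ Λ) {g : Z → Conf Z → ℝ≥0∞}
    (hg : Measurable (Function.uncurry g)) :
    ∫⁻ ω, ∑ i, g (ω.2 i) (rest ω i) ∂(poissonProcess Λ ν) =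
      ENNReal.ofReal Λ * ∫⁻ z, ∫⁻ ω, g z ω ∂(poissonProcess Λ ν) ∂ν := by
  have hterm (n : ℕ) (i : Fin (n + 1)) :
      Measurable fun x : Fin (n + 1) → Z => g (x i) ⟨n, i.removeNth x⟩ := by
    have h1 : Measurable fun x : Fin (n + 1) → Z => (i.removeNth x : Fin n → Z) :=
      measurable_pi_lambda _ fun j => measurable_pi_apply _
    have h2 : Measurable fun x : Fin (n + 1) → Z => (⟨n, i.removeNth x⟩ : Conf Z) :=
      (measurable_sigmaMk (X := fun n => Fin n → Z) n).comp h1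
    exact hg.comp ((measurable_pi_apply i).prodMk h2)
  have hmeas : Measurable fun ω : Conf Z => ∑ i, g (ω.2 i) (rest ω i) := by
    refine measurable_of_sigma fun n => ?_
    cases n with
    | zero => simp
    | succ n =>
      change Measurable fun x : Fin (n + 1) → Z => ∑ i : Fin (n + 1), g (x i) ⟨n, i.removeNth x⟩
      exact Finset.measurable_sum _ fun i _ => hterm n i
  have hgn (n : ℕ) : Measurable fun p : Z × (Fin n → Z) => g p.1 ⟨n, p.2⟩ :=
    hg.comp (measurable_fst.prodMk ((measurable_sigmaMk n).comp measurable_snd))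
  -- The layer without points contributes an empty sum; after the shift, layer n + 1 on the left is
  -- matched with layer n on the right.
  rw [lintegral_poissonProcess hmeas, tsum_eq_zero_add' ENNReal.summable]
  have h1 : ∀ z, ∫⁻ ω, g z ω ∂(poissonProcess Λ ν) =
      ∑' n, poissonWeight Λ n * ∫⁻ x, g z ⟨n, x⟩ ∂(Measure.pi fun _ : Fin n => ν) := fun z =>
    lintegral_poissonProcess (hg.comp measurable_prodMk_left)
  simp_rw [h1]
  rw [lintegral_tsum fun n => ((hgn n).lintegral_prod_right'.const_mul _).aemeasurable,
    ← ENNReal.tsum_mul_left]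
  simp only [Finset.univ_eq_empty, Finset.sum_empty, lintegral_zero, mul_zero, zero_add]
  congr with n
  rw [lintegral_const_mul _ (hgn n).lintegral_prod_right', ← mul_assoc, ← poissonWeight_succ hΛ,
    mul_assoc]
  congr 1
  change ∫⁻ x : Fin (n + 1) → Z, ∑ i : Fin (n + 1), g (x i) ⟨n, i.removeNth x⟩
    ∂(Measure.pi fun _ => ν) = _
  rw [lintegral_finsetSum _ fun i _ => hterm n i]
  -- By exchangeability every label contributes the same integral; the n + 1 labels supply the
  -- factor absorbed by `poissonWeight_succ`.
  have : ∀ i : Fin (n + 1), ∫⁻ x, g (x i) ⟨n, i.removeNth x⟩ ∂(Measure.pi fun _ : Fin (n + 1) => ν)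
      = ∫⁻ z, ∫⁻ x, g z ⟨n, x⟩ ∂(Measure.pi fun _ : Fin n => ν) ∂ν := by
    intro i
    rw [← lintegral_prod _ (hgn n).aemeasurable,
      ← (measurePreserving_piFinSuccAbove (fun _ => ν) i).lintegral_comp (hgn n)]
    rfl
  rw [Finset.sum_congr rfl fun i _ => this i]
  simp

open Classical in
theorem sum_rest {Z M : Type*} [AddCommMonoid M] (ω : Conf Z) (i : Fin ω.1) (h : Z → M) :
    ∑ k, h ((rest ω i).2 k) = ∑ k with k ≠ i, h (ω.2 k) := by
  obtain ⟨n, x⟩ := ω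
  cases n with
  | zero => exact i.elim0
  | succ n =>
    change Fin (n + 1) at i
    change ∑ k : Fin n, h (x (i.succAbove k)) = ∑ k : Fin (n + 1) with k ≠ i, h (x k)
    rw [Finset.sum_filter, Fin.sum_univ_succAbove _ i]
    simp [Fin.succAbove_ne]

theorem measurable_sum_conf {M : Type*} [AddCommMonoid M] [MeasurableSpace M] [MeasurableAdd₂ M]
    {h : Z → M} (hh : Measurable h) : Measurable fun ω : Conf Z => ∑ i, h (ω.2 i) :=
  measurable_of_sigma fun n =>
    (Finset.measurable_sum Finset.univ fun i _ => hh.comp (measurable_pi_apply i) :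
      Measurable fun x : Fin n → Z => ∑ i : Fin n, h (x i))

/-- Campbell's formula. -/
theorem lintegral_sum_conf [IsProbabilityMeasure ν] (hΛ : 0 ≤ Λ) {h : Z → ℝ≥0∞}
    (hh : Measurable h) :
    ∫⁻ ω, ∑ i, h (ω.2 i) ∂(poissonProcess Λ ν) = ENNReal.ofReal Λ * ∫⁻ z, h z ∂ν := by
  have := isProbabilityMeasure_poissonProcess (ν := ν) hΛ
  have := lintegral_sum_rest (ν := ν) hΛ (g := fun z _ => h z) (hh.comp measurable_fst)
  simpa using this

/-- Mecke's formula is applied to h(z) (h(z) + ∑ h), whose sum over the points is the square of ∑ h.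
The variance of ∑ h is thus Λ ∫ h². -/
theorem lintegral_sq_sum_conf [IsProbabilityMeasure ν] (hΛ : 0 ≤ Λ) {h : Z → ℝ≥0∞}
    (hh : Measurable h) :
    ∫⁻ ω, (∑ i, h (ω.2 i)) ^ 2 ∂(poissonProcess Λ ν) =
      ENNReal.ofReal Λ * ∫⁻ z, h z ^ 2 ∂ν + (ENNReal.ofReal Λ * ∫⁻ z, h z ∂ν) ^ 2 := by
  classical
  have := isProbabilityMeasure_poissonProcess (ν := ν) hΛ
  have hsum := measurable_sum_conf hh
  have hM := lintegral_sum_rest (ν := ν) hΛ (g := fun z ω => h z * (h z + ∑ k, h (ω.2 k)))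
    ((hh.comp measurable_fst).mul ((hh.comp measurable_fst).add (hsum.comp measurable_snd)))
  have hl : ∀ ω : Conf Z, ∑ i, h (ω.2 i) * (h (ω.2 i) + ∑ k, h ((rest ω i).2 k)) =
      (∑ i, h (ω.2 i)) ^ 2 := by
    intro ω
    have : ∀ i, h (ω.2 i) + ∑ k, h ((rest ω i).2 k) = ∑ k, h (ω.2 k) := by
      intro i
      rw [sum_rest, ← Finset.sum_filter_add_sum_filter_not Finset.univ (fun k => k ≠ i), add_comm]
      congr 1
      simp [Finset.filter_eq']
    simp_rw [this]
    rw [← Finset.sum_mul, sq]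
  simp_rw [hl] at hM
  rw [hM]
  have : ∀ z, ∫⁻ ω : Conf Z, h z * (h z + ∑ k, h (ω.2 k)) ∂(poissonProcess Λ ν) =
      h z ^ 2 + h z * (ENNReal.ofReal Λ * ∫⁻ z, h z ∂ν) := by
    intro z
    rw [lintegral_const_mul _ (hsum.const_add _), lintegral_add_left measurable_const,
      lintegral_sum_conf hΛ hh]
    simp only [lintegral_const, measure_univ, mul_one]
    ring
  simp_rw [this]
  rw [lintegral_add_left (hh.pow_const 2), lintegral_mul_const _ hh]
  ring

end Poisson

/-! ### Bounds on means -/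

section MeanLE

variable {Ω : Type*} [MeasurableSpace Ω] {P : Measure Ω}

/-- The mean of the positive part of `F` is at most `B`. -/
def MeanLE (P : Measure Ω) (F : Ω → ℝ) (B : ℝ) : Prop :=
  ∫⁻ ω, ENNReal.ofReal (F ω) ∂P ≤ ENNReal.ofReal B

theorem MeanLE.mono {F G : Ω → ℝ} {B C : ℝ} (h : MeanLE P F B) (hGF : ∀ ω, G ω ≤ F ω)
    (hBC : B ≤ C) : MeanLE P G C :=
  (lintegral_mono fun ω => ENNReal.ofReal_le_ofReal (hGF ω)).trans
    (h.trans (ENNReal.ofReal_le_ofReal hBC))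

theorem MeanLE.add {F G : Ω → ℝ} {B C : ℝ} (hF : MeanLE P F B) (hG : MeanLE P G C)
    (hm : Measurable F) (hB : 0 ≤ B) (hC : 0 ≤ C) : MeanLE P (fun ω => F ω + G ω) (B + C) := by
  unfold MeanLE
  calc _ ≤ ∫⁻ ω, (ENNReal.ofReal (F ω) + ENNReal.ofReal (G ω)) ∂P :=
        lintegral_mono fun ω => ENNReal.ofReal_add_le
    _ = _ := lintegral_add_left hm.ennreal_ofReal _
    _ ≤ _ := by rw [ENNReal.ofReal_add hB hC]; exact add_le_add hF hG

theorem MeanLE.const_mul {F : Ω → ℝ} {B c : ℝ} (hF : MeanLE P F B) (hc : 0 ≤ c) :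
    MeanLE P (fun ω => c * F ω) (c * B) := by
  unfold MeanLE
  simp_rw [ENNReal.ofReal_mul hc]
  rw [lintegral_const_mul' _ _ ENNReal.ofReal_ne_top]
  exact mul_le_mul_right hF _

theorem meanLE_const [IsProbabilityMeasure P] (c : ℝ) : MeanLE P (fun _ => c) c := by
  simp [MeanLE]

theorem MeanLE.finset_sum {ι : Type*} (s : Finset ι) {F : ι → Ω → ℝ} {B : ι → ℝ}
    (hF : ∀ i ∈ s, MeanLE P (F i) (B i)) (hm : ∀ i ∈ s, Measurable (F i))
    (hB : ∀ i ∈ s, 0 ≤ B i) : MeanLE P (fun ω => ∑ i ∈ s, F i ω) (∑ i ∈ s, B i) := by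
  classical
  induction s using Finset.induction_on with
  | empty => simp [MeanLE]
  | insert a s ha ih =>
    simp only [Finset.mem_insert, forall_eq_or_imp] at hF hm hB
    simp_rw [Finset.sum_insert ha]
    exact hF.1.add (ih hF.2 hm.2 hB.2) hm.1 hB.1 (Finset.sum_nonneg hB.2)

/-- The passage from mean bounds to Bochner integrals. `F` need be neither measurable nor
integrable, because the integral defaults to zero. -/
theorem MeanLE.abs_integral_le {F G : Ω → ℝ} {B : ℝ} (h : MeanLE P G B) (hFG : ∀ᵐ ω ∂P, |F ω| ≤ G ω)
    (hB : 0 ≤ B) : |∫ ω, F ω ∂P| ≤ B := by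
  have h1 : ENNReal.ofReal ‖∫ ω, F ω ∂P‖ ≤ ENNReal.ofReal B := by
    rw [ofReal_norm]
    refine (enorm_integral_le_lintegral_enorm F).trans (le_trans (lintegral_mono_ae ?_) h)
    filter_upwards [hFG] with ω hω
    rw [← ofReal_norm]
    exact ENNReal.ofReal_le_ofReal hω
  exact (ENNReal.ofReal_le_ofReal_iff hB).1 h1

/-- Swapping the order of integration in a bound on means. -/
theorem MeanLE.of_prod {Ω' : Type*} [MeasurableSpace Ω'] {Q : Measure Ω'} [SFinite P] [SFinite Q]
    [IsProbabilityMeasure P] {F : Ω → Ω' → ℝ} {B : ℝ} (hF : Measurable (Function.uncurry F))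
    (h : ∀ ω, MeanLE Q (F ω) B) (h0 : ∀ ω ω', 0 ≤ F ω ω')
    (hi : ∀ ω', Integrable (fun ω => F ω ω') P) :
    MeanLE Q (fun ω' => ∫ ω, F ω ω' ∂P) B := by
  unfold MeanLE
  have : ∀ ω', ENNReal.ofReal (∫ ω, F ω ω' ∂P) = ∫⁻ ω, ENNReal.ofReal (F ω ω') ∂P := by
    exact fun ω' =>
      ofReal_integral_eq_lintegral_ofReal (hi ω') (Eventually.of_forall fun ω => h0 ω ω')
  simp_rw [this]
  rw [lintegral_lintegral_swap]
  · calc _ ≤ ∫⁻ _, ENNReal.ofReal B ∂P := lintegral_mono fun ω => h ω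
      _ = _ := by simp
  · exact (hF.comp measurable_swap).ennreal_ofReal.aemeasurable

/-- The mean absolute deviation is bounded by the standard deviation. -/
theorem meanLE_abs_sub [IsProbabilityMeasure P] {X : Ω → ℝ} {m V : ℝ} (hX : Measurable X)
    (h0 : ∀ ω, 0 ≤ X ω) (hm : 0 ≤ m) (hV : 0 ≤ V)
    (h1 : ∫⁻ ω, ENNReal.ofReal (X ω) ∂P = ENNReal.ofReal m)
    (h2 : ∫⁻ ω, ENNReal.ofReal (X ω) ^ 2 ∂P ≤ ENNReal.ofReal (m ^ 2 + V)) :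
    MeanLE P (fun ω => |X ω - m|) (Real.sqrt V) := by
  simp_rw [← ENNReal.ofReal_pow (h0 _)] at h2
  have i1 : Integrable X P := by
    refine ⟨hX.aestronglyMeasurable, ?_⟩
    rw [hasFiniteIntegral_iff_ofReal (Eventually.of_forall h0), h1]
    exact ENNReal.ofReal_lt_top
  have i2 : Integrable (fun ω => X ω ^ 2) P := by
    refine ⟨(hX.pow_const 2).aestronglyMeasurable, ?_⟩
    rw [hasFiniteIntegral_iff_ofReal (Eventually.of_forall fun ω => sq_nonneg _)]
    exact h2.trans_lt ENNReal.ofReal_lt_top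
  have e1 : ∫ ω, X ω ∂P = m := by
    rw [integral_eq_lintegral_of_nonneg_ae (Eventually.of_forall h0) hX.aestronglyMeasurable, h1,
      ENNReal.toReal_ofReal hm]
  have e2 : ∫ ω, X ω ^ 2 ∂P ≤ m ^ 2 + V := by
    rw [integral_eq_lintegral_of_nonneg_ae (Eventually.of_forall fun ω => sq_nonneg _)
      (hX.pow_const 2).aestronglyMeasurable]
    exact ENNReal.toReal_le_of_le_ofReal (by positivity) h2
  have i3 : Integrable (fun ω => |X ω - m|) P := (i1.sub (integrable_const m)).abs
  set c := ∫ ω, |X ω - m| ∂P with hc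
  -- Expanding this square gives c² ≤ E(X - m)² ≤ V.
  have key : 0 ≤ ∫ ω, (|X ω - m| - c) ^ 2 ∂P := integral_nonneg fun ω => sq_nonneg _
  have hexp : ∀ ω, (|X ω - m| - c) ^ 2 = X ω ^ 2 - 2 * m * X ω + m ^ 2 - 2 * c * |X ω - m| + c ^ 2 := by
    intro ω
    have := sq_abs (X ω - m)
    nlinarith
  simp_rw [hexp] at key
  have j1 : Integrable (fun ω => X ω ^ 2 - 2 * m * X ω) P := i2.sub (i1.const_mul _)
  have j2 : Integrable (fun ω => X ω ^ 2 - 2 * m * X ω + m ^ 2) P := j1.add (integrable_const _)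
  have j3 : Integrable (fun ω => X ω ^ 2 - 2 * m * X ω + m ^ 2 - 2 * c * |X ω - m|) P :=
    j2.sub (i3.const_mul _)
  rw [integral_add j3 (integrable_const _), integral_sub j2 (i3.const_mul _),
    integral_add j1 (integrable_const _),
    integral_sub i2 (i1.const_mul _), integral_const_mul, integral_const_mul, e1, ← hc] at key
  simp only [integral_const, probReal_univ, one_smul] at key
  have hcV : c ≤ Real.sqrt V := Real.le_sqrt_of_sq_le (by nlinarith)
  unfold MeanLE
  rw [← ofReal_integral_eq_lintegral_ofReal i3 (Eventually.of_forall fun ω => abs_nonneg _)]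
  exact ENNReal.ofReal_le_ofReal hcV

end MeanLE

/-! ### Mean bounds for sums over a Poisson process -/

section Poisson

variable {Z : Type*} [MeasurableSpace Z] {Λ : ℝ} {ν : Measure Z} [IsProbabilityMeasure ν]

theorem ofReal_sum_le {ι : Type*} (s : Finset ι) (f : ι → ℝ) :
    ENNReal.ofReal (∑ i ∈ s, f i) ≤ ∑ i ∈ s, ENNReal.ofReal (f i) :=
  Finset.le_sum_of_subadditive _ ENNReal.ofReal_zero.le (fun _ _ => ENNReal.ofReal_add_le) _ _

/-- A bound on the mean of a sum over the points of a Poisson process. -/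
theorem meanLE_sum_rest (hΛ : 0 ≤ Λ) {e : Z → Conf Z → ℝ} (he : Measurable (Function.uncurry e))
    {B : ℝ} (h : ∀ᵐ z ∂ν, MeanLE (poissonProcess Λ ν) (e z) B) :
    MeanLE (poissonProcess Λ ν) (fun ω => ∑ i, e (ω.2 i) (rest ω i)) (Λ * B) := by
  unfold MeanLE
  calc _ ≤ ∫⁻ ω, ∑ i, ENNReal.ofReal (e (ω.2 i) (rest ω i)) ∂(poissonProcess Λ ν) :=
        lintegral_mono fun ω => ofReal_sum_le _ _
    _ = ENNReal.ofReal Λ * ∫⁻ z, ∫⁻ ω, ENNReal.ofReal (e z ω) ∂(poissonProcess Λ ν) ∂ν :=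
        lintegral_sum_rest hΛ (g := fun z ω => ENNReal.ofReal (e z ω)) he.ennreal_ofReal
    _ ≤ ENNReal.ofReal Λ * ∫⁻ _, ENNReal.ofReal B ∂ν := by
        exact mul_le_mul_right (lintegral_mono_ae h) _
    _ = _ := by rw [ENNReal.ofReal_mul hΛ]; simp

theorem meanLE_sum_conf (hΛ : 0 ≤ Λ) {h : Z → ℝ} (hh : Measurable h) (h0 : ∀ z, 0 ≤ h z)
    (hi : Integrable h ν) :
    MeanLE (poissonProcess Λ ν) (fun ω => ∑ i, h (ω.2 i)) (Λ * ∫ z, h z ∂ν) := by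
  unfold MeanLE
  simp_rw [ENNReal.ofReal_sum_of_nonneg fun i _ => h0 _]
  rw [lintegral_sum_conf hΛ hh.ennreal_ofReal, ENNReal.ofReal_mul hΛ,
    ofReal_integral_eq_lintegral_ofReal hi (Eventually.of_forall h0)]

/-- The mean absolute deviation of a sum over the points of a Poisson process. -/
theorem meanLE_abs_sum_sub (hΛ : 0 ≤ Λ) {h : Z → ℝ} (hh : Measurable h) (h0 : ∀ z, 0 ≤ h z)
    (h1 : ∀ z, h z ≤ 1) :
    MeanLE (poissonProcess Λ ν) (fun ω => |∑ i, h (ω.2 i) - Λ * ∫ z, h z ∂ν|)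
      (Real.sqrt (Λ * ∫ z, h z ∂ν)) := by
  have := isProbabilityMeasure_poissonProcess (ν := ν) hΛ
  have hi : Integrable h ν := Integrable.of_bound hh.aestronglyMeasurable 1
    (Eventually.of_forall fun z => by rw [Real.norm_of_nonneg (h0 z)]; exact h1 z)
  have hint : 0 ≤ ∫ z, h z ∂ν := integral_nonneg h0
  have hm : ENNReal.ofReal (Λ * ∫ z, h z ∂ν) =
      ENNReal.ofReal Λ * ∫⁻ z, ENNReal.ofReal (h z) ∂ν := by
    rw [ENNReal.ofReal_mul hΛ, ofReal_integral_eq_lintegral_ofReal hi (Eventually.of_forall h0)]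
  refine meanLE_abs_sub (measurable_sum_conf hh) (fun ω => Finset.sum_nonneg fun i _ => h0 _)
    (by positivity) (by positivity) ?_ ?_
  · simp_rw [ENNReal.ofReal_sum_of_nonneg fun i _ => h0 _]
    rw [lintegral_sum_conf hΛ hh.ennreal_ofReal, hm]
  · simp_rw [ENNReal.ofReal_sum_of_nonneg fun i _ => h0 _]
    rw [lintegral_sq_sum_conf hΛ hh.ennreal_ofReal, add_comm,
      ENNReal.ofReal_add (by positivity) (by positivity), ENNReal.ofReal_pow (by positivity), hm]
    -- Since 0 ≤ h ≤ 1, h² ≤ h, so the variance is at most the mean.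
    gcongr with z
    rw [← ENNReal.ofReal_pow (h0 z)]
    exact ENNReal.ofReal_le_ofReal (by nlinarith [h0 z, h1 z])

theorem measurable_card : Measurable fun ω : Conf Z => (ω.1 : ℝ) :=
  measurable_of_sigma fun n => (measurable_const : Measurable fun _ : Fin n → Z => (n : ℝ))

theorem integrable_card (hΛ : 0 ≤ Λ) :
    Integrable (fun ω : Conf Z => (ω.1 : ℝ)) (poissonProcess Λ ν) := by
  refine ⟨measurable_card.aestronglyMeasurable, ?_⟩
  rw [hasFiniteIntegral_iff_ofReal (Eventually.of_forall fun ω => by positivity)]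
  have := lintegral_sum_conf (ν := ν) hΛ (h := fun _ => 1) measurable_const
  simp only [Finset.sum_const, Finset.card_univ, Fintype.card_fin, nsmul_eq_mul, mul_one,
    lintegral_const, measure_univ] at this
  simp only [ENNReal.ofReal_natCast, this, ENNReal.ofReal_lt_top]

theorem integral_card (hΛ : 0 ≤ Λ) : ∫ ω : Conf Z, (ω.1 : ℝ) ∂(poissonProcess Λ ν) = Λ := by
  rw [integral_eq_lintegral_of_nonneg_ae (Eventually.of_forall fun ω => by positivity)
    (integrable_card hΛ).1]
  have := lintegral_sum_conf (ν := ν) hΛ (h := fun _ => 1) measurable_const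
  simp only [Finset.sum_const, Finset.card_univ, Fintype.card_fin, nsmul_eq_mul, mul_one,
    lintegral_const, measure_univ] at this
  simp only [ENNReal.ofReal_natCast, this, ENNReal.toReal_ofReal hΛ]

/-- The mean over the points of the proportion of the other points with a property. -/
theorem meanLE_sum_div_card (hΛ : 0 ≤ Λ) {h : Z → ℝ} (hh : Measurable h) (h0 : ∀ z, 0 ≤ h z)
    (hi : Integrable h ν) :
    MeanLE (poissonProcess Λ ν) (fun ω => (∑ i, h (ω.2 i)) / ω.1) (∫ z, h z ∂ν) := by
  have := isProbabilityMeasure_poissonProcess (ν := ν) hΛ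
  unfold MeanLE
  have hm : Measurable fun ω : Conf Z => ENNReal.ofReal ((∑ i, h (ω.2 i)) / ω.1) :=
    ((measurable_sum_conf hh).div measurable_card).ennreal_ofReal
  rw [lintegral_poissonProcess hm]
  have h1 : ∑' n, poissonWeight Λ n = 1 := by
    simpa using tsum_poissonWeight_mul_pow hΛ zero_le_one
  calc _ ≤ ∑' n, poissonWeight Λ n * ENNReal.ofReal (∫ z, h z ∂ν) := by
        refine ENNReal.tsum_le_tsum fun n => ?_
        refine mul_le_mul_right ?_ _
        change ∫⁻ x : Fin n → Z, ENNReal.ofReal ((∑ i : Fin n, h (x i)) / n) ∂(Measure.pi fun _ => ν) ≤ _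
        simp_rw [div_eq_inv_mul, ENNReal.ofReal_mul (show 0 ≤ (n : ℝ)⁻¹ by positivity),
          ENNReal.ofReal_sum_of_nonneg fun i _ => h0 _]
        have hmi (i : Fin n) : Measurable fun x : Fin n → Z => ENNReal.ofReal (h (x i)) :=
          (hh.comp (measurable_pi_apply i)).ennreal_ofReal
        rw [lintegral_const_mul' _ _ ENNReal.ofReal_ne_top, lintegral_finsetSum _ fun i _ => hmi i]
        have : ∀ i : Fin n, ∫⁻ x : Fin n → Z, ENNReal.ofReal (h (x i)) ∂(Measure.pi fun _ => ν) =
            ENNReal.ofReal (∫ z, h z ∂ν) := by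
          intro i
          rw [ofReal_integral_eq_lintegral_ofReal hi (Eventually.of_forall h0)]
          exact (measurePreserving_eval (fun _ : Fin n => ν) i).lintegral_comp hh.ennreal_ofReal
        rw [Finset.sum_congr rfl fun i _ => this i]
        simp only [Finset.sum_const, Finset.card_univ, Fintype.card_fin, nsmul_eq_mul]
        rw [← mul_assoc, ← ENNReal.ofReal_natCast, ← ENNReal.ofReal_mul (by positivity)]
        -- Only an inequality holds: the factor n⁻¹ n is 0 for n = 0 and 1 otherwise.
        refine mul_le_of_le_one_left' (by
          rw [← ENNReal.ofReal_one]; exact ENNReal.ofReal_le_ofReal (inv_mul_le_one))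
    _ = _ := by rw [ENNReal.tsum_mul_right, h1, one_mul]

end Poisson

/-! ### Resampling of marks -/

section Marks

variable {X Y : Type*} [MeasurableSpace X] [MeasurableSpace Y] {ν₁ : Measure X} {ν₂ : Measure Y}
  [IsProbabilityMeasure ν₁] [IsProbabilityMeasure ν₂] {Λ : ℝ}

/-- The configuration `ω` with the marks replaced by `m`. -/
def remark (ω : Conf (X × Y)) (m : Fin ω.1 → Y) : Conf (X × Y) := ⟨ω.1, fun i => ((ω.2 i).1, m i)⟩

theorem measurePreserving_remark (n : ℕ) :
    MeasurePreserving (fun p : (Fin n → X × Y) × (Fin n → Y) => fun i => ((p.1 i).1, p.2 i))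
      ((Measure.pi fun _ : Fin n => ν₁.prod ν₂).prod (Measure.pi fun _ : Fin n => ν₂))
      (Measure.pi fun _ : Fin n => ν₁.prod ν₂) := by
  have h1 : MeasurePreserving (fun p : (X × Y) × Y => (p.1.1, p.2)) ((ν₁.prod ν₂).prod ν₂)
      (ν₁.prod ν₂) := measurePreserving_fst.prod (MeasurePreserving.id ν₂)
  have h2 := measurePreserving_pi (fun _ : Fin n => (ν₁.prod ν₂).prod ν₂) (fun _ => ν₁.prod ν₂)
    (f := fun _ p => (p.1.1, p.2)) fun _ => h1
  exact h2.comp (measurePreserving_arrowProdEquivProdArrow (X × Y) Y (Fin n)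
    (fun _ => ν₁.prod ν₂) (fun _ => ν₂)).symm

/-- Given the number of points, the marks are independent of the positions and of each other, so
fresh marks leave the law unchanged. This permits averaging over the ALOHA variables with the
positions held fixed. -/
theorem integral_remark {f : Conf (X × Y) → ℝ}
    (hf : Integrable f (poissonProcess Λ (ν₁.prod ν₂))) :
    Integrable (fun ω => ∫ m, f (remark ω m) ∂(Measure.pi fun _ => ν₂))
      (poissonProcess Λ (ν₁.prod ν₂)) ∧
    ∫ ω, ∫ m, f (remark ω m) ∂(Measure.pi fun _ => ν₂) ∂(poissonProcess Λ (ν₁.prod ν₂)) =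
      ∫ ω, f ω ∂(poissonProcess Λ (ν₁.prod ν₂)) := by
  have hemb (n : ℕ) := measurableEmbedding_sigmaMk (X := fun n => Fin n → X × Y) n
  have hw (n : ℕ) : poissonWeight Λ n ≠ ⊤ := ENNReal.ofReal_ne_top
  by_cases hw0 : ∀ n, poissonWeight Λ n = 0
  · have : poissonProcess Λ (ν₁.prod ν₂) = 0 := by
      simp [poissonProcess, hw0]
    simp [this]
  have hsum := integrable_sum_measure_iff.1 hf
  -- Integrability on the n-point layer follows only where its weight is nonzero; layers of weight
  -- zero contribute nothing.
  have hfn : ∀ n, poissonWeight Λ n ≠ 0 →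
      Integrable (fun x => f ⟨n, x⟩) (Measure.pi fun _ : Fin n => ν₁.prod ν₂) := by
    intro n hn
    have := hsum.1 n
    rw [integrable_smul_measure hn (hw n), (hemb n).integrable_map_iff] at this
    exact this
  have hprod : ∀ n, poissonWeight Λ n ≠ 0 → Integrable
      (fun p : (Fin n → X × Y) × (Fin n → Y) => f (remark ⟨n, p.1⟩ p.2))
      ((Measure.pi fun _ : Fin n => ν₁.prod ν₂).prod (Measure.pi fun _ : Fin n => ν₂)) :=
    fun n hn => ((measurePreserving_remark n).integrable_comp
      (hfn n hn).aestronglyMeasurable).2 (hfn n hn)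
  have hint : ∀ (g : Conf (X × Y) → ℝ) (n : ℕ),
      ∫ ω, g ω ∂(poissonWeight Λ n • (Measure.pi fun _ : Fin n => ν₁.prod ν₂).map (Sigma.mk n)) =
      (poissonWeight Λ n).toReal * ∫ x, g ⟨n, x⟩ ∂(Measure.pi fun _ : Fin n => ν₁.prod ν₂) := by
    intro g n
    rw [integral_smul_measure, (hemb n).integral_map, smul_eq_mul]
  have hmp : ∀ (g : Conf (X × Y) → ℝ) (n : ℕ),
      Integrable (fun x => g ⟨n, x⟩) (Measure.pi fun _ : Fin n => ν₁.prod ν₂) →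
      ∫ x, ∫ m, g (remark ⟨n, x⟩ m) ∂(Measure.pi fun _ : Fin n => ν₂)
        ∂(Measure.pi fun _ : Fin n => ν₁.prod ν₂) =
      ∫ x, g ⟨n, x⟩ ∂(Measure.pi fun _ : Fin n => ν₁.prod ν₂) := by
    intro g n hg
    have h1 := (measurePreserving_remark (ν₁ := ν₁) (ν₂ := ν₂) n)
    have h2 := (h1.integrable_comp hg.aestronglyMeasurable).2 hg
    have h3 := integral_prod _ h2
    have h4 := integral_map h1.measurable.aemeasurable (f := fun x => g ⟨n, x⟩) (by
        rw [h1.map_eq]; exact hg.aestronglyMeasurable)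
    rw [h1.map_eq] at h4
    exact h3.symm.trans h4.symm
  have hI : Integrable (fun ω => ∫ m, f (remark ω m) ∂(Measure.pi fun _ => ν₂))
      (poissonProcess Λ (ν₁.prod ν₂)) := by
    refine integrable_sum_measure_iff.2 ⟨fun n => ?_, ?_⟩
    · by_cases hn : poissonWeight Λ n = 0
      · rw [hn, zero_smul]; exact integrable_zero_measure
      rw [integrable_smul_measure hn (hw n), (hemb n).integrable_map_iff]
      exact (hprod n hn).integral_prod_left
    · refine Summable.of_nonneg_of_le (fun n => integral_nonneg fun _ => norm_nonneg _)
        (fun n => ?_) hsum.2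
      rw [hint _ n, hint _ n]
      by_cases hn : poissonWeight Λ n = 0
      · simp [hn]
      gcongr ?_ * ?_
      rw [← hmp (fun ω => ‖f ω‖) n (hfn n hn).norm]
      refine integral_mono (hprod n hn).integral_prod_left.norm
        (hprod n hn).norm.integral_prod_left fun x => ?_
      exact norm_integral_le_integral_norm _
  refine ⟨hI, ?_⟩
  conv_lhs => rw [poissonProcess]
  conv_rhs => rw [poissonProcess]
  rw [integral_sum_measure hI, integral_sum_measure hf]
  congr with n
  rw [hint _ n, hint _ n]
  by_cases hn : poissonWeight Λ n = 0
  · simp [hn]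
  rw [← hmp f n (hfn n hn)]

end Marks

/-! ### The progress as a linear function of the success probabilities -/

open Classical in
/-- The total progress if a transmission from `i` to `k` has success probability `s i k`. -/
def weightedProgress (T : Traffic) (R : ℝ) {n : ℕ} (x : Fin n → Plane) (s : Fin n → Fin n → ℝ) : ℝ :=
  ∑ i, ∑ j, T.destProb x i j *
    ((∑ k ∈ candidates x R i j, progress x i j k * s i k) / ((candidates x R i j).card : ℝ))

theorem Traffic.destProb_nonneg (T : Traffic) {n : ℕ} (x : Fin n → Plane) (i j : Fin n) :
    0 ≤ T.destProb x i j := by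
  unfold Traffic.destProb
  split_ifs with h
  · exact le_rfl
  · have h1 := T.own_mem n x i
    have h2 := T.relayed_nonneg n x i j
    have hn : (1 : ℝ) ≤ n := by
      have : 1 ≤ n := by have := i.2; omega
      exact_mod_cast this
    exact add_nonneg (mul_nonneg h1.1 (by rw [one_div]; exact inv_nonneg.2 (by linarith)))
      (mul_nonneg (by linarith [h1.2]) h2)

theorem Traffic.destProb_self (T : Traffic) {n : ℕ} (x : Fin n → Plane) (i : Fin n) :
    T.destProb x i i = 0 := by simp [Traffic.destProb]

theorem Traffic.sum_destProb (T : Traffic) {n : ℕ} (hn : 2 ≤ n) (x : Fin n → Plane) (i : Fin n) :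
    ∑ j, T.destProb x i j = 1 := by
  classical
  have h1 : ∀ j, T.destProb x i j = (if j = i then 0 else T.own n x i * (1 / ((n : ℝ) - 1))) +
      (1 - T.own n x i) * T.relayed n x i j := by
    intro j
    unfold Traffic.destProb
    by_cases h : j = i
    · subst h; simp [T.relayed_self]
    · simp [h]
  simp_rw [h1]
  rw [Finset.sum_add_distrib, ← Finset.mul_sum, T.relayed_sum n x i hn, Finset.sum_ite]
  have hn' : (n : ℝ) - 1 ≠ 0 := by
    have : (2 : ℝ) ≤ n := by exact_mod_cast hn
    linarith
  simp only [Finset.sum_const_zero, Finset.sum_const, Finset.filter_ne', nsmul_eq_mul,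
    Finset.card_erase_of_mem (Finset.mem_univ i), Finset.card_univ, Fintype.card_fin]
  rw [Nat.cast_sub (by omega)]
  field_simp
  push_cast
  ring

theorem Traffic.sum_destProb_le_one (T : Traffic) {n : ℕ} (x : Fin n → Plane) (i : Fin n) :
    ∑ j, T.destProb x i j ≤ 1 := by
  by_cases hn : 2 ≤ n
  · exact (T.sum_destProb hn x i).le
  · have : ∀ j, j = i := fun j => by have := i.2; have := j.2; apply Fin.ext; omega
    refine (Finset.sum_nonpos fun j _ => ?_).trans zero_le_one
    rw [this j, T.destProb_self]

theorem mem_candidates_of_lt {n : ℕ} {x : Fin n → Plane} {R : ℝ} {i j k : Fin n}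
    (h : R < dist (x i) (x j)) :
    k ∈ candidates x R i j ↔ k ≠ i ∧ x k ∈ halfDisk (x i) (x j) R := by
  classical
  rw [candidates, if_neg h.not_ge, Finset.mem_filter, and_iff_right (Finset.mem_univ k)]

theorem candidates_dist_le {n : ℕ} {x : Fin n → Plane} {R : ℝ} {i j k : Fin n}
    (hk : k ∈ candidates x R i j) : dist (x k) (x i) ≤ R := by
  by_cases h : dist (x i) (x j) ≤ R
  · rw [candidates, if_pos h, Finset.mem_singleton] at hk
    rw [hk, dist_comm]; exact h
  · exact ((mem_candidates_of_lt (not_le.1 h)).1 hk).2.1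

theorem abs_progress_le {n : ℕ} (x : Fin n → Plane) (i j k : Fin n) :
    |progress x i j k| ≤ dist (x k) (x i) := by
  rw [progress, dist_comm (x k) (x i)]
  exact abs_dist_sub_le _ _ _

/-- By the triangle inequality a hop progresses by at most its length, hence by at most `R`. An
empty set of candidates gives 0 / 0 = 0, in accordance with a node that has no relay. -/
theorem abs_average_le {n : ℕ} {x : Fin n → Plane} {R c : ℝ} {i j : Fin n} {s : Fin n → ℝ}
    (hc : 0 ≤ c) (hR : 0 ≤ R) (hs : ∀ k ∈ candidates x R i j, |s k| ≤ c) :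
    |(∑ k ∈ candidates x R i j, progress x i j k * s k) / ((candidates x R i j).card : ℝ)| ≤
      R * c := by
  rw [abs_div, Nat.abs_cast]
  refine div_le_of_le_mul₀ (by positivity) (by positivity) ?_
  refine (Finset.abs_sum_le_sum_abs _ _).trans ?_
  rw [mul_comm, ← nsmul_eq_mul]
  refine Finset.sum_le_card_nsmul _ _ _ fun k hk => ?_
  rw [abs_mul]
  exact mul_le_mul ((abs_progress_le x i j k).trans (candidates_dist_le hk)) (hs k hk)
    (abs_nonneg _) hR

theorem abs_weightedProgress_le (T : Traffic) {R : ℝ} (hR : 0 ≤ R) {n : ℕ} (x : Fin n → Plane)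
    {s : Fin n → Fin n → ℝ} {c : Fin n → ℝ} (hc : ∀ i, 0 ≤ c i) (hs : ∀ i k, |s i k| ≤ c i) :
    |weightedProgress T R x s| ≤ R * ∑ i, c i := by
  unfold weightedProgress
  rw [Finset.mul_sum]
  refine (Finset.abs_sum_le_sum_abs _ _).trans (Finset.sum_le_sum fun i _ => ?_)
  refine (Finset.abs_sum_le_sum_abs _ _).trans ?_
  calc _ ≤ ∑ j, T.destProb x i j * (R * c i) := by
        refine Finset.sum_le_sum fun j _ => ?_
        rw [abs_mul, abs_of_nonneg (T.destProb_nonneg x i j)]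
        exact mul_le_mul_of_nonneg_left (abs_average_le (hc i) hR fun k _ => hs i k)
          (T.destProb_nonneg x i j)
    _ = (∑ j, T.destProb x i j) * (R * c i) := by rw [Finset.sum_mul]
    _ ≤ 1 * (R * c i) :=
        mul_le_mul_of_nonneg_right (T.sum_destProb_le_one x i) (mul_nonneg hR (hc i))
    _ = _ := one_mul _

theorem Traffic.measurable_destProb (T : Traffic) (n : ℕ) (i j : Fin n) :
    Measurable fun x : Fin n → Plane => T.destProb x i j := by
  unfold Traffic.destProb
  by_cases h : j = i
  · simp [h]
  · simp only [h, if_false]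
    exact ((T.own_measurable n i).mul_const _).add
      (((T.own_measurable n i).const_sub 1).mul (T.relayed_measurable n i j))

theorem measurableSet_candidates (R : ℝ) {n : ℕ} (i j k : Fin n) :
    MeasurableSet {x : Fin n → Plane | k ∈ candidates x R i j} := by
  have h1 : MeasurableSet {x : Fin n → Plane | dist (x i) (x j) ≤ R} :=
    measurableSet_le (by fun_prop) measurable_const
  have h2 : MeasurableSet {x : Fin n → Plane | x k ∈ halfDisk (x i) (x j) R} := by
    have a : MeasurableSet {x : Fin n → Plane | dist (x k) (x i) ≤ R} :=
      measurableSet_le (by fun_prop) measurable_const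
    have b : MeasurableSet {x : Fin n → Plane | (0 : ℝ) ≤ inner ℝ (x k - x i) (x j - x i)} :=
      measurableSet_le measurable_const (by fun_prop)
    exact a.inter b
  have : {x : Fin n → Plane | k ∈ candidates x R i j} =
      ({x : Fin n → Plane | dist (x i) (x j) ≤ R} ∩ {_x | k = j}) ∪
      ({x : Fin n → Plane | dist (x i) (x j) ≤ R}ᶜ ∩
        ({_x | k ≠ i} ∩ {x : Fin n → Plane | x k ∈ halfDisk (x i) (x j) R})) := by
    ext x
    simp only [Set.mem_ofPred_eq, candidates, Set.mem_union, Set.mem_inter_iff, Set.mem_compl_iff]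
    split_ifs with h <;> simp [h]
  rw [this]
  exact (h1.inter (MeasurableSet.const _)).union
    (h1.compl.inter ((MeasurableSet.const _).inter h2))

theorem measurable_weightedProgress {α : Type*} [MeasurableSpace α] (T : Traffic) (R : ℝ) {n : ℕ}
    {x : α → Fin n → Plane} (hx : Measurable x) {s : α → Fin n → Fin n → ℝ}
    (hs : ∀ i k, Measurable fun a => s a i k) :
    Measurable fun a => weightedProgress T R (x a) (s a) := by
  classical
  have hxi : ∀ i, Measurable fun a => x a i := fun i => (measurable_pi_apply i).comp hx
  unfold weightedProgress
  refine Finset.measurable_sum _ fun i _ => Finset.measurable_sum _ fun j _ =>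
    ((T.measurable_destProb n i j).comp hx).mul (Measurable.div ?_ ?_)
  · have : ∀ a, ∑ k ∈ candidates (x a) R i j, progress (x a) i j k * s a i k =
        ∑ k, if k ∈ candidates (x a) R i j then progress (x a) i j k * s a i k else 0 := by
      intro a; rw [Finset.sum_ite_mem, Finset.univ_inter]
    simp_rw [this]
    refine Finset.measurable_sum _ fun k _ => Measurable.ite (hx (measurableSet_candidates R i j k))
      (Measurable.mul ?_ (hs i k)) measurable_const
    exact ((hxi i).dist (hxi j)).sub ((hxi k).dist (hxi j))
  · have : ∀ a, ((candidates (x a) R i j).card : ℝ) =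
        ∑ k, if k ∈ candidates (x a) R i j then 1 else 0 := by
      intro a; simp
    simp_rw [this]
    exact Finset.measurable_sum _ fun k _ =>
      Measurable.ite (hx (measurableSet_candidates R i j k)) measurable_const measurable_const

/-- Averaging the progress over random success indicators. -/
theorem integral_weightedProgress {α : Type*} [MeasurableSpace α] {P : Measure α} (T : Traffic)
    (R : ℝ) {n : ℕ} (x : Fin n → Plane) {s : α → Fin n → Fin n → ℝ}
    (hs : ∀ i k, Integrable (fun a => s a i k) P) :
    ∫ a, weightedProgress T R x (s a) ∂P =
      weightedProgress T R x fun i k => ∫ a, s a i k ∂P := by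
  unfold weightedProgress
  have h1 : ∀ i j, Integrable (fun a =>
      ∑ k ∈ candidates x R i j, progress x i j k * s a i k) P := fun i j =>
    integrable_finsetSum _ fun k _ => (hs i k).const_mul _
  have h2 : ∀ i j, Integrable (fun a => T.destProb x i j *
      ((∑ k ∈ candidates x R i j, progress x i j k * s a i k) /
        ((candidates x R i j).card : ℝ))) P := fun i j => ((h1 i j).div_const _).const_mul _
  rw [integral_finsetSum _ fun i _ => integrable_finsetSum _ fun j _ => h2 i j]
  refine Finset.sum_congr rfl fun i _ => ?_
  rw [integral_finsetSum _ fun j _ => h2 i j]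
  refine Finset.sum_congr rfl fun j _ => ?_
  rw [integral_const_mul, integral_div, integral_finsetSum _ fun k _ => (hs i k).const_mul _]
  simp_rw [integral_const_mul]

/-! ### The laws of the nodes -/

/-- The law of a position. -/
def posLaw (ρ : ℝ) : Measure Plane := ProbabilityTheory.cond volume (region ρ)

/-- The law of an ALOHA variable. -/
def markLaw : Measure ℝ := volume.restrict (Set.Icc 0 1)

instance : IsProbabilityMeasure markLaw := ⟨by simp [markLaw]⟩

theorem nodeLaw_eq (ρ : ℝ) : nodeLaw ρ = (posLaw ρ).prod markLaw := rfl

theorem volume_real_closedBall (x : Plane) {r : ℝ} (hr : 0 ≤ r) :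
    volume.real (Metric.closedBall x r) = Real.pi * r ^ 2 := by
  rw [Measure.real, EuclideanSpace.volume_closedBall_fin_two, ENNReal.toReal_mul,
    ENNReal.toReal_pow, ENNReal.toReal_ofReal hr, ENNReal.toReal_ofReal Real.pi_pos.le, mul_comm]

theorem volume_real_region {ρ : ℝ} (hρ : 0 < ρ) : volume.real (region ρ) = Real.pi * ρ ^ 2 :=
  volume_real_closedBall 0 hρ.le

theorem isProbabilityMeasure_posLaw {ρ : ℝ} (hρ : 0 < ρ) : IsProbabilityMeasure (posLaw ρ) := by
  have h : volume (region ρ) ≠ 0 := (Metric.measure_closedBall_pos volume 0 hρ).ne'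
  have h' : volume (region ρ) ≠ ⊤ := measure_closedBall_lt_top.ne
  exact ProbabilityTheory.cond_isProbabilityMeasure_of_finite h h'

theorem isProbabilityMeasure_nodeLaw {ρ : ℝ} (hρ : 0 < ρ) : IsProbabilityMeasure (nodeLaw ρ) := by
  have := isProbabilityMeasure_posLaw hρ
  rw [nodeLaw_eq]; infer_instance

theorem markLaw_Iio {q : ℝ} (h0 : 0 ≤ q) (h1 : q ≤ 1) : markLaw.real (Set.Iio q) = q := by
  rw [markLaw, Measure.real, Measure.restrict_apply measurableSet_Iio]
  have : Set.Iio q ∩ Set.Icc 0 1 = Set.Ico 0 q := by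
    ext t; simp only [Set.mem_inter_iff, Set.mem_Iio, Set.mem_Icc, Set.mem_Ico]
    constructor
    · rintro ⟨a, b, c⟩; exact ⟨b, a⟩
    · rintro ⟨a, b⟩; exact ⟨b, a, by linarith⟩
  rw [this, Real.volume_Ico, ENNReal.toReal_ofReal (by linarith), sub_zero]

/-! ### Success probabilities given the positions -/

theorem measurable_primaryFree (q r : ℝ) :
    Measurable fun p : Config × Plane => primaryFree p.1 q r p.2 := by
  refine measurable_of_sigma_prod fun n => ?_
  change Measurable fun p : (Fin n → Plane × ℝ) × Plane =>
    ∀ k : Fin n, (p.1 k).2 < q → r < dist (p.1 k).1 p.2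
  refine Measurable.forall fun k => Measurable.imp ?_ ?_
  · exact measurableSet_setOfPred.1 (measurableSet_lt (by fun_prop) measurable_const)
  · exact measurableSet_setOfPred.1 (measurableSet_lt measurable_const (by fun_prop))

open Classical in
/-- The indicator that no primary node within distance `r` of `y` transmits. -/
def freeInd (ωp : Config) (qp r : ℝ) (y : Plane) : ℝ := if primaryFree ωp qp r y then 1 else 0

theorem freeInd_nonneg (ωp : Config) (qp r : ℝ) (y : Plane) : 0 ≤ freeInd ωp qp r y := by
  unfold freeInd; split_ifs <;> norm_num

theorem freeInd_le_one (ωp : Config) (qp r : ℝ) (y : Plane) : freeInd ωp qp r y ≤ 1 := by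
  unfold freeInd; split_ifs <;> norm_num

theorem measurable_freeInd (q r : ℝ) :
    Measurable fun p : Config × Plane => freeInd p.1 q r p.2 :=
  Measurable.ite (measurableSet_setOfPred.2 (measurable_primaryFree q r)) measurable_const
    measurable_const

open Classical in
/-- The number of potential interferers at node `k` of a transmission from node `i`. -/
def interferers (ωp : Config) (qp RD RI : ℝ) {n : ℕ} (x : Fin n → Plane) (i k : Fin n) : ℕ :=
  (Finset.univ.filter fun m => m ≠ i ∧ dist (x m) (x k) ≤ RI ∧ primaryFree ωp qp RD (x m)).card

/-- The probability, given the positions and the primary network, that a transmission from `i` to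
`k` is successful, divided by the access probability. -/
def reach (ωp : Config) (qp qs RD RI RIps : ℝ) {n : ℕ} (x : Fin n → Plane) (i k : Fin n) : ℝ :=
  freeInd ωp qp RD (x i) * freeInd ωp qp RIps (x k) * (1 - qs) ^ interferers ωp qp RD RI x i k

theorem reach_nonneg {ωp : Config} {qp qs RD RI RIps : ℝ} (hq : qs ≤ 1) {n : ℕ}
    (x : Fin n → Plane) (i k : Fin n) : 0 ≤ reach ωp qp qs RD RI RIps x i k :=
  mul_nonneg (mul_nonneg (freeInd_nonneg _ _ _ _) (freeInd_nonneg _ _ _ _))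
    (pow_nonneg (by linarith) _)

theorem reach_le {ωp : Config} {qp qs RD RI RIps : ℝ} (hq0 : 0 ≤ qs) (hq : qs ≤ 1) {n : ℕ}
    (x : Fin n → Plane) (i k : Fin n) :
    reach ωp qp qs RD RI RIps x i k ≤ freeInd ωp qp RD (x i) := by
  unfold reach
  have h1 := freeInd_nonneg ωp qp RD (x i)
  have h2 := freeInd_le_one ωp qp RIps (x k)
  have h3 : (1 - qs) ^ interferers ωp qp RD RI x i k ≤ 1 := pow_le_one₀ (by linarith) (by linarith)
  rw [mul_assoc]
  exact mul_le_of_le_one_right h1 (mul_le_one₀ h2 (pow_nonneg (by linarith) _) h3)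

open Classical in
theorem pow_interferers_eq_prod (c : ℝ) (ωp : Config) (qp RD RI : ℝ) {n : ℕ} (x : Fin n → Plane)
    (i k : Fin n) : c ^ interferers ωp qp RD RI x i k =
      ∏ m, if m ≠ i ∧ dist (x m) (x k) ≤ RI ∧ primaryFree ωp qp RD (x m) then c else 1 := by
  rw [Finset.prod_ite]
  simp only [Finset.prod_const, one_pow, mul_one, interferers]

theorem measurable_primaryFree_node (qp r : ℝ) {n : ℕ} (m : Fin n) :
    Measurable fun p : Config × (Fin n → Plane) => primaryFree p.1 qp r (p.2 m) :=
  (measurable_primaryFree qp r).comp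
    (measurable_fst.prodMk ((measurable_pi_apply m).comp measurable_snd))

theorem measurable_reach (qp qs RD RI RIps : ℝ) {n : ℕ} (i k : Fin n) :
    Measurable fun p : Config × (Fin n → Plane) => reach p.1 qp qs RD RI RIps p.2 i k := by
  classical
  have hx : ∀ i : Fin n, Measurable fun p : Config × (Fin n → Plane) => (p.1, p.2 i) := fun i =>
    measurable_fst.prodMk ((measurable_pi_apply i).comp measurable_snd)
  unfold reach
  refine (((measurable_freeInd qp RD).comp (hx i)).mul
    ((measurable_freeInd qp RIps).comp (hx k))).mul ?_
  simp_rw [pow_interferers_eq_prod]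
  refine Finset.measurable_prod _ fun m _ => Measurable.ite ?_ measurable_const measurable_const
  refine measurableSet_setOfPred.2 (Measurable.and measurable_const (Measurable.and ?_ ?_))
  · exact measurableSet_setOfPred.1 (measurableSet_le (by fun_prop) measurable_const)
  · exact measurable_primaryFree_node qp RD m

theorem measurable_secondarySuccess (qp qs RD RI RIps : ℝ) {n : ℕ} (i k : Fin n) :
    Measurable fun p : Config × (Fin n → Plane × ℝ) =>
      secondarySuccess p.1 ⟨n, p.2⟩ qp qs RD RI RIps i k := by
  have hx : Measurable fun p : Config × (Fin n → Plane × ℝ) =>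
      (p.1, fun l => (p.2 l).1) := by fun_prop
  have hfree : ∀ (r : ℝ) (m : Fin n), Measurable fun p : Config × (Fin n → Plane × ℝ) =>
      primaryFree p.1 qp r (p.2 m).1 := fun r m => (measurable_primaryFree_node qp r m).comp hx
  have htx : ∀ m : Fin n, Measurable fun p : Config × (Fin n → Plane × ℝ) =>
      (p.2 m).2 < qs ∧ primaryFree p.1 qp RD (p.2 m).1 := fun m =>
    (measurableSet_setOfPred.1 (measurableSet_lt (by fun_prop) measurable_const)).and (hfree RD m)
  change Measurable fun p : Config × (Fin n → Plane × ℝ) =>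
    (((p.2 i).2 < qs ∧ primaryFree p.1 qp RD (p.2 i).1) ∧
      ∀ m : Fin n, m ≠ i → dist (p.2 m).1 (p.2 k).1 ≤ RI →
        ¬ ((p.2 m).2 < qs ∧ primaryFree p.1 qp RD (p.2 m).1)) ∧ primaryFree p.1 qp RIps (p.2 k).1
  refine ((htx i).and (Measurable.forall fun m => measurable_const.imp (Measurable.imp ?_
    (htx m).not))).and (hfree RIps k)
  exact measurableSet_setOfPred.1 (measurableSet_le (by fun_prop) measurable_const)

open Classical in
/-- The success probability, averaged over the ALOHA variables. -/
theorem integral_marks_success (ωp : Config) {qp qs RD RI RIps : ℝ} (hq0 : 0 ≤ qs) (hq1 : qs ≤ 1)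
    (ωs : Config) (i k : Fin ωs.1) :
    ∫ m, (if secondarySuccess ωp (remark ωs m) qp qs RD RI RIps i k then (1 : ℝ) else 0)
      ∂(Measure.pi fun _ => markLaw) = qs * reach ωp qp qs RD RI RIps ωs.pos i k := by
  obtain ⟨n, z⟩ := ωs
  set x : Fin n → Plane := fun i => (z i).1 with hx
  change Fin n at i k
  set S : (Fin n → ℝ) → Prop := fun m =>
    secondarySuccess ωp (remark ⟨n, z⟩ m) qp qs RD RI RIps i k with hS
  have hSdef : ∀ m, S m ↔ (((m i < qs ∧ primaryFree ωp qp RD (x i)) ∧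
      ∀ l : Fin n, l ≠ i → dist (x l) (x k) ≤ RI →
        ¬ (m l < qs ∧ primaryFree ωp qp RD (x l))) ∧ primaryFree ωp qp RIps (x k)) :=
    fun m => Iff.rfl
  change ∫ m : Fin n → ℝ, (if S m then (1 : ℝ) else 0)
      ∂(Measure.pi fun _ => markLaw) = qs * reach ωp qp qs RD RI RIps x i k
  by_cases h : primaryFree ωp qp RD (x i) ∧ primaryFree ωp qp RIps (x k)
  -- Given positions and primary network, success is a product event in the marks: the mark of `i`
  -- is below `qs`, those of the free nodes in range of `k` are not, and the others are
  -- unrestricted.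
  · set E : Fin n → Set ℝ := fun l => if l = i then Set.Iio qs else
      if dist (x l) (x k) ≤ RI ∧ primaryFree ωp qp RD (x l) then (Set.Iio qs)ᶜ else Set.univ with hE
    have h1 : ∀ m : Fin n → ℝ, S m ↔ m ∈ Set.univ.pi E := by
      intro m
      rw [hSdef]
      simp only [h.1, h.2, and_true, Set.mem_pi, Set.mem_univ, forall_true_left, hE]
      constructor
      · rintro ⟨a, b⟩ l
        split_ifs with c d
        · subst c; exact a
        · exact fun hl => b l c d.1 ⟨hl, d.2⟩
        · trivial
      · intro H
        refine ⟨by simpa using H i, fun l hl hd => ?_⟩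
        rintro ⟨a, b⟩
        have := H l
        rw [if_neg hl, if_pos ⟨hd, b⟩] at this
        exact this a
    simp_rw [h1]
    have h2 : (fun m : Fin n → ℝ => if m ∈ Set.univ.pi E then (1 : ℝ) else 0) =
        (Set.univ.pi E).indicator 1 := by
      ext m; simp [Set.indicator_apply]
    have hEm : ∀ l, MeasurableSet (E l) := by
      intro l; simp only [hE]; split_ifs
      · exact measurableSet_Iio
      · exact measurableSet_Iio.compl
      · exact MeasurableSet.univ
    rw [h2, integral_indicator_one (MeasurableSet.univ_pi hEm), Measure.real, Measure.pi_pi,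
      ENNReal.toReal_prod, ← Finset.mul_prod_erase _ _ (Finset.mem_univ i)]
    have e1 : (markLaw (E i)).toReal = qs := by
      simp only [hE, if_true]; exact markLaw_Iio hq0 hq1
    rw [e1, reach, freeInd, freeInd, if_pos h.1, if_pos h.2, pow_interferers_eq_prod,
      ← Finset.mul_prod_erase _ _ (Finset.mem_univ i)]
    simp only [ne_eq, not_true_eq_false, false_and, if_false, one_mul]
    congr 1
    refine Finset.prod_congr rfl fun l hl => ?_
    have hl' := Finset.ne_of_mem_erase hl
    simp only [hE, hl', if_false, not_false_eq_true, true_and]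
    split_ifs with c
    · change markLaw.real _ = _
      rw [probReal_compl_eq_one_sub measurableSet_Iio, markLaw_Iio hq0 hq1]
    · simp
  · have h1 : ∀ m : Fin n → ℝ, ¬ S m :=
      fun m H => h ⟨((hSdef m).1 H).1.1.2, ((hSdef m).1 H).2⟩
    simp only [h1, if_false, integral_zero]
    rw [reach, freeInd, freeInd]
    by_cases h2 : primaryFree ωp qp RD (x i)
    · have h3 : ¬ primaryFree ωp qp RIps (x k) := fun h3 => h ⟨h2, h3⟩
      simp [h3]
    · simp [h2]

/-- The success probability given the positions, divided by the access probability. -/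
def meanReach (Pp : Measure Config) (qp qs RD RI RIps : ℝ) {n : ℕ} (x : Fin n → Plane)
    (i k : Fin n) : ℝ := ∫ ωp, reach ωp qp qs RD RI RIps x i k ∂Pp

/-- The throughput in terms of the success probabilities given the positions. -/
theorem secondaryThroughput_eq {ρ densP densS R RI RIps RD qp qs : ℝ} (hρ : 0 < ρ)
    (hP : 0 ≤ densP) (hS : 0 ≤ densS) (hR : 0 ≤ R) (hq0 : 0 ≤ qs) (hq1 : qs ≤ 1) (T : Traffic) :
    Integrable (fun ωs : Config => weightedProgress T R ωs.pos fun i k =>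
      qs * meanReach (poissonLaw ρ densP) qp qs RD RI RIps ωs.pos i k) (poissonLaw ρ densS) ∧
    secondaryThroughput ρ densP densS T R RI RIps RD qp qs =
      ∫ ωs, weightedProgress T R ωs.pos (fun i k =>
        qs * meanReach (poissonLaw ρ densP) qp qs RD RI RIps ωs.pos i k) ∂(poissonLaw ρ densS) := by
  classical
  have := isProbabilityMeasure_posLaw hρ
  have := isProbabilityMeasure_nodeLaw hρ
  have hv : 0 ≤ volume.real (region ρ) := measureReal_nonneg
  have hPp : IsProbabilityMeasure (poissonLaw ρ densP) :=
    isProbabilityMeasure_poissonProcess (by positivity)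
  have hPs : IsProbabilityMeasure (poissonLaw ρ densS) :=
    isProbabilityMeasure_poissonProcess (by positivity)
  set f : Config × Config → ℝ := fun ω =>
    totalProgress T R ω.2.pos (secondarySuccess ω.1 ω.2 qp qs RD RI RIps) with hf
  have hind : ∀ (p : Prop) [Decidable p], |if p then (1 : ℝ) else 0| ≤ 1 := by
    intro p _; split_ifs <;> simp
  have hindm : ∀ {n : ℕ} (i k : Fin n), Measurable fun p : Config × (Fin n → Plane × ℝ) =>
      if secondarySuccess p.1 ⟨n, p.2⟩ qp qs RD RI RIps i k then (1 : ℝ) else 0 := fun i k =>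
    Measurable.ite (measurableSet_setOfPred.2 (measurable_secondarySuccess qp qs RD RI RIps i k))
      measurable_const measurable_const
  have hfm : Measurable f := by
    refine measurable_of_prod_sigma fun n => ?_
    change Measurable fun p : Config × (Fin n → Plane × ℝ) =>
      weightedProgress T R (fun i => (p.2 i).1) fun i k =>
        if secondarySuccess p.1 ⟨n, p.2⟩ qp qs RD RI RIps i k then (1 : ℝ) else 0
    exact measurable_weightedProgress T R (by fun_prop) fun i k => hindm i k
  have hfb : ∀ ω, |f ω| ≤ R * ω.2.1 := by
    intro ω
    have := abs_weightedProgress_le T hR ω.2.pos (s := fun i k =>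
      if secondarySuccess ω.1 ω.2 qp qs RD RI RIps i k then (1 : ℝ) else 0) (c := fun _ => 1)
      (fun _ => zero_le_one) (fun i k => hind _)
    simp only [Finset.sum_const, Finset.card_univ, Fintype.card_fin, nsmul_eq_mul, mul_one] at this
    exact this
  have hfi : Integrable f ((poissonLaw ρ densP).prod (poissonLaw ρ densS)) := by
    have h1 : Integrable (fun ω : Config => (ω.1 : ℝ)) (poissonLaw ρ densS) :=
      integrable_card (by positivity)
    refine Integrable.mono' ((h1.comp_snd (poissonLaw ρ densP)).const_mul R)
      hfm.aestronglyMeasurable (Eventually.of_forall fun ω => hfb ω)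
  have e1 : secondaryThroughput ρ densP densS T R RI RIps RD qp qs =
      ∫ ωs, ∫ ωp, f (ωp, ωs) ∂(poissonLaw ρ densP) ∂(poissonLaw ρ densS) :=
    integral_prod_symm f hfi
  -- The primary network is integrated first, then the marks are resampled. Destinations and
  -- candidates depend on positions only, so both averages act on the success indicators alone.
  have h2 := integral_remark (ν₁ := posLaw ρ) (ν₂ := markLaw) hfi.integral_prod_right
  have e3 : ∀ ωs : Config, ∫ m, ∫ ωp, f (ωp, remark ωs m) ∂(poissonLaw ρ densP)
      ∂(Measure.pi fun _ => markLaw) = weightedProgress T R ωs.pos (fun i k =>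
        qs * meanReach (poissonLaw ρ densP) qp qs RD RI RIps ωs.pos i k) := by
    intro ωs
    have hsm : ∀ i k : Fin ωs.1, Measurable fun p : (Fin ωs.1 → ℝ) × Config =>
        if secondarySuccess p.2 (remark ωs p.1) qp qs RD RI RIps i k then (1 : ℝ) else 0 := by
      intro i k
      have : Measurable fun p : (Fin ωs.1 → ℝ) × Config =>
        (p.2, fun i => ((ωs.2 i).1, p.1 i)) := by fun_prop
      exact (hindm i k).comp this
    have hsi : ∀ i k : Fin ωs.1, Integrable (fun p : (Fin ωs.1 → ℝ) × Config =>
        if secondarySuccess p.2 (remark ωs p.1) qp qs RD RI RIps i k then (1 : ℝ) else 0)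
        ((Measure.pi fun _ => markLaw).prod (poissonLaw ρ densP)) := fun i k =>
      Integrable.of_bound (hsm i k).aestronglyMeasurable 1 (Eventually.of_forall fun p => hind _)
    have hfi' : Integrable (fun p : (Fin ωs.1 → ℝ) × Config => f (p.2, remark ωs p.1))
        ((Measure.pi fun _ => markLaw).prod (poissonLaw ρ densP)) := by
      refine Integrable.of_bound (Measurable.aestronglyMeasurable ?_) (R * ωs.1)
        (Eventually.of_forall fun p => hfb _)
      have : Measurable fun p : (Fin ωs.1 → ℝ) × Config => (p.2, remark ωs p.1) :=
        measurable_snd.prodMk ((measurable_sigmaMk (X := fun n => Fin n → Plane × ℝ) ωs.1).comp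
          (by fun_prop : Measurable fun p : (Fin ωs.1 → ℝ) × Config =>
            fun i => ((ωs.2 i).1, p.1 i)))
      exact hfm.comp this
    rw [← integral_prod (fun p : (Fin ωs.1 → ℝ) × Config => f (p.2, remark ωs p.1)) hfi']
    refine (integral_weightedProgress T R ωs.pos hsi).trans ?_
    congr 1
    ext i k
    rw [integral_prod_symm _ (hsi i k)]
    simp_rw [integral_marks_success _ hq0 hq1]
    rw [integral_const_mul, meanReach]
  have h4 : (fun ωs : Config => ∫ m, ∫ ωp, f (ωp, remark ωs m) ∂(poissonLaw ρ densP)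
      ∂(Measure.pi fun _ => markLaw)) = fun ωs => weightedProgress T R ωs.pos (fun i k =>
        qs * meanReach (poissonLaw ρ densP) qp qs RD RI RIps ωs.pos i k) := funext e3
  have h5 := h2
  simp_rw [e3] at h5
  exact ⟨h5.1, e1.trans h5.2.symm⟩

/-! ### Test functions on the unit disk -/

open Classical in
/-- The positive part of the projection on `v`, on the unit disk. -/
def projFn (v y : Plane) : ℝ := if ‖y‖ ≤ 1 then max 0 (inner ℝ y v) else 0

open Classical in
/-- The indicator of the cap `{τ ≤ ⟪y, v⟫}` of the unit disk. -/
def capFn (v : Plane) (τ : ℝ) (y : Plane) : ℝ := if ‖y‖ ≤ 1 ∧ τ ≤ inner ℝ y v then 1 else 0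

/-- Measurable functions with values in `[0, 1]` that vanish off the unit disk. -/
structure IsTestFn (g : Plane → ℝ) : Prop where
  measurable : Measurable g
  nonneg : ∀ y, 0 ≤ g y
  le_one : ∀ y, g y ≤ 1
  eq_zero : ∀ y, 1 < ‖y‖ → g y = 0

theorem isTestFn_projFn {v : Plane} (hv : ‖v‖ = 1) : IsTestFn (projFn v) where
  measurable := Measurable.ite (measurableSet_le (by fun_prop) measurable_const) (by fun_prop)
    measurable_const
  nonneg y := by unfold projFn; split_ifs <;> simp
  le_one y := by
    unfold projFn; split_ifs with h
    · refine max_le zero_le_one ((real_inner_le_norm y v).trans ?_)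
      rw [hv, mul_one]; exact h
    · exact zero_le_one
  eq_zero y hy := by rw [projFn, if_neg hy.not_ge]

theorem isTestFn_capFn (v : Plane) (τ : ℝ) : IsTestFn (capFn v τ) where
  measurable := by
    have h1 : MeasurableSet {y : Plane | ‖y‖ ≤ 1} := measurableSet_le (by fun_prop) measurable_const
    have h2 : MeasurableSet {y : Plane | τ ≤ inner ℝ y v} :=
      measurableSet_le measurable_const (by fun_prop)
    exact Measurable.ite (h1.inter h2) measurable_const measurable_const
  nonneg y := by unfold capFn; split_ifs <;> simp
  le_one y := by unfold capFn; split_ifs <;> simp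
  eq_zero y hy := by rw [capFn, if_neg (fun h => hy.not_ge h.1)]

theorem IsTestFn.le_indicator {g : Plane → ℝ} (hg : IsTestFn g) (y : Plane) :
    g y ≤ (Metric.closedBall (0 : Plane) 1).indicator 1 y := by
  by_cases hy : ‖y‖ ≤ 1
  · rw [Set.indicator_of_mem (by simpa using hy)]; exact hg.le_one y
  · rw [hg.eq_zero y (not_le.1 hy)]
    exact Set.indicator_nonneg (fun _ _ => zero_le_one) _

theorem integrable_indicator_disk :
    Integrable ((Metric.closedBall (0 : Plane) 1).indicator (1 : Plane → ℝ)) :=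
  (integrable_indicator_iff Metric.isClosed_closedBall.measurableSet).2
    (integrableOn_const (measure_closedBall_lt_top.ne))

theorem IsTestFn.integrable {g : Plane → ℝ} (hg : IsTestFn g) : Integrable g :=
  integrable_indicator_disk.mono' hg.measurable.aestronglyMeasurable
    (Eventually.of_forall fun y => by
      rw [Real.norm_of_nonneg (hg.nonneg y)]; exact hg.le_indicator y)

theorem IsTestFn.integral_le {g : Plane → ℝ} (hg : IsTestFn g) : ∫ y, g y ≤ Real.pi := by
  calc ∫ y, g y ≤ ∫ y, (Metric.closedBall (0 : Plane) 1).indicator (1 : Plane → ℝ) y :=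
        integral_mono hg.integrable integrable_indicator_disk hg.le_indicator
    _ = Real.pi := by
        rw [integral_indicator_one Metric.isClosed_closedBall.measurableSet,
          volume_real_closedBall 0 zero_le_one]; ring

theorem exists_isometry {v w : Plane} (h : ‖v‖ = ‖w‖) : ∃ e : Plane ≃ₗᵢ[ℝ] Plane, e v = w :=
  ⟨_, Submodule.reflection_sub h⟩

/-- A unit vector. -/
def unitVec : Plane := EuclideanSpace.single 0 1

theorem norm_unitVec : ‖unitVec‖ = 1 := by simp [unitVec]

/-- A linear isometry carrying one direction to the other preserves area, so one constant serves all
destinations. -/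
theorem integral_projFn {v : Plane} (hv : ‖v‖ = 1) : ∫ y, projFn v y = ∫ y, projFn unitVec y := by
  obtain ⟨e, he⟩ := exists_isometry (norm_unitVec.trans hv.symm)
  rw [← (e.measurePreserving).integral_comp' (f := e.toHomeomorph.toMeasurableEquiv) (projFn v)]
  congr with y
  change projFn v (e y) = _
  simp only [projFn, e.norm_map]
  rw [← he, e.inner_map_map]

theorem integral_capFn {v : Plane} (hv : ‖v‖ = 1) (τ : ℝ) :
    ∫ y, capFn v τ y = ∫ y, capFn unitVec τ y := by
  obtain ⟨e, he⟩ := exists_isometry (norm_unitVec.trans hv.symm)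
  rw [← (e.measurePreserving).integral_comp' (f := e.toHomeomorph.toMeasurableEquiv) (capFn v τ)]
  congr with y
  change capFn v τ (e y) = _
  simp only [capFn, e.norm_map]
  rw [← he, e.inner_map_map]

/-- The integral of the projection over the half-disk. -/
def projInt : ℝ := ∫ y, projFn unitVec y

/-- The area of the half-disk. -/
def capInt : ℝ := ∫ y, capFn unitVec 0 y

/-- The mean progress, relative to the transmission range, towards a distant destination. -/
def meanProgress : ℝ := projInt / capInt

/-- A ball inside the open half-disk makes the integrals defining `projInt` and `capInt` positive.
-/
theorem half_unitVec_ball {y : Plane} (hy : y ∈ Metric.ball ((1 / 2 : ℝ) • unitVec) (1 / 4)) :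
    ‖y‖ ≤ 1 ∧ 0 < inner ℝ y unitVec := by
  have h1 : ‖y - (1 / 2 : ℝ) • unitVec‖ < 1 / 4 := by rwa [mem_ball_iff_norm] at hy
  have h2 : ‖(1 / 2 : ℝ) • unitVec‖ = 1 / 2 := by rw [norm_smul, norm_unitVec]; norm_num
  constructor
  · have := norm_add_le (y - (1 / 2 : ℝ) • unitVec) ((1 / 2 : ℝ) • unitVec)
    rw [sub_add_cancel] at this
    linarith
  · have h3 := (abs_le.1 (abs_real_inner_le_norm (y - (1 / 2 : ℝ) • unitVec) unitVec)).1
    rw [inner_sub_left, inner_smul_left, real_inner_self_eq_norm_sq, norm_unitVec] at h3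
    simp only [conj_trivial] at h3
    linarith

theorem volume_ball_pos (c : Plane) {r : ℝ} (hr : 0 < r) : 0 < volume (Metric.ball c r) :=
  Metric.measure_ball_pos volume c hr

theorem projInt_pos : 0 < projInt := by
  refine (integral_pos_iff_support_of_nonneg (isTestFn_projFn norm_unitVec).nonneg
    (isTestFn_projFn norm_unitVec).integrable).2 ((volume_ball_pos _ (by norm_num)).trans_le
      (measure_mono (s := Metric.ball ((1 / 2 : ℝ) • unitVec) (1 / 4)) fun y hy => ?_))
  have := half_unitVec_ball hy
  rw [Function.mem_support, projFn, if_pos this.1]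
  exact (this.2.trans_le (le_max_right _ _)).ne'

theorem capInt_pos : 0 < capInt := by
  refine (integral_pos_iff_support_of_nonneg (isTestFn_capFn unitVec 0).nonneg
    (isTestFn_capFn unitVec 0).integrable).2 ((volume_ball_pos _ (by norm_num)).trans_le
      (measure_mono (s := Metric.ball ((1 / 2 : ℝ) • unitVec) (1 / 4)) fun y hy => ?_))
  have := half_unitVec_ball hy
  rw [Function.mem_support, capFn, if_pos ⟨this.1, this.2.le⟩]
  exact one_ne_zero

theorem meanProgress_pos : 0 < meanProgress := div_pos projInt_pos capInt_pos

theorem meanProgress_le_one : meanProgress ≤ 1 := by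
  refine div_le_one_of_le₀ ?_ capInt_pos.le
  refine integral_mono (isTestFn_projFn norm_unitVec).integrable
    (isTestFn_capFn unitVec 0).integrable fun y => ?_
  unfold projFn capFn
  by_cases h1 : ‖y‖ ≤ 1
  · by_cases h2 : 0 ≤ inner ℝ y unitVec
    · rw [if_pos h1, if_pos ⟨h1, h2⟩, max_eq_right h2]
      refine (real_inner_le_norm y _).trans ?_
      rw [norm_unitVec, mul_one]; exact h1
    · rw [if_pos h1, if_neg (fun h => h2 h.2), max_eq_left (not_le.1 h2).le]
  · rw [if_neg h1, if_neg (fun h => h1 h.1)]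

/-- The indicators converge off the line orthogonal to `unitVec`, which is a null set, and the disk
dominates them. Hence half-disks of nearby directions, which are sandwiched between caps, have
nearly the same expected count. -/
theorem tendsto_capInt : Tendsto (fun τ => ∫ y, capFn unitVec τ y) (𝓝 0) (𝓝 capInt) := by
  refine tendsto_integral_filter_of_dominated_convergence
    ((Metric.closedBall (0 : Plane) 1).indicator 1)
    (Eventually.of_forall fun τ => (isTestFn_capFn _ τ).measurable.aestronglyMeasurable)
    (Eventually.of_forall fun τ => Eventually.of_forall fun y => by
      rw [Real.norm_of_nonneg ((isTestFn_capFn _ τ).nonneg y)]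
      exact (isTestFn_capFn _ τ).le_indicator y) integrable_indicator_disk ?_
  have hnull : volume {y : Plane | inner ℝ y unitVec = (0 : ℝ)} = 0 := by
    have h : ((ℝ ∙ unitVec)ᗮ : Submodule ℝ Plane) ≠ ⊤ := by
      intro h
      have : unitVec ∈ (ℝ ∙ unitVec)ᗮ := h ▸ Submodule.mem_top
      rw [Submodule.mem_orthogonal_singleton_iff_inner_left, real_inner_self_eq_norm_sq,
        norm_unitVec] at this
      norm_num at this
    have h2 := Measure.addHaar_submodule (volume : Measure Plane) _ h
    convert! h2 using 2
    ext y
    exact (Submodule.mem_orthogonal_singleton_iff_inner_left).symm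
  have : ∀ᵐ y : Plane, inner ℝ y unitVec ≠ (0 : ℝ) := by
    rw [ae_iff]; simpa using hnull
  filter_upwards [this] with y hy
  refine tendsto_const_nhds.congr' ?_
  rcases lt_or_gt_of_ne hy with h | h
  · filter_upwards [lt_mem_nhds h] with τ hτ
    simp [capFn, h.not_ge, hτ.not_ge]
  · filter_upwards [gt_mem_nhds h] with τ hτ
    simp [capFn, h.le, hτ.le]

/-! ### The progress at a typical node -/

/-- With c the projection of w on u, ‖w - p‖² = (D - c)² + ‖w‖² - c². This gives the lower bound D -
c, because |c| ≤ ‖w‖. The upper bound uses c ≤ R ≤ D / 2, whence R² ≤ 2 (R / M) (D - c): the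
correction to the linear approximation is at most R / M. -/
theorem abs_dist_sub_sub_inner_le {p w u : Plane} {D R M : ℝ} (hu : ‖u‖ = 1) (hw : ‖w‖ ≤ R)
    (hM : 2 ≤ M) (hR : 0 < R) (hD : M * R ≤ D) (hp : p = D • u) :
    |D - ‖w - p‖ - inner ℝ w u| ≤ R / M := by
  subst hp
  set c : ℝ := inner ℝ w u with hc
  have hcw : |c| ≤ ‖w‖ := by simpa [hu] using abs_real_inner_le_norm w u
  have hc' := abs_le.1 hcw
  have hDpos : 0 < D := by nlinarith
  have hsq : ‖w - D • u‖ ^ 2 = ‖w‖ ^ 2 - 2 * D * c + D ^ 2 := by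
    rw [norm_sub_sq_real, inner_smul_right, norm_smul, hu, Real.norm_eq_abs, mul_one, sq_abs]; ring
  set N := ‖w - D • u‖
  have hN : 0 ≤ N := norm_nonneg _
  have h1 : D - c ≤ N := by
    refine le_of_sq_le_sq ?_ hN |>.trans le_rfl
    nlinarith [sq_abs c, abs_nonneg c, norm_nonneg w]
  have h2 : N ≤ D - c + R / M := by
    have hRM : 0 < R / M := by positivity
    refine le_of_sq_le_sq ?_ (by nlinarith)
    have h3 : R / M * M = R := by field_simp
    have hDc : D / 2 ≤ D - c := by nlinarith
    have h5 : R ^ 2 ≤ 2 * (R / M) * (D - c) := by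
      have : R / M * (M * R) ≤ R / M * D := by gcongr
      nlinarith
    have h6 : ‖w‖ ^ 2 ≤ R ^ 2 := by gcongr
    nlinarith [sq_nonneg c, sq_nonneg (R / M)]
  rw [abs_le]; constructor <;> linarith [show 0 ≤ R / M by positivity]

open Classical in
/-- Comparison of the sums over the half-disk towards `u` with sums of test functions in a nearby
direction `v`. -/
theorem halfDisk_sums {ι : Type*} (K : Finset ι) (y : ι → Plane) {u v : Plane} {τ η L b α : ℝ}
    (huv : ‖u - v‖ ≤ τ)
    (ha : |∑ k ∈ K, projFn v (y k) - L * α| ≤ L * η)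
    (hp : ∑ k ∈ K, capFn v (-τ) (y k) ≤ L * (b + η))
    (hm : L * (b - η) ≤ ∑ k ∈ K, capFn v τ (y k))
    (hd : ∑ k ∈ K, capFn 0 0 (y k) ≤ 4 * L) :
    |∑ k ∈ K with ‖y k‖ ≤ 1 ∧ 0 ≤ inner ℝ (y k) u, inner ℝ (y k) u - L * α| ≤
      L * (η + 4 * τ) ∧
    |((K.filter fun k => ‖y k‖ ≤ 1 ∧ 0 ≤ inner ℝ (y k) u).card : ℝ) - L * b| ≤ L * η := by
  have hτ : 0 ≤ τ := (norm_nonneg _).trans huv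
  have hinner : ∀ z : Plane, ‖z‖ ≤ 1 → |inner ℝ z u - inner ℝ z v| ≤ τ := by
    intro z hz
    rw [← inner_sub_right]
    refine (abs_real_inner_le_norm _ _).trans ?_
    nlinarith [norm_nonneg z, norm_nonneg (u - v)]
  have e1 : ∑ k ∈ K with ‖y k‖ ≤ 1 ∧ 0 ≤ inner ℝ (y k) u, inner ℝ (y k) u =
      ∑ k ∈ K, projFn u (y k) := by
    rw [Finset.sum_filter]
    refine Finset.sum_congr rfl fun k _ => ?_
    unfold projFn
    by_cases h1 : ‖y k‖ ≤ 1
    · by_cases h2 : 0 ≤ inner ℝ (y k) u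
      · rw [if_pos ⟨h1, h2⟩, if_pos h1, max_eq_right h2]
      · rw [if_neg (fun h => h2 h.2), if_pos h1, max_eq_left (not_le.1 h2).le]
    · rw [if_neg (fun h => h1 h.1), if_neg h1]
  have e2 : ((K.filter fun k => ‖y k‖ ≤ 1 ∧ 0 ≤ inner ℝ (y k) u).card : ℝ) =
      ∑ k ∈ K, capFn u 0 (y k) := by
    simp [capFn]
  rw [e1, e2]
  constructor
  · have h1 : |∑ k ∈ K, projFn u (y k) - ∑ k ∈ K, projFn v (y k)| ≤
        τ * ∑ k ∈ K, capFn 0 0 (y k) := by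
      rw [← Finset.sum_sub_distrib, Finset.mul_sum]
      refine (Finset.abs_sum_le_sum_abs _ _).trans (Finset.sum_le_sum fun k _ => ?_)
      unfold projFn capFn
      by_cases h : ‖y k‖ ≤ 1
      · rw [if_pos h, if_pos h, if_pos ⟨h, by simp⟩, mul_one]
        refine le_trans ?_ (hinner _ h)
        have := abs_max_sub_max_le_max 0 (inner ℝ (y k) u) 0 (inner ℝ (y k) v)
        simpa using this
      · rw [if_neg h, if_neg h]; simp [h]
    have h2 : τ * ∑ k ∈ K, capFn 0 0 (y k) ≤ τ * (4 * L) := by gcongr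
    rw [abs_le] at *
    constructor <;> nlinarith
  -- On the unit disk the projections on u and v differ by at most τ, so the half-disk towards u
  -- contains the cap of v at level τ and lies in the one at level -τ.
  · have h1 : ∑ k ∈ K, capFn v τ (y k) ≤ ∑ k ∈ K, capFn u 0 (y k) := by
      refine Finset.sum_le_sum fun k _ => ?_
      unfold capFn
      by_cases h : ‖y k‖ ≤ 1 ∧ τ ≤ inner ℝ (y k) v
      · have := (abs_le.1 (hinner _ h.1)).1
        rw [if_pos h, if_pos ⟨h.1, by linarith [h.2]⟩]
      · rw [if_neg h]; split_ifs <;> simp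
    have h2 : ∑ k ∈ K, capFn u 0 (y k) ≤ ∑ k ∈ K, capFn v (-τ) (y k) := by
      refine Finset.sum_le_sum fun k _ => ?_
      unfold capFn
      by_cases h : ‖y k‖ ≤ 1 ∧ 0 ≤ inner ℝ (y k) u
      · have := (abs_le.1 (hinner _ h.1)).2
        rw [if_pos h, if_pos ⟨h.1, by linarith [h.2]⟩]
      · rw [if_neg h]; split_ifs <;> simp
    rw [abs_le]
    constructor <;> linarith

/-- The scale L cancels in X / Y; the condition η ≤ b / 2 keeps the denominator above L b / 2. -/
theorem abs_div_sub_div_le {X Y L α b η₁ η : ℝ} (hL : 0 < L) (hb : 0 < b) (hα : 0 ≤ α)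
    (hη : η ≤ b / 2) (hX : |X - L * α| ≤ L * η₁) (hY : |Y - L * b| ≤ L * η) :
    L * b / 2 ≤ Y ∧ |X / Y - α / b| ≤ 2 * η₁ / b + 2 * α * η / b ^ 2 := by
  have hYl : L * b / 2 ≤ Y := by nlinarith [(abs_le.1 hY).1]
  have hYp : 0 < Y := lt_of_lt_of_le (by positivity) hYl
  refine ⟨hYl, ?_⟩
  have h1 : X / Y - α / b = ((X - L * α) * b - α * (Y - L * b)) / (Y * b) := by
    field_simp; ring
  rw [h1, abs_div, abs_of_pos (mul_pos hYp hb), div_le_iff₀ (mul_pos hYp hb)]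
  have h2 : |(X - L * α) * b - α * (Y - L * b)| ≤ L * η₁ * b + α * (L * η) := by
    refine (abs_sub _ _).trans ?_
    rw [abs_mul, abs_mul, abs_of_pos hb, abs_of_nonneg hα]
    gcongr
  have hη0 : 0 ≤ η := by nlinarith [(abs_nonneg _).trans hY]
  have hη1 : 0 ≤ η₁ := by nlinarith [(abs_nonneg _).trans hX]
  have h3 : (2 * η₁ / b + 2 * α * η / b ^ 2) * (Y * b) ≥
      (2 * η₁ / b + 2 * α * η / b ^ 2) * (L * b / 2 * b) := by gcongr
  have h4 : (2 * η₁ / b + 2 * α * η / b ^ 2) * (L * b / 2 * b) = L * η₁ * b + α * (L * η) := by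
    field_simp
  linarith

/-- Destinations may depend on the positions arbitrarily, so concentration is needed in all
directions at once. Compactness of the circle reduces this to finitely many. -/
theorem exists_direction_net {τ : ℝ} (hτ : 0 < τ) : ∃ V : Finset Plane, (∀ v ∈ V, ‖v‖ = 1) ∧
    ∀ u : Plane, ‖u‖ = 1 → ∃ v ∈ V, ‖u - v‖ ≤ τ := by
  obtain ⟨t, ht, hf, hc⟩ := (isCompact_sphere (0 : Plane) 1).finite_cover_balls hτ
  refine ⟨hf.toFinset, fun v hv => by simpa using ht (hf.mem_toFinset.1 hv), fun u hu => ?_⟩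
  have := hc (show u ∈ Metric.sphere (0 : Plane) 1 by simpa using hu)
  simp only [Set.mem_iUnion, exists_prop] at this
  obtain ⟨v, hv, huv⟩ := this
  exact ⟨v, hf.mem_toFinset.2 hv, by rw [← dist_eq_norm]; exact (Metric.mem_ball.1 huv).le⟩

/-- The sum of a test function over the nodes around node `i`, at scale `R`. -/
def localSum (R : ℝ) {n : ℕ} (x : Fin n → Plane) (i : Fin n) (g : Plane → ℝ) : ℝ :=
  ∑ k with k ≠ i, g (R⁻¹ • (x k - x i))

/-- The deviation from `c` of the numbers `s k`, summed over the nodes `k` within range `R` of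
node `i`. -/
def rangeDeviation (R : ℝ) {n : ℕ} (x : Fin n → Plane) (i : Fin n) (s : Fin n → ℝ) (c : ℝ) : ℝ :=
  ∑ k with k ≠ i ∧ dist (x k) (x i) ≤ R, |s k - c|

theorem rangeDeviation_nonneg (R : ℝ) {n : ℕ} (x : Fin n → Plane) (i : Fin n) (s : Fin n → ℝ)
    (c : ℝ) : 0 ≤ rangeDeviation R x i s c := Finset.sum_nonneg fun _ _ => abs_nonneg _

/-- Three errors occur: replacing the progress by the projection on the direction of the destination
costs 1 / M; the ratio of the projection sum to the number of candidates deviates from `projInt /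
capInt`; and the fluctuations of `s` are divided by the number of candidates, which is at least
`capInt * L / 2`. -/
theorem abs_average_sub_le {n : ℕ} {x : Fin n → Plane} {i j : Fin n} {R L c M τ η : ℝ}
    {s : Fin n → ℝ} {v : Plane} (hR : 0 < R) (hL : 0 < L) (hM : 2 ≤ M)
    (hc0 : 0 ≤ c) (hc1 : c ≤ 1) (hη : η ≤ capInt / 2)
    (huv : ‖(dist (x i) (x j))⁻¹ • (x j - x i) - v‖ ≤ τ)
    (ha : |localSum R x i (projFn v) - L * projInt| ≤ L * η)
    (hp : localSum R x i (capFn v (-τ)) ≤ L * (capInt + η))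
    (hm : L * (capInt - η) ≤ localSum R x i (capFn v τ))
    (hd : localSum R x i (capFn 0 0) ≤ 4 * L) (hfar : M * R < dist (x i) (x j)) :
    |(∑ k ∈ candidates x R i j, progress x i j k * s k) / ((candidates x R i j).card : ℝ) -
      c * (meanProgress * R)| ≤
    R * (1 / M + (2 * (η + 4 * τ) / capInt + 2 * projInt * η / capInt ^ 2) +
      2 / (capInt * L) * rangeDeviation R x i s c) := by
  classical
  set D := dist (x i) (x j) with hDdef
  set u : Plane := D⁻¹ • (x j - x i) with hu
  have hD : 0 < D := lt_of_le_of_lt (by positivity) hfar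
  have hDn : ‖x j - x i‖ = D := by rw [hDdef, dist_comm, dist_eq_norm]
  have hu1 : ‖u‖ = 1 := by
    rw [hu, norm_smul, hDn, Real.norm_of_nonneg (by positivity), inv_mul_cancel₀ hD.ne']
  have hxu : x j - x i = D • u := by rw [hu, smul_smul, mul_inv_cancel₀ hD.ne', one_smul]
  set y : Fin n → Plane := fun k => R⁻¹ • (x k - x i) with hy
  have hRy : ∀ k, R * inner ℝ (y k) u = inner ℝ (x k - x i) u := by
    intro k; rw [hy, inner_smul_left]; simp only [conj_trivial]; field_simp
  have hny : ∀ k, ‖y k‖ ≤ 1 ↔ dist (x k) (x i) ≤ R := by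
    intro k
    rw [hy, norm_smul, norm_inv, Real.norm_of_nonneg hR.le, dist_eq_norm, inv_mul_le_one₀ hR]
  have hcand : candidates x R i j =
      (Finset.univ.filter fun k => k ≠ i).filter fun k => ‖y k‖ ≤ 1 ∧ 0 ≤ inner ℝ (y k) u := by
    ext k
    rw [mem_candidates_of_lt (by nlinarith), Finset.mem_filter, Finset.mem_filter, hny,
      and_iff_right (Finset.mem_univ k)]
    have : (0 ≤ inner ℝ (x k - x i) (x j - x i)) ↔ 0 ≤ inner ℝ (y k) u := by
      rw [hxu, inner_smul_right, ← hRy k]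
      constructor
      · intro h
        by_contra hneg
        have : inner ℝ (y k) u < 0 := not_le.1 hneg
        have := mul_neg_of_pos_of_neg hD (mul_neg_of_pos_of_neg hR this)
        linarith
      · intro h; positivity
    rw [halfDisk, Set.mem_ofPred_eq, this]
  obtain ⟨hs1, hs2⟩ := halfDisk_sums (Finset.univ.filter fun k => k ≠ i) y huv ha hp hm hd
  rw [← hcand] at hs1 hs2
  obtain ⟨hY, hratio⟩ := abs_div_sub_div_le hL capInt_pos projInt_pos.le hη hs1 hs2
  set N : ℝ := ((candidates x R i j).card : ℝ) with hN
  have hNpos : 0 < N := lt_of_lt_of_le (by have := capInt_pos; positivity) hY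
  set X := ∑ k ∈ candidates x R i j, inner ℝ (y k) u with hX
  have hdev : ∑ k ∈ candidates x R i j, |s k - c| ≤ rangeDeviation R x i s c := by
    refine Finset.sum_le_sum_of_subset_of_nonneg (fun k hk => ?_) fun _ _ _ => abs_nonneg _
    rw [Finset.mem_filter, and_iff_right (Finset.mem_univ k)]
    exact ⟨((mem_candidates_of_lt (by nlinarith)).1 hk).1, candidates_dist_le hk⟩
  have hmain : |∑ k ∈ candidates x R i j, progress x i j k * s k - c * (R * X)| ≤
      R * rangeDeviation R x i s c + N * (R / M) := by
    rw [hX, Finset.mul_sum, Finset.mul_sum, ← Finset.sum_sub_distrib]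
    refine (Finset.abs_sum_le_sum_abs _ _).trans ?_
    calc _ ≤ ∑ k ∈ candidates x R i j, (R * |s k - c| + R / M) := by
          refine Finset.sum_le_sum fun k hk => ?_
          have hdk := candidates_dist_le hk
          have h1 : |progress x i j k - R * inner ℝ (y k) u| ≤ R / M := by
            rw [hRy]
            have h := abs_dist_sub_sub_inner_le (w := x k - x i) hu1
              (by rw [← dist_eq_norm]; exact hdk) hM hR hfar.le hxu
            rwa [sub_sub_sub_cancel_right, ← dist_eq_norm (x k) (x j)] at h
          have h2 : progress x i j k * s k - c * (R * inner ℝ (y k) u) =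
              progress x i j k * (s k - c) + c * (progress x i j k - R * inner ℝ (y k) u) := by ring
          rw [h2]
          refine (abs_add_le _ _).trans (add_le_add ?_ ?_)
          · rw [abs_mul]
            exact mul_le_mul_of_nonneg_right ((abs_progress_le x i j k).trans hdk) (abs_nonneg _)
          · rw [abs_mul, abs_of_nonneg hc0]
            exact (mul_le_of_le_one_left (abs_nonneg _) hc1).trans h1
      _ ≤ _ := by
          rw [Finset.sum_add_distrib, ← Finset.mul_sum, Finset.sum_const, nsmul_eq_mul]
          gcongr
  have e : (∑ k ∈ candidates x R i j, progress x i j k * s k) / N - c * (meanProgress * R) =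
      (∑ k ∈ candidates x R i j, progress x i j k * s k - c * (R * X)) / N +
        c * R * (X / N - projInt / capInt) := by
    rw [meanProgress]; field_simp; ring
  rw [e]
  have h3 : |(∑ k ∈ candidates x R i j, progress x i j k * s k - c * (R * X)) / N| ≤
      R * (1 / M + 2 / (capInt * L) * rangeDeviation R x i s c) := by
    rw [abs_div, abs_of_pos hNpos, div_le_iff₀ hNpos]
    refine hmain.trans ?_
    have hdv := rangeDeviation_nonneg R x i s c
    have hb := capInt_pos
    have : rangeDeviation R x i s c ≤ 2 / (capInt * L) * rangeDeviation R x i s c * N := by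
      calc _ = 2 / (capInt * L) * rangeDeviation R x i s c * (L * capInt / 2) := by field_simp
        _ ≤ _ := by gcongr
    have h4 : R * rangeDeviation R x i s c ≤ R * (2 / (capInt * L) * rangeDeviation R x i s c * N) := by
      gcongr
    calc _ ≤ R * (2 / (capInt * L) * rangeDeviation R x i s c * N) + N * (R / M) := by gcongr
      _ = _ := by ring
  have h5 : |c * R * (X / N - projInt / capInt)| ≤
      R * (2 * (η + 4 * τ) / capInt + 2 * projInt * η / capInt ^ 2) := by
    rw [abs_mul, abs_of_nonneg (by positivity)]
    have : c * R ≤ R := mul_le_of_le_one_left hR.le hc1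
    exact mul_le_mul this hratio (abs_nonneg _) hR.le
  calc _ ≤ _ := abs_add_le _ _
    _ ≤ _ := add_le_add h3 h5
    _ = _ := by ring

/-- Finitely many test functions control the mean progress towards all distant destinations. -/
theorem exists_testFns {δ : ℝ} (hδ : 0 < δ) : ∃ (G : Finset (Plane → ℝ)) (η M : ℝ),
    0 < η ∧ 2 ≤ M ∧ (∀ g ∈ G, IsTestFn g) ∧
    ∀ (n : ℕ) (x : Fin n → Plane) (i j : Fin n) (R L c : ℝ) (s : Fin n → ℝ), 0 < R → 0 < L →
      0 ≤ c → c ≤ 1 → (∀ g ∈ G, |localSum R x i g - L * ∫ y, g y| ≤ L * η) →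
      M * R < dist (x i) (x j) →
      |(∑ k ∈ candidates x R i j, progress x i j k * s k) / ((candidates x R i j).card : ℝ) -
        c * (meanProgress * R)| ≤ R * (δ + 2 / (capInt * L) * rangeDeviation R x i s c) := by
  classical
  have hb := capInt_pos
  have hα := projInt_pos
  set A := 10 / capInt + 2 * projInt / capInt ^ 2 with hA
  have hApos : 0 < A := by positivity
  -- The bound `capInt / 2` protects the denominator, 1 / 2 keeps the count in the full disk below 4
  -- L (as π < 3.15), and the last one makes the ratio error A η at most δ / 2. The 10 in A comes
  -- from 2 (η + 4 τ) with τ ≤ η.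
  set η := min (capInt / 2) (min (1 / 2) (δ / 2 / A)) with hη
  have hηpos : 0 < η := by positivity
  have hη1 : η ≤ capInt / 2 := min_le_left _ _
  have hη2 : η ≤ 1 / 2 := (min_le_right _ _).trans (min_le_left _ _)
  have hη3 : A * η ≤ δ / 2 := by
    have : η ≤ δ / 2 / A := (min_le_right _ _).trans (min_le_right _ _)
    rw [le_div_iff₀ hApos] at this
    linarith
  obtain ⟨ε, hε, hball⟩ := Metric.eventually_nhds_iff.1
    (tendsto_capInt.eventually (Metric.ball_mem_nhds capInt (half_pos hηpos)))
  set τ := min (ε / 2) η with hτ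
  have hτpos : 0 < τ := by positivity
  have hτη : τ ≤ η := min_le_right _ _
  have hτε : τ < ε := (min_le_left _ _).trans_lt (half_lt_self hε)
  have hp1 : |(∫ y, capFn unitVec τ y) - capInt| < η / 2 := by
    have := hball (y := τ) (by rw [dist_zero_right, Real.norm_of_nonneg hτpos.le]; exact hτε)
    rwa [Real.dist_eq] at this
  have hp2 : |(∫ y, capFn unitVec (-τ) y) - capInt| < η / 2 := by
    have := hball (y := -τ) (by
      rw [dist_zero_right, norm_neg, Real.norm_of_nonneg hτpos.le]; exact hτε)
    rwa [Real.dist_eq] at this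
  obtain ⟨V, hV, hnet⟩ := exists_direction_net hτpos
  -- The tolerance η is split equally between the fluctuation of the sums and the difference between
  -- cap and half-disk areas; M is at least 2 / δ, so that 1 / M ≤ δ / 2.
  refine ⟨insert (capFn 0 0) (V.image projFn ∪ (V.image (fun v => capFn v τ) ∪
    V.image fun v => capFn v (-τ))), η / 2, max 2 (2 / δ), half_pos hηpos, le_max_left _ _, ?_, ?_⟩
  · intro g hg
    simp only [Finset.mem_insert, Finset.mem_union, Finset.mem_image] at hg
    rcases hg with rfl | ⟨v, hv, rfl⟩ | ⟨v, hv, rfl⟩ | ⟨v, hv, rfl⟩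
    exacts [isTestFn_capFn _ _, isTestFn_projFn (hV v hv), isTestFn_capFn _ _, isTestFn_capFn _ _]
  · intro n x i j R L c s hR hL hc0 hc1 hG hfar
    have hD : 0 < dist (x i) (x j) := lt_of_le_of_lt (by positivity) hfar
    obtain ⟨v, hv, huv⟩ := hnet ((dist (x i) (x j))⁻¹ • (x j - x i)) (by
      rw [norm_smul, ← dist_eq_norm, dist_comm (x j), norm_inv, Real.norm_of_nonneg hD.le,
        inv_mul_cancel₀ hD.ne'])
    have g1 := hG _ (Finset.mem_insert_self _ _)
    have g2 := hG (projFn v) (by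
      simp only [Finset.mem_insert, Finset.mem_union, Finset.mem_image]
      exact Or.inr (Or.inl ⟨v, hv, rfl⟩))
    have g3 := hG (capFn v τ) (by
      simp only [Finset.mem_insert, Finset.mem_union, Finset.mem_image]
      exact Or.inr (Or.inr (Or.inl ⟨v, hv, rfl⟩)))
    have g4 := hG (capFn v (-τ)) (by
      simp only [Finset.mem_insert, Finset.mem_union, Finset.mem_image]
      exact Or.inr (Or.inr (Or.inr ⟨v, hv, rfl⟩)))
    rw [integral_projFn (hV v hv)] at g2
    rw [integral_capFn (hV v hv), abs_le] at g3 g4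
    rw [abs_le] at g1
    rw [abs_lt] at hp1 hp2
    have hdisk := (isTestFn_capFn 0 0).integral_le
    have hpi := Real.pi_lt_d2
    have key := abs_average_sub_le (s := s) (M := max 2 (2 / δ)) (η := η) hR hL (le_max_left _ _)
      hc0 hc1 hη1 huv (g2.trans (by gcongr; linarith)) (by nlinarith) (by nlinarith) (by nlinarith)
      hfar
    refine key.trans (mul_le_mul_of_nonneg_left (add_le_add_left ?_ _) hR.le)
    have h1 : 1 / max 2 (2 / δ) ≤ δ / 2 := by
      rw [div_le_iff₀ (by positivity)]
      have : 2 / δ ≤ max 2 (2 / δ) := le_max_right _ _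
      calc (1 : ℝ) = δ / 2 * (2 / δ) := by field_simp
        _ ≤ _ := by gcongr
    have h2 : 2 * (η + 4 * τ) / capInt + 2 * projInt * η / capInt ^ 2 ≤ A * η := by
      have : 2 * (η + 4 * τ) / capInt ≤ 10 * η / capInt :=
        div_le_div_of_nonneg_right (by linarith) hb.le
      calc _ ≤ 10 * η / capInt + 2 * projInt * η / capInt ^ 2 := by gcongr
        _ = A * η := by rw [hA]; ring
    linarith

open Classical in
/-- The probability that the destination of the packet at node `i` is within distance `r`. -/
def nearProb (T : Traffic) (r : ℝ) {n : ℕ} (x : Fin n → Plane) (i : Fin n) : ℝ :=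
  ∑ j with dist (x i) (x j) ≤ r, T.destProb x i j

/-- The indicator of the disk of radius `r` around the centre of the region. -/
def coreInd (r : ℝ) (y : Plane) : ℝ := (Metric.closedBall (0 : Plane) r).indicator 1 y

theorem coreInd_eq (r : ℝ) (y : Plane) : coreInd r y = 0 ∨ coreInd r y = 1 ∧ ‖y‖ ≤ r := by
  unfold coreInd
  by_cases h : y ∈ Metric.closedBall (0 : Plane) r
  · right; rw [Set.indicator_of_mem h]; exact ⟨rfl, by simpa using h⟩
  · left; rw [Set.indicator_of_notMem h]

/-- A bound for the deviation of the total progress from its typical value. -/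
theorem exists_testFns_weightedProgress {δ : ℝ} (hδ : 0 < δ) :
    ∃ (G : Finset (Plane → ℝ)) (η M : ℝ), 0 < η ∧ 2 ≤ M ∧ (∀ g ∈ G, IsTestFn g) ∧
    ∀ (T : Traffic) (n : ℕ) (x : Fin n → Plane) (R L c r : ℝ) (s : Fin n → Fin n → ℝ),
      0 < R → 0 < L → 0 ≤ c → c ≤ 1 → (∀ i k, 0 ≤ s i k) → (∀ i k, s i k ≤ 1) →
      |weightedProgress T R x s - n * (c * (meanProgress * R))| ≤
        R * (1 + ∑ i, (2 * nearProb T (M * R) x i + 2 * (1 - coreInd r (x i)) +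
          2 / (L * η) * ∑ g ∈ G, coreInd r (x i) * |localSum R x i g - L * ∫ y, g y| + δ +
          2 / (capInt * L) * (coreInd r (x i) * rangeDeviation R x i (s i) c))) := by
  classical
  obtain ⟨G, η, M, hη, hM, hG, H⟩ := exists_testFns hδ
  refine ⟨G, η, M, hη, hM, hG, ?_⟩
  intro T n x R L c r s hR hL hc0 hc1 hs0 hs1
  have hb := capInt_pos
  have hκ0 := meanProgress_pos
  have hκ1 := meanProgress_le_one
  have hcκ : |c * (meanProgress * R)| ≤ R := by
    rw [abs_of_nonneg (by positivity)]
    calc _ ≤ 1 * (1 * R) := by gcongr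
      _ = R := by ring
  have hnear : ∀ i, 0 ≤ nearProb T (M * R) x i := fun i =>
    Finset.sum_nonneg fun j _ => T.destProb_nonneg x i j
  have hcore : ∀ i, 0 ≤ coreInd r (x i) ∧ coreInd r (x i) ≤ 1 := by
    intro i
    rcases coreInd_eq r (x i) with h | h
    · rw [h]; simp
    · rw [h.1]; simp
  have hGs : ∀ i, 0 ≤ ∑ g ∈ G, coreInd r (x i) * |localSum R x i g - L * ∫ y, g y| := fun i =>
    Finset.sum_nonneg fun g _ => mul_nonneg (hcore i).1 (abs_nonneg _)
  have hterm : ∀ i, 0 ≤ 2 * nearProb T (M * R) x i + 2 * (1 - coreInd r (x i)) +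
          2 / (L * η) * ∑ g ∈ G, coreInd r (x i) * |localSum R x i g - L * ∫ y, g y| + δ +
          2 / (capInt * L) * (coreInd r (x i) * rangeDeviation R x i (s i) c) := by
    intro i
    have h1 := hnear i; have h2 := hcore i; have h3 := hGs i
    have h4 := mul_nonneg h2.1 (rangeDeviation_nonneg R x i (s i) c)
    have h5 : 0 ≤ 1 - coreInd r (x i) := by linarith
    positivity
  by_cases hn : 2 ≤ n
  · have e : weightedProgress T R x s - n * (c * (meanProgress * R)) = ∑ i, ∑ j, T.destProb x i j *
        ((∑ k ∈ candidates x R i j, progress x i j k * s i k) / ((candidates x R i j).card : ℝ) -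
          c * (meanProgress * R)) := by
      simp_rw [mul_sub, Finset.sum_sub_distrib, ← Finset.sum_mul, T.sum_destProb hn]
      rw [weightedProgress]
      simp
    rw [e]
    refine (Finset.abs_sum_le_sum_abs _ _).trans ?_
    rw [mul_add, Finset.mul_sum, mul_one]
    refine le_add_of_nonneg_of_le hR.le (Finset.sum_le_sum fun i _ => ?_)
    refine (Finset.abs_sum_le_sum_abs _ _).trans ?_
    have htriv : ∀ j, |(∑ k ∈ candidates x R i j, progress x i j k * s i k) /
        ((candidates x R i j).card : ℝ) - c * (meanProgress * R)| ≤ 2 * R := by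
      intro j
      have h1 := abs_average_le (x := x) (R := R) (c := 1) (i := i) (j := j) (s := s i) zero_le_one
        hR.le fun k _ => by rw [abs_of_nonneg (hs0 i k)]; exact hs1 i k
      refine (abs_sub _ _).trans ?_
      linarith
    -- At a good node distant destinations are controlled by `H` and near ones by the trivial bound
    -- 2 R. Goodness does not involve the destination, so no property of `T.destProb` beyond total
    -- mass one is used.
    by_cases hgood : coreInd r (x i) = 1 ∧ ∀ g ∈ G, |localSum R x i g - L * ∫ y, g y| ≤ L * η
    · calc _ ≤ ∑ j, (T.destProb x i j * (if dist (x i) (x j) ≤ M * R then 2 * R else 0) +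
            T.destProb x i j *
              (R * (δ + 2 / (capInt * L) * rangeDeviation R x i (s i) c))) := by
            refine Finset.sum_le_sum fun j _ => ?_
            rw [abs_mul, abs_of_nonneg (T.destProb_nonneg x i j), ← mul_add]
            refine mul_le_mul_of_nonneg_left ?_ (T.destProb_nonneg x i j)
            have hd := rangeDeviation_nonneg R x i (s i) c
            by_cases hj : dist (x i) (x j) ≤ M * R
            · rw [if_pos hj]
              exact (htriv j).trans (le_add_of_nonneg_right (by positivity))
            · rw [if_neg hj, zero_add]
              exact H n x i j R L c (s i) hR hL hc0 hc1 hgood.2 (not_le.1 hj)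
        _ = R * (2 * nearProb T (M * R) x i + δ +
              2 / (capInt * L) * (coreInd r (x i) * rangeDeviation R x i (s i) c)) := by
            rw [Finset.sum_add_distrib, ← Finset.sum_mul, T.sum_destProb hn, hgood.1, nearProb,
              Finset.sum_filter]
            simp_rw [mul_ite, mul_zero, ← ite_zero_mul]
            rw [← Finset.sum_mul]
            ring
        _ ≤ _ := by
            refine mul_le_mul_of_nonneg_left ?_ hR.le
            have h3 := mul_nonneg (show 0 ≤ 2 / (L * η) by positivity) (hGs i)
            rw [hgood.1] at h3 ⊢
            linarith
    · calc _ ≤ ∑ j, T.destProb x i j * (2 * R) := by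
            refine Finset.sum_le_sum fun j _ => ?_
            rw [abs_mul, abs_of_nonneg (T.destProb_nonneg x i j)]
            exact mul_le_mul_of_nonneg_left (htriv j) (T.destProb_nonneg x i j)
        _ = R * 2 := by rw [← Finset.sum_mul, T.sum_destProb hn]; ring
        _ ≤ _ := by
            refine mul_le_mul_of_nonneg_left ?_ hR.le
            have h1 := hnear i
            have h4 := mul_nonneg (show 0 ≤ 2 / (capInt * L) by positivity)
              (mul_nonneg (hcore i).1 (rangeDeviation_nonneg R x i (s i) c))
            have h3 := mul_nonneg (show 0 ≤ 2 / (L * η) by positivity) (hGs i)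
            -- A bad node costs 2 R. Either it is near the boundary, and the term 2 (1 - `coreInd`)
            -- pays, or some test function deviates by more than L η, and the weighted deviation is
            -- at least 2, as in Markov's inequality.
            rcases coreInd_eq r (x i) with h | h
            · rw [h] at h3 h4 ⊢; linarith
            · have : ∃ g ∈ G, L * η < |localSum R x i g - L * ∫ y, g y| := by
                by_contra hcon
                push Not at hcon
                exact hgood ⟨h.1, hcon⟩
              obtain ⟨g, hg, hlt⟩ := this
              have h5 : L * η ≤ ∑ g ∈ G, coreInd r (x i) * |localSum R x i g - L * ∫ y, g y| := by
                refine hlt.le.trans ?_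
                have := Finset.single_le_sum (s := G)
                  (f := fun g => coreInd r (x i) * |localSum R x i g - L * ∫ y, g y|)
                  (fun g _ => mul_nonneg (hcore i).1 (abs_nonneg _)) hg
                simpa [h.1] using this
              have h6 : 2 ≤ 2 / (L * η) *
                  ∑ g ∈ G, coreInd r (x i) * |localSum R x i g - L * ∫ y, g y| := by
                calc (2 : ℝ) = 2 / (L * η) * (L * η) := by field_simp
                  _ ≤ _ := by gcongr
              have h7 := (hcore i).2
              linarith
  -- With at most one node there is no destination; the summand 1 in the bound absorbs the typical
  -- value.
  · have hz : weightedProgress T R x s = 0 := by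
      refine Finset.sum_eq_zero fun i _ => Finset.sum_eq_zero fun j _ => ?_
      have : j = i := by apply Fin.ext; have := i.2; have := j.2; omega
      rw [this, T.destProb_self, zero_mul]
    rw [hz, zero_sub, abs_neg, abs_mul, Nat.abs_cast]
    have hn1 : (n : ℝ) ≤ 1 := by exact_mod_cast (by omega : n ≤ 1)
    calc _ ≤ 1 * R := by gcongr
      _ = R * 1 := by ring
      _ ≤ _ := by
        refine mul_le_mul_of_nonneg_left ?_ hR.le
        exact le_add_of_nonneg_right (Finset.sum_nonneg fun i _ => hterm i)

/-! ### Intensities -/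

theorem poissonMean_nonneg {ρ dens : ℝ} (hd : 0 ≤ dens) : 0 ≤ dens * volume.real (region ρ) :=
  mul_nonneg hd measureReal_nonneg

theorem isProbabilityMeasure_poissonLaw {ρ dens : ℝ} (hρ : 0 < ρ) (hd : 0 ≤ dens) :
    IsProbabilityMeasure (poissonLaw ρ dens) :=
  have := isProbabilityMeasure_nodeLaw hρ
  isProbabilityMeasure_poissonProcess (poissonMean_nonneg hd)

theorem measurableSet_region (ρ : ℝ) : MeasurableSet (region ρ) :=
  Metric.isClosed_closedBall.measurableSet

theorem volume_region_ne_top (ρ : ℝ) : volume (region ρ) ≠ ⊤ := measure_closedBall_lt_top.ne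

theorem volume_real_region_pos {ρ : ℝ} (hρ : 0 < ρ) : 0 < volume.real (region ρ) := by
  rw [volume_real_region hρ]; have := Real.pi_pos; positivity

/-- The mean of a sum over the positions of the nodes. -/
theorem intensity_integral {ρ : ℝ} (hρ : 0 < ρ) (dens : ℝ) (h : Plane → ℝ) :
    dens * volume.real (region ρ) * ∫ z, h z.1 ∂(nodeLaw ρ) = dens * ∫ y in region ρ, h y := by
  have := isProbabilityMeasure_posLaw hρ
  have hv := volume_real_region_pos hρ
  rw [nodeLaw_eq, integral_fun_fst, posLaw, ProbabilityTheory.cond, integral_smul_measure,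
    probReal_univ, one_smul, ENNReal.toReal_inv, smul_eq_mul, ← Measure.real]
  field_simp

theorem integrable_comp_fst_nodeLaw {ρ : ℝ} (hρ : 0 < ρ) {h : Plane → ℝ} (hh : Measurable h)
    (h0 : ∀ y, 0 ≤ h y) (h1 : ∀ y, h y ≤ 1) : Integrable (fun z => h z.1) (nodeLaw ρ) :=
  have := isProbabilityMeasure_nodeLaw hρ
  Integrable.of_bound (hh.comp measurable_fst).aestronglyMeasurable 1
    (Eventually.of_forall fun z => by rw [Real.norm_of_nonneg (h0 _)]; exact h1 _)

/-- The probability that no transmitting primary node lies in `W`. -/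
theorem poissonLaw_void {ρ dens q : ℝ} (hρ : 0 < ρ) (hd : 0 ≤ dens) (hq0 : 0 ≤ q) (hq1 : q ≤ 1)
    {W : Set Plane} (hW : MeasurableSet W) :
    poissonLaw ρ dens {ω | ∀ k, ω.attempts q k → ω.pos k ∉ W} =
      ENNReal.ofReal (Real.exp (-(dens * q * volume.real (region ρ ∩ W)))) := by
  have := isProbabilityMeasure_nodeLaw hρ
  have := isProbabilityMeasure_posLaw hρ
  have hv := volume_real_region_pos hρ
  -- Thinning: a transmitter in W is a point of the marked process in W × (-∞, q).
  have hset : {ω : Config | ∀ k, ω.attempts q k → ω.pos k ∉ W} =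
      {ω : Config | ∀ k, ω.2 k ∉ W ×ˢ Set.Iio q} := by
    ext ω
    simp only [Set.mem_ofPred_eq, Config.attempts, Config.pos, Set.mem_prod, Set.mem_Iio, not_and']
  rw [hset, poissonLaw_eq, poissonProcess_void (poissonMean_nonneg hd) (hW.prod measurableSet_Iio)]
  congr 3
  have hW' : (posLaw ρ).real W = (volume.real (region ρ))⁻¹ * volume.real (region ρ ∩ W) := by
    rw [Measure.real, posLaw, ProbabilityTheory.cond_apply (measurableSet_region ρ),
      ENNReal.toReal_mul, ENNReal.toReal_inv]
    rfl
  rw [nodeLaw_eq, measureReal_prod_prod, markLaw_Iio hq0 hq1, hW']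
  field_simp

theorem primaryFree_iff {ωp : Config} {q r : ℝ} {y : Plane} :
    primaryFree ωp q r y ↔ ∀ k, ωp.attempts q k → ωp.pos k ∉ Metric.closedBall y r := by
  simp only [primaryFree, Metric.mem_closedBall, not_le]

theorem primaryFree_and_iff {ωp : Config} {q r r' : ℝ} {y y' : Plane} :
    primaryFree ωp q r y ∧ primaryFree ωp q r' y' ↔
      ∀ k, ωp.attempts q k → ωp.pos k ∉ Metric.closedBall y r ∪ Metric.closedBall y' r' := by
  simp only [primaryFree_iff, Set.mem_union, not_or]
  exact ⟨fun h k hk => ⟨h.1 k hk, h.2 k hk⟩, fun h => ⟨fun k hk => (h k hk).1, fun k hk => (h k hk).2⟩⟩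

/-! ### Regions free of primary transmitters -/

section Primary

variable {ρ dens q : ℝ}

theorem lintegral_freeInd (hρ : 0 < ρ) (hd : 0 ≤ dens) (hq0 : 0 ≤ q) (hq1 : q ≤ 1) (r : ℝ)
    (y : Plane) :
    ∫⁻ ωp, ENNReal.ofReal (freeInd ωp q r y) ∂(poissonLaw ρ dens) = ENNReal.ofReal
      (Real.exp (-(dens * q * volume.real (region ρ ∩ Metric.closedBall y r)))) := by
  rw [← poissonLaw_void hρ hd hq0 hq1 Metric.isClosed_closedBall.measurableSet,
    ← lintegral_indicator_one]
  · congr with ωp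
    simp only [freeInd, ← primaryFree_iff]
    by_cases h1 : primaryFree ωp q r y <;> simp [h1]
  · simp only [← primaryFree_iff]
    exact measurableSet_setOfPred.2
      ((measurable_primaryFree q r).comp (measurable_id.prodMk measurable_const))

theorem lintegral_freeInd_mul (hρ : 0 < ρ) (hd : 0 ≤ dens) (hq0 : 0 ≤ q) (hq1 : q ≤ 1) (r r' : ℝ)
    (y y' : Plane) :
    ∫⁻ ωp, ENNReal.ofReal (freeInd ωp q r y * freeInd ωp q r' y') ∂(poissonLaw ρ dens) =
      ENNReal.ofReal (Real.exp (-(dens * q *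
        volume.real (region ρ ∩ (Metric.closedBall y r ∪ Metric.closedBall y' r'))))) := by
  rw [← poissonLaw_void hρ hd hq0 hq1 (Metric.isClosed_closedBall.measurableSet.union
    Metric.isClosed_closedBall.measurableSet), ← lintegral_indicator_one]
  · congr with ωp
    simp only [freeInd, ← primaryFree_and_iff]
    by_cases h1 : primaryFree ωp q r y <;> by_cases h2 : primaryFree ωp q r' y' <;> simp [h1, h2]
  · simp only [← primaryFree_and_iff]
    exact measurableSet_setOfPred.2
      (((measurable_primaryFree q r).comp (measurable_id.prodMk measurable_const)).and
        ((measurable_primaryFree q r').comp (measurable_id.prodMk measurable_const)))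

theorem measurable_freeInd_left (q r : ℝ) (y : Plane) : Measurable fun ωp => freeInd ωp q r y :=
  (measurable_freeInd q r).comp (measurable_id.prodMk measurable_const)

theorem measurable_freeInd_right (q r : ℝ) (ωp : Config) : Measurable fun y => freeInd ωp q r y :=
  (measurable_freeInd q r).comp (measurable_const.prodMk measurable_id)

theorem closedBall_subset_region {y : Plane} {r : ℝ} (h : ‖y‖ + r ≤ ρ) :
    Metric.closedBall y r ⊆ region ρ :=
  Metric.closedBall_subset_closedBall' (by rw [dist_zero_right]; linarith)

/-- Two distant nodes are free of primary transmitters independently of each other. -/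
theorem lintegral_freeInd_mul_of_lt (hρ : 0 < ρ) (hd : 0 ≤ dens) (hq0 : 0 ≤ q) (hq1 : q ≤ 1)
    {r r' : ℝ} (hr : 0 ≤ r) (hr' : 0 ≤ r') {y y' : Plane} (hy : ‖y‖ + r ≤ ρ) (hy' : ‖y'‖ + r' ≤ ρ)
    (hyy : r + r' < dist y y') :
    ∫⁻ ωp, ENNReal.ofReal (freeInd ωp q r y * freeInd ωp q r' y') ∂(poissonLaw ρ dens) =
      ENNReal.ofReal (Real.exp (-(dens * q * Real.pi * (r ^ 2 + r' ^ 2)))) := by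
  rw [lintegral_freeInd_mul hρ hd hq0 hq1, Set.inter_eq_self_of_subset_right
    (Set.union_subset (closedBall_subset_region hy) (closedBall_subset_region hy')),
    measureReal_union (Metric.closedBall_disjoint_closedBall hyy)
      Metric.isClosed_closedBall.measurableSet measure_closedBall_lt_top.ne
      measure_closedBall_lt_top.ne, volume_real_closedBall _ hr, volume_real_closedBall _ hr']
  congr 3; ring

theorem lintegral_freeInd_of_le (hρ : 0 < ρ) (hd : 0 ≤ dens) (hq0 : 0 ≤ q) (hq1 : q ≤ 1)
    {r : ℝ} (hr : 0 ≤ r) {y : Plane} (hy : ‖y‖ + r ≤ ρ) :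
    ∫⁻ ωp, ENNReal.ofReal (freeInd ωp q r y) ∂(poissonLaw ρ dens) =
      ENNReal.ofReal (Real.exp (-(dens * q * Real.pi * r ^ 2))) := by
  rw [lintegral_freeInd hρ hd hq0 hq1, Set.inter_eq_self_of_subset_right
    (closedBall_subset_region hy), volume_real_closedBall _ hr]
  congr 3; ring

/-- For disjoint disks inside the region the void probability is exact. Otherwise only the trivial
bound 1 is used, which is harmless because such close pairs turn out to be rare. -/
theorem abs_integral_freeInd_mul_sub_le (hρ : 0 < ρ) (hd : 0 ≤ dens) (hq0 : 0 ≤ q) (hq1 : q ≤ 1)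
    {r r' : ℝ} (hr : 0 ≤ r) (hr' : 0 ≤ r') {y y' : Plane} (hy : ‖y‖ + r ≤ ρ) (hy' : ‖y'‖ + r' ≤ ρ) :
    |∫ ωp, freeInd ωp q r y * freeInd ωp q r' y' ∂(poissonLaw ρ dens) -
      Real.exp (-(dens * q * Real.pi * (r ^ 2 + r' ^ 2)))| ≤
      (Metric.closedBall y (r + r')).indicator 1 y' := by
  have := isProbabilityMeasure_poissonLaw hρ hd
  have h0 : ∀ ωp, 0 ≤ freeInd ωp q r y * freeInd ωp q r' y' := fun ωp =>
    mul_nonneg (freeInd_nonneg _ _ _ _) (freeInd_nonneg _ _ _ _)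
  have h1 : ∀ ωp, freeInd ωp q r y * freeInd ωp q r' y' ≤ 1 := fun ωp =>
    mul_le_one₀ (freeInd_le_one _ _ _ _) (freeInd_nonneg _ _ _ _) (freeInd_le_one _ _ _ _)
  have hm : Measurable fun ωp => freeInd ωp q r y * freeInd ωp q r' y' :=
    (measurable_freeInd_left q r y).mul (measurable_freeInd_left q r' y')
  by_cases h : y' ∈ Metric.closedBall y (r + r')
  · rw [Set.indicator_of_mem h]
    have a1 : 0 ≤ ∫ ωp, freeInd ωp q r y * freeInd ωp q r' y' ∂(poissonLaw ρ dens) :=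
      integral_nonneg h0
    have a2 : ∫ ωp, freeInd ωp q r y * freeInd ωp q r' y' ∂(poissonLaw ρ dens) ≤ 1 := by
      have := integral_mono (μ := poissonLaw ρ dens) (Integrable.of_bound hm.aestronglyMeasurable 1
        (Eventually.of_forall fun ω => by rw [Real.norm_of_nonneg (h0 ω)]; exact h1 ω))
        (integrable_const (1 : ℝ)) h1
      simpa using this
    have b1 : Real.exp (-(dens * q * Real.pi * (r ^ 2 + r' ^ 2))) ≤ 1 := by
      have := Real.pi_pos
      exact Real.exp_le_one_iff.2 (neg_nonpos.2 (by positivity))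
    have b2 := Real.exp_pos (-(dens * q * Real.pi * (r ^ 2 + r' ^ 2)))
    rw [Pi.one_apply, abs_le]; constructor <;> linarith
  · rw [Set.indicator_of_notMem h, integral_eq_lintegral_of_nonneg_ae (Eventually.of_forall h0)
      hm.aestronglyMeasurable, lintegral_freeInd_mul_of_lt hρ hd hq0 hq1 hr hr' hy hy' (by
        rw [Metric.mem_closedBall, not_le, dist_comm] at h; exact h),
      ENNReal.toReal_ofReal (Real.exp_pos _).le, sub_self, abs_zero]

/-- The area of the part of a disk where the secondary nodes are free to transmit. -/
def freeArea (ωp : Config) (q RD RI : ℝ) (z : Plane) : ℝ :=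
  ∫ y in Metric.closedBall z RI, freeInd ωp q RD y

theorem integrableOn_freeInd (ωp : Config) (q RD RI : ℝ) (z : Plane) :
    IntegrableOn (freeInd ωp q RD) (Metric.closedBall z RI) :=
  Measure.integrableOn_of_bounded (M := 1) measure_closedBall_lt_top.ne
    (measurable_freeInd_right q RD ωp).aestronglyMeasurable
    (Eventually.of_forall fun y => by
      rw [Real.norm_of_nonneg (freeInd_nonneg _ _ _ _)]; exact freeInd_le_one _ _ _ _)

theorem freeArea_nonneg (ωp : Config) (q RD RI : ℝ) (z : Plane) : 0 ≤ freeArea ωp q RD RI z :=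
  integral_nonneg fun _ => freeInd_nonneg _ _ _ _

theorem freeArea_le (ωp : Config) (q RD : ℝ) {RI : ℝ} (hRI : 0 ≤ RI) (z : Plane) :
    freeArea ωp q RD RI z ≤ Real.pi * RI ^ 2 := by
  calc freeArea ωp q RD RI z ≤ ∫ _ in Metric.closedBall z RI, (1 : ℝ) :=
        integral_mono (integrableOn_freeInd ωp q RD RI z)
          (integrableOn_const measure_closedBall_lt_top.ne) fun _ => freeInd_le_one _ _ _ _
    _ = _ := by
        rw [setIntegral_const, volume_real_closedBall z hRI, smul_eq_mul, mul_one]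

theorem measurable_freeArea (q RD RI : ℝ) (z : Plane) :
    Measurable fun ωp => freeArea ωp q RD RI z :=
  ((measurable_freeInd q RD).stronglyMeasurable.integral_prod_right'
    (ν := volume.restrict (Metric.closedBall z RI))).measurable

theorem ofReal_freeArea (ωp : Config) (q RD RI : ℝ) (z : Plane) :
    ENNReal.ofReal (freeArea ωp q RD RI z) =
      ∫⁻ y in Metric.closedBall z RI, ENNReal.ofReal (freeInd ωp q RD y) :=
  ofReal_integral_eq_lintegral_ofReal (integrableOn_freeInd ωp q RD RI z)
    (Eventually.of_forall fun _ => freeInd_nonneg _ _ _ _)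

theorem volume_closedBall_eq (z : Plane) {r : ℝ} (hr : 0 ≤ r) :
    volume (Metric.closedBall z r) = ENNReal.ofReal (Real.pi * r ^ 2) := by
  rw [← volume_real_closedBall z hr, Measure.real, ENNReal.ofReal_toReal measure_closedBall_lt_top.ne]

/-- The free area of a disk that is large compared to the detection range is concentrated. -/
theorem meanLE_abs_freeArea_sub (hρ : 0 < ρ) (hd : 0 ≤ dens) (hq0 : 0 ≤ q) (hq1 : q ≤ 1)
    {RD RI : ℝ} (hRD : 0 ≤ RD) (hRI : 0 ≤ RI) {z : Plane} (hz : ‖z‖ + (RI + RD) ≤ ρ) :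
    MeanLE (poissonLaw ρ dens) (fun ωp => |freeArea ωp q RD RI z -
        Real.pi * RI ^ 2 * Real.exp (-(dens * q * Real.pi * RD ^ 2))|)
      (Real.sqrt (Real.pi * RI ^ 2 * (Real.pi * (2 * RD) ^ 2))) := by
  have := isProbabilityMeasure_poissonLaw hρ hd
  have hpi := Real.pi_pos
  set p := Real.exp (-(dens * q * Real.pi * RD ^ 2)) with hp
  have hp0 : 0 < p := Real.exp_pos _
  set B := Metric.closedBall z RI with hB
  have hyB : ∀ y ∈ B, ‖y‖ + RD ≤ ρ := by
    intro y hy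
    have : ‖y‖ ≤ ‖z‖ + RI := by
      have h1 := norm_le_norm_add_norm_sub' y z
      have h2 : ‖y - z‖ ≤ RI := by rw [← dist_eq_norm]; exact hy
      linarith
    linarith
  have hfm := (measurable_freeInd q RD).ennreal_ofReal
  have hBm : MeasurableSet B := Metric.isClosed_closedBall.measurableSet
  refine meanLE_abs_sub (measurable_freeArea q RD RI z) (fun ωp => freeArea_nonneg _ _ _ _ _)
    (by positivity) (by positivity) ?_ ?_
  · simp_rw [ofReal_freeArea]
    rw [lintegral_lintegral_swap hfm.aemeasurable]
    rw [setLIntegral_congr_fun hBm fun y hy => lintegral_freeInd_of_le hρ hd hq0 hq1 hRD (hyB y hy),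
      setLIntegral_const, volume_closedBall_eq z hRI, ← ENNReal.ofReal_mul hp0.le, mul_comm]
  · have e1 : ∀ ωp : Config, ENNReal.ofReal (freeArea ωp q RD RI z) ^ 2 =
        ∫⁻ y in B, ∫⁻ y' in B, ENNReal.ofReal (freeInd ωp q RD y * freeInd ωp q RD y') := by
      intro ωp
      rw [ofReal_freeArea, sq, ← lintegral_mul_const _
        (measurable_freeInd_right q RD ωp).ennreal_ofReal]
      congr with y
      simp_rw [ENNReal.ofReal_mul (freeInd_nonneg ωp q RD y)]
      rw [lintegral_const_mul _ (measurable_freeInd_right q RD ωp).ennreal_ofReal]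
    simp_rw [e1]
    have hm3 : Measurable fun w : (Config × Plane) × Plane =>
        ENNReal.ofReal (freeInd w.1.1 q RD w.1.2 * freeInd w.1.1 q RD w.2) :=
      (((measurable_freeInd q RD).comp measurable_fst).mul ((measurable_freeInd q RD).comp
        ((measurable_fst.comp measurable_fst).prodMk measurable_snd))).ennreal_ofReal
    rw [lintegral_lintegral_swap (Measurable.lintegral_prod_right' hm3).aemeasurable]
    have e2 : ∀ y, ∫⁻ ωp, (∫⁻ y' in B, ENNReal.ofReal (freeInd ωp q RD y * freeInd ωp q RD y'))
        ∂(poissonLaw ρ dens) = ∫⁻ y' in B, ∫⁻ ωp,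
          ENNReal.ofReal (freeInd ωp q RD y * freeInd ωp q RD y') ∂(poissonLaw ρ dens) := by
      intro y
      refine lintegral_lintegral_swap (Measurable.aemeasurable ?_)
      exact hm3.comp ((measurable_fst.prodMk measurable_const).prodMk measurable_snd)
    simp_rw [e2]
    -- Points farther apart than 2 RD are independent and contribute p²; the closer ones occupy an
    -- area of at most π (2 RD)². The variance is therefore at most the area of B times π (2 RD)².
    have e3 : ∀ y ∈ B, ∫⁻ y' in B, ∫⁻ ωp,
        ENNReal.ofReal (freeInd ωp q RD y * freeInd ωp q RD y') ∂(poissonLaw ρ dens) ≤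
        ENNReal.ofReal (p ^ 2 * (Real.pi * RI ^ 2) + Real.pi * (2 * RD) ^ 2) := by
      intro y hy
      calc _ ≤ ∫⁻ y' in B, (ENNReal.ofReal (p ^ 2) +
            (Metric.closedBall y (2 * RD)).indicator 1 y') := by
            refine setLIntegral_mono' hBm fun y' hy' => ?_
            by_cases h : y' ∈ Metric.closedBall y (2 * RD)
            · rw [Set.indicator_of_mem h]
              refine le_add_of_nonneg_of_le zero_le ?_
              calc _ ≤ ∫⁻ _, 1 ∂(poissonLaw ρ dens) := by
                    refine lintegral_mono fun ωp => ?_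
                    rw [← ENNReal.ofReal_one]
                    exact ENNReal.ofReal_le_ofReal (mul_le_one₀ (freeInd_le_one _ _ _ _)
                      (freeInd_nonneg _ _ _ _) (freeInd_le_one _ _ _ _))
                _ = _ := by simp
            · rw [Set.indicator_of_notMem h, add_zero,
                lintegral_freeInd_mul_of_lt hρ hd hq0 hq1 hRD hRD (hyB y hy) (hyB y' hy') (by
                  rw [Metric.mem_closedBall, not_le, dist_comm] at h; linarith), hp,
                ← Real.exp_nat_mul]
              refine (ENNReal.ofReal_le_ofReal (le_of_eq ?_))
              congr 1; push_cast; ring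
        _ ≤ ENNReal.ofReal (p ^ 2) * volume B + volume (Metric.closedBall y (2 * RD)) := by
            rw [lintegral_add_left measurable_const, setLIntegral_const]
            gcongr
            refine (setLIntegral_le_lintegral _ _).trans ?_
            rw [lintegral_indicator_one Metric.isClosed_closedBall.measurableSet]
        _ = _ := by
            rw [volume_closedBall_eq z hRI, volume_closedBall_eq y (by positivity),
              ← ENNReal.ofReal_mul (by positivity), ← ENNReal.ofReal_add (by positivity)
                (by positivity)]
    refine (setLIntegral_mono' hBm e3).trans ?_
    rw [setLIntegral_const, volume_closedBall_eq z hRI, ← ENNReal.ofReal_mul (by positivity)]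
    exact ENNReal.ofReal_le_ofReal (le_of_eq (by ring))

end Primary

/-! ### Mean deviations of local statistics -/

theorem measurable_sum_conf_param {W Z M : Type*} [MeasurableSpace W] [MeasurableSpace Z]
    [AddCommMonoid M] [MeasurableSpace M] [MeasurableAdd₂ M] {h : W × Z → M} (hh : Measurable h) :
    Measurable fun p : W × Conf Z => ∑ k, h (p.1, p.2.2 k) := by
  refine measurable_of_prod_sigma fun n => ?_
  change Measurable fun p : W × (Fin n → Z) => ∑ k : Fin n, h (p.1, p.2 k)
  exact Finset.measurable_sum _ fun k _ => hh.comp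
    (measurable_fst.prodMk ((measurable_pi_apply k).comp measurable_snd))

section Local

variable {ρ dens : ℝ}

theorem meanLE_poissonLaw_sum_rest (hρ : 0 < ρ) (hd : 0 ≤ dens) {e : Plane × ℝ → Config → ℝ}
    (he : Measurable (Function.uncurry e)) {B : ℝ} (h : ∀ z, MeanLE (poissonLaw ρ dens) (e z) B) :
    MeanLE (poissonLaw ρ dens) (fun ω => ∑ i, e (ω.2 i) (rest ω i))
      (dens * volume.real (region ρ) * B) := by
  have := isProbabilityMeasure_nodeLaw hρ
  rw [poissonLaw_eq] at *
  exact meanLE_sum_rest (poissonMean_nonneg hd) he (Eventually.of_forall h)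

theorem meanLE_poissonLaw_sum (hρ : 0 < ρ) (hd : 0 ≤ dens) {h : Plane → ℝ} (hm : Measurable h)
    (h0 : ∀ y, 0 ≤ h y) (h1 : ∀ y, h y ≤ 1) :
    MeanLE (poissonLaw ρ dens) (fun ω => ∑ i, h (ω.2 i).1) (dens * ∫ y in region ρ, h y) := by
  have := isProbabilityMeasure_nodeLaw hρ
  rw [poissonLaw_eq, ← intensity_integral hρ dens h]
  exact meanLE_sum_conf (poissonMean_nonneg hd) (h := fun z : Plane × ℝ => h z.1)
    (hm.comp measurable_fst) (fun z => h0 _) (integrable_comp_fst_nodeLaw hρ hm h0 h1)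

theorem meanLE_poissonLaw_abs_sum_sub (hρ : 0 < ρ) (hd : 0 ≤ dens) {h : Plane → ℝ}
    (hm : Measurable h) (h0 : ∀ y, 0 ≤ h y) (h1 : ∀ y, h y ≤ 1) :
    MeanLE (poissonLaw ρ dens) (fun ω => |∑ i, h (ω.2 i).1 - dens * ∫ y in region ρ, h y|)
      (Real.sqrt (dens * ∫ y in region ρ, h y)) := by
  have := isProbabilityMeasure_nodeLaw hρ
  rw [poissonLaw_eq, ← intensity_integral hρ dens h]
  exact meanLE_abs_sum_sub (poissonMean_nonneg hd) (h := fun z : Plane × ℝ => h z.1)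
    (hm.comp measurable_fst) (fun z => h0 _) (fun z => h1 _)

theorem measurable_coreInd (r : ℝ) : Measurable (coreInd r) :=
  measurable_one.indicator Metric.isClosed_closedBall.measurableSet

theorem coreInd_nonneg (r : ℝ) (y : Plane) : 0 ≤ coreInd r y := by
  rcases coreInd_eq r y with h | h
  · rw [h]
  · rw [h.1]; exact zero_le_one

theorem coreInd_le_one (r : ℝ) (y : Plane) : coreInd r y ≤ 1 := by
  rcases coreInd_eq r y with h | h
  · rw [h]; exact zero_le_one
  · rw [h.1]

/-- Few nodes are close to the boundary of the region. -/
theorem meanLE_sum_one_sub_coreInd (hρ : 0 < ρ) (hd : 0 ≤ dens) {r : ℝ} (hr0 : 0 ≤ r)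
    (hr : r ≤ ρ) :
    MeanLE (poissonLaw ρ dens) (fun ω => ∑ i, (1 - coreInd r (ω.pos i)))
      (dens * (2 * Real.pi * ρ * (ρ - r))) := by
  have := isProbabilityMeasure_nodeLaw hρ
  have hm : Measurable fun y => 1 - coreInd r y := (measurable_coreInd r).const_sub 1
  have h0 : ∀ y, 0 ≤ 1 - coreInd r y := fun y => by linarith [coreInd_le_one r y]
  have h1 : ∀ y, 1 - coreInd r y ≤ 1 := fun y => by linarith [coreInd_nonneg r y]
  refine (meanLE_poissonLaw_sum hρ hd hm h0 h1).mono (fun _ => le_rfl) ?_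
  refine mul_le_mul_of_nonneg_left ?_ hd
  have hsub : Metric.closedBall (0 : Plane) r ⊆ region ρ := Metric.closedBall_subset_closedBall hr
  have hci : IntegrableOn (coreInd r) (region ρ) :=
    (integrableOn_const (C := (1 : ℝ)) (volume_region_ne_top ρ)).indicator
      Metric.isClosed_closedBall.measurableSet
  have hone : IntegrableOn (fun _ => (1 : ℝ)) (region ρ) :=
    integrableOn_const (volume_region_ne_top ρ)
  rw [integral_sub hone hci, setIntegral_const, volume_real_region hρ]
  have : ∫ y in region ρ, coreInd r y = Real.pi * r ^ 2 := by
    unfold coreInd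
    rw [integral_indicator_one Metric.isClosed_closedBall.measurableSet, measureReal_restrict_apply
      Metric.isClosed_closedBall.measurableSet, Set.inter_eq_self_of_subset_left hsub,
      volume_real_closedBall _ hr0]
  rw [this, smul_eq_mul, mul_one]
  have := mul_nonneg Real.pi_pos.le (sq_nonneg (ρ - r))
  nlinarith

theorem setIntegral_testFn {g : Plane → ℝ} (hg : IsTestFn g) {R : ℝ} (hR : 0 < R) {z : Plane}
    (hz : ‖z‖ + R ≤ ρ) : ∫ y in region ρ, g (R⁻¹ • (y - z)) = R ^ 2 * ∫ y, g y := by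
  have h1 : ∫ y in region ρ, g (R⁻¹ • (y - z)) = ∫ y, g (R⁻¹ • (y - z)) := by
    refine setIntegral_eq_integral_of_forall_compl_eq_zero fun y hy => hg.eq_zero _ ?_
    by_contra hcon
    refine hy (closedBall_subset_region hz ?_)
    rw [norm_smul, norm_inv, Real.norm_of_nonneg hR.le, not_lt, inv_mul_le_one₀ hR] at hcon
    rwa [Metric.mem_closedBall, dist_eq_norm]
  rw [h1, integral_sub_right_eq_self (fun y => g (R⁻¹ • y)) z,
    Measure.integral_comp_inv_smul_of_nonneg volume g hR.le]
  simp

theorem localSum_eq_rest (R : ℝ) (g : Plane → ℝ) (ω : Config) (i : Fin ω.1) :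
    localSum R ω.pos i g = ∑ k, g (R⁻¹ • (((rest ω i).2 k).1 - (ω.2 i).1)) :=
  (sum_rest ω i fun z : Plane × ℝ => g (R⁻¹ • (z.1 - (ω.2 i).1))).symm

/-- The local sums of a test function are concentrated. -/
theorem meanLE_localSum (hρ : 0 < ρ) (hd : 0 ≤ dens) {g : Plane → ℝ} (hg : IsTestFn g) {R r : ℝ}
    (hR : 0 < R) (hr : r + R ≤ ρ) :
    MeanLE (poissonLaw ρ dens) (fun ω => ∑ i, coreInd r (ω.pos i) *
      |localSum R ω.pos i g - dens * R ^ 2 * ∫ y, g y|)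
      (dens * volume.real (region ρ) * Real.sqrt (dens * R ^ 2 * Real.pi)) := by
  simp_rw [localSum_eq_rest]
  refine meanLE_poissonLaw_sum_rest hρ hd (e := fun z ω => coreInd r z.1 *
    |∑ k, g (R⁻¹ • ((ω.2 k).1 - z.1)) - dens * R ^ 2 * ∫ y, g y|) ?_ fun z => ?_
  · have h1 : Measurable fun p : (Plane × ℝ) × (Plane × ℝ) => g (R⁻¹ • (p.2.1 - p.1.1)) :=
      hg.measurable.comp (by fun_prop)
    exact ((measurable_coreInd r).comp (measurable_fst.comp measurable_fst)).mul
      ((measurable_sum_conf_param h1).sub_const _).abs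
  · rcases coreInd_eq r z.1 with h | h
    · simp [MeanLE, h]
    · rw [h.1]
      simp_rw [one_mul]
      have hgz : Measurable fun y => g (R⁻¹ • (y - z.1)) := hg.measurable.comp (by fun_prop)
      have h2 := meanLE_poissonLaw_abs_sum_sub hρ hd hgz (fun w => hg.nonneg _)
        (fun w => hg.le_one _)
      rw [setIntegral_testFn hg hR (by linarith [h.2]), ← mul_assoc] at h2
      refine h2.mono (fun _ => le_rfl) (Real.sqrt_le_sqrt ?_)
      exact mul_le_mul_of_nonneg_left hg.integral_le (by positivity)

/-- The indicator of the closed disk of radius `r` around `z`. -/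
def diskInd (r : ℝ) (z y : Plane) : ℝ := (Metric.closedBall z r).indicator 1 y

theorem diskInd_nonneg (r : ℝ) (z y : Plane) : 0 ≤ diskInd r z y :=
  Set.indicator_nonneg (fun _ _ => zero_le_one) _

theorem diskInd_le_one (r : ℝ) (z y : Plane) : diskInd r z y ≤ 1 :=
  Set.indicator_le_self' (fun _ _ => zero_le_one) _

open Classical in
theorem diskInd_eq (r : ℝ) (z y : Plane) : diskInd r z y = if dist y z ≤ r then 1 else 0 := by
  simp [diskInd, Set.indicator_apply]

theorem measurable_diskInd (r : ℝ) : Measurable fun p : Plane × Plane => diskInd r p.1 p.2 := by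
  classical
  simp_rw [diskInd_eq]
  exact Measurable.ite (measurableSet_le (by fun_prop) measurable_const) measurable_const
    measurable_const

theorem measurable_diskInd_right (r : ℝ) (z : Plane) : Measurable (diskInd r z) :=
  measurable_one.indicator Metric.isClosed_closedBall.measurableSet

theorem setIntegral_diskInd_le {r : ℝ} (hr : 0 ≤ r) (z : Plane) :
    ∫ y in region ρ, diskInd r z y ≤ Real.pi * r ^ 2 := by
  unfold diskInd
  rw [integral_indicator_one Metric.isClosed_closedBall.measurableSet, ← volume_real_closedBall z hr]
  exact measureReal_mono_of_restrict z r
where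
  measureReal_mono_of_restrict (z : Plane) (r : ℝ) :
      (volume.restrict (region ρ)).real (Metric.closedBall z r) ≤
        volume.real (Metric.closedBall z r) :=
    ENNReal.toReal_mono measure_closedBall_lt_top.ne (Measure.restrict_apply_le _ _)

theorem meanLE_sum_diskInd (hρ : 0 < ρ) (hd : 0 ≤ dens) {r : ℝ} (hr : 0 ≤ r) (z : Plane) :
    MeanLE (poissonLaw ρ dens) (fun ω => ∑ k, diskInd r z (ω.2 k).1) (dens * (Real.pi * r ^ 2)) := by
  refine (meanLE_poissonLaw_sum hρ hd (measurable_diskInd_right r z) (diskInd_nonneg r z)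
    (diskInd_le_one r z)).mono (fun _ => le_rfl) ?_
  exact mul_le_mul_of_nonneg_left (setIntegral_diskInd_le hr z) hd

theorem measurable_sum_diskInd (r : ℝ) : Measurable fun p : (Plane × ℝ) × Config =>
    ∑ k, diskInd r p.1.1 (p.2.2 k).1 := by
  have h : Measurable fun p : (Plane × ℝ) × (Plane × ℝ) => (p.1.1, p.2.1) := by fun_prop
  exact measurable_sum_conf_param ((measurable_diskInd r).comp h)

/-- The number of nodes within distance `r` of node `i`. -/
def degree (r : ℝ) {n : ℕ} (x : Fin n → Plane) (i : Fin n) : ℝ :=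
  ∑ k with k ≠ i, diskInd r (x i) (x k)

theorem degree_eq_rest (r : ℝ) (ω : Config) (i : Fin ω.1) :
    degree r ω.pos i = ∑ k, diskInd r (ω.2 i).1 ((rest ω i).2 k).1 :=
  (sum_rest ω i fun z : Plane × ℝ => diskInd r (ω.2 i).1 z.1).symm

theorem meanLE_sum_degree (hρ : 0 < ρ) (hd : 0 ≤ dens) {r : ℝ} (hr : 0 ≤ r) :
    MeanLE (poissonLaw ρ dens) (fun ω => ∑ i, degree r ω.pos i)
      (dens * volume.real (region ρ) * (dens * (Real.pi * r ^ 2))) := by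
  simp_rw [degree_eq_rest]
  exact meanLE_poissonLaw_sum_rest hρ hd (e := fun z ω => ∑ k, diskInd r z.1 (ω.2 k).1)
    (measurable_sum_diskInd r) fun z => meanLE_sum_diskInd hρ hd hr z.1

theorem rest_fst (ω : Config) (i : Fin ω.1) : (((rest ω i).1 : ℕ) : ℝ) = (ω.1 : ℝ) - 1 := by
  obtain ⟨n, x⟩ := ω
  cases n with
  | zero => exact i.elim0
  | succ n => simp [rest]

/-- An own packet is destined uniformly to the other nodes, whose number is that of `rest ω i`; its
probability of being own is bounded by 1. Written through `rest`, the first term has the form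
required by Mecke's formula. -/
theorem nearProb_le (T : Traffic) (r : ℝ) (ω : Config) (i : Fin ω.1) :
    nearProb T r ω.pos i ≤ (∑ k, diskInd r (ω.2 i).1 ((rest ω i).2 k).1) / (rest ω i).1 +
      ∑ j with dist (ω.pos i) (ω.pos j) ≤ r,
        (1 - T.own ω.1 ω.pos i) * T.relayed ω.1 ω.pos i j := by
  classical
  have hn : (0 : ℝ) ≤ (ω.1 : ℝ) - 1 := by rw [← rest_fst ω i]; positivity
  have hown := T.own_mem ω.1 ω.pos i
  rw [← degree_eq_rest, rest_fst, degree, Finset.sum_div, nearProb, Finset.sum_filter,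
    Finset.sum_filter, Finset.sum_filter, ← Finset.sum_add_distrib]
  refine Finset.sum_le_sum fun j _ => ?_
  rw [diskInd_eq, dist_comm (ω.pos j)]
  have hrel := mul_nonneg (show 0 ≤ 1 - T.own ω.1 ω.pos i by linarith [hown.2])
    (T.relayed_nonneg ω.1 ω.pos i j)
  by_cases hji : j = i
  · subst hji
    rw [T.destProb_self]
    simp only [ne_eq, not_true_eq_false, if_false, ite_self, zero_add]
    split_ifs <;> first | exact hrel | exact le_rfl
  · by_cases h : dist (ω.pos i) (ω.pos j) ≤ r
    · simp only [h, if_true, ne_eq, hji, not_false_eq_true, Traffic.destProb, if_false]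
      refine add_le_add_left ?_ _
      exact mul_le_of_le_one_left (by positivity) hown.2
    · simp [h]

theorem sum_relayed_le (T : Traffic) (r : ℝ) (ω : Config) :
    ∑ i, ∑ j with dist (ω.pos i) (ω.pos j) ≤ r,
      (1 - T.own ω.1 ω.pos i) * T.relayed ω.1 ω.pos i j ≤ ω.1 := by
  have : ∀ i : Fin ω.1, ∑ j with dist (ω.pos i) (ω.pos j) ≤ r,
      (1 - T.own ω.1 ω.pos i) * T.relayed ω.1 ω.pos i j ≤ 1 := by
    intro i
    have hown := T.own_mem ω.1 ω.pos i
    calc _ ≤ ∑ j, (1 - T.own ω.1 ω.pos i) * T.relayed ω.1 ω.pos i j :=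
          Finset.sum_le_sum_of_subset_of_nonneg (Finset.filter_subset _ _) fun j _ _ =>
            mul_nonneg (by linarith [hown.2]) (T.relayed_nonneg _ _ _ _)
      _ = (1 - T.own ω.1 ω.pos i) * ∑ j, T.relayed ω.1 ω.pos i j := by rw [Finset.mul_sum]
      _ ≤ 1 * 1 := by
          have h1 : ∑ j, T.relayed ω.1 ω.pos i j ≤ 1 := by
            by_cases hn : 2 ≤ ω.1
            · exact (T.relayed_sum _ _ _ hn).le
            · refine (Finset.sum_nonpos fun j _ => ?_).trans zero_le_one
              have : j = i := by apply Fin.ext; have := i.2; have := j.2; omega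
              rw [this, T.relayed_self]
          exact mul_le_mul (by linarith [hown.1]) h1
            (Finset.sum_nonneg fun j _ => T.relayed_nonneg _ _ _ _) zero_le_one
      _ = 1 := one_mul 1
  calc _ ≤ ∑ i : Fin ω.1, (1 : ℝ) := Finset.sum_le_sum fun i _ => this i
    _ = _ := by simp

theorem measurable_sum_relayed (T : Traffic) (r : ℝ) : Measurable fun ω : Config =>
    ∑ i, ∑ j with dist (ω.pos i) (ω.pos j) ≤ r,
      (1 - T.own ω.1 ω.pos i) * T.relayed ω.1 ω.pos i j := by
  refine measurable_of_sigma fun n => ?_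
  change Measurable fun z : Fin n → Plane × ℝ =>
    ∑ i : Fin n, ∑ j : Fin n with dist (z i).1 (z j).1 ≤ r,
      (1 - T.own n (fun i => (z i).1) i) * T.relayed n (fun i => (z i).1) i j
  have hx : Measurable fun z : Fin n → Plane × ℝ => fun i => (z i).1 := by fun_prop
  simp_rw [Finset.sum_filter]
  refine Finset.measurable_sum _ fun i _ => Finset.measurable_sum _ fun j _ => Measurable.ite
    (measurableSet_le (by fun_prop) measurable_const) ?_ measurable_const
  exact (((T.own_measurable n i).comp hx).const_sub 1).mul ((T.relayed_measurable n i j).comp hx)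

/-- Few packets are close to their destination. -/
theorem meanLE_sum_nearProb (hρ : 0 < ρ) (hd : 0 ≤ dens) (T : Traffic) {r : ℝ} (hr : 0 ≤ r) :
    MeanLE (poissonLaw ρ dens) (fun ω => ∑ i, nearProb T r ω.pos i)
      (dens * (Real.pi * r ^ 2) + T.relayedNear ρ dens r) := by
  have := isProbabilityMeasure_nodeLaw hρ
  have := isProbabilityMeasure_poissonLaw hρ hd
  have hv := volume_real_region_pos hρ
  have hown0 : ∀ ω : Config, 0 ≤ ∑ i, ∑ j with dist (ω.pos i) (ω.pos j) ≤ r,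
        (1 - T.own ω.1 ω.pos i) * T.relayed ω.1 ω.pos i j := fun ω =>
    Finset.sum_nonneg fun i _ => Finset.sum_nonneg fun j _ =>
      mul_nonneg (by linarith [(T.own_mem ω.1 ω.pos i).2]) (T.relayed_nonneg _ _ _ _)
  have h1 : MeanLE (poissonLaw ρ dens) (fun ω => ∑ i,
      (∑ k, diskInd r (ω.2 i).1 ((rest ω i).2 k).1) / (rest ω i).1)
      (dens * volume.real (region ρ) * (Real.pi * r ^ 2 / volume.real (region ρ))) := by
    refine meanLE_poissonLaw_sum_rest hρ hd (e := fun z ω =>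
      (∑ k, diskInd r z.1 (ω.2 k).1) / ω.1)
      ((measurable_sum_diskInd r).div (measurable_card.comp measurable_snd)) fun z => ?_
    rw [poissonLaw_eq]
    refine (meanLE_sum_div_card (poissonMean_nonneg hd)
      (h := fun w : Plane × ℝ => diskInd r z.1 w.1)
      ((measurable_diskInd_right r z.1).comp measurable_fst) (fun w => diskInd_nonneg _ _ _)
      (integrable_comp_fst_nodeLaw hρ (measurable_diskInd_right r z.1) (diskInd_nonneg r z.1)
      (diskInd_le_one r z.1))).mono (fun _ => le_rfl) ?_
    have h2 := intensity_integral hρ 1 (diskInd r z.1)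
    rw [one_mul, one_mul] at h2
    rw [le_div_iff₀ hv, mul_comm, h2]
    exact setIntegral_diskInd_le hr z.1
  have h2 : MeanLE (poissonLaw ρ dens) (fun ω => ∑ i, ∑ j with dist (ω.pos i) (ω.pos j) ≤ r,
        (1 - T.own ω.1 ω.pos i) * T.relayed ω.1 ω.pos i j) (T.relayedNear ρ dens r) := by
    have hi : Integrable (fun ω : Config => ∑ i, ∑ j with dist (ω.pos i) (ω.pos j) ≤ r,
        (1 - T.own ω.1 ω.pos i) * T.relayed ω.1 ω.pos i j) (poissonLaw ρ dens) := by
      refine Integrable.mono' (integrable_card (ν := nodeLaw ρ) (poissonMean_nonneg hd))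
        (measurable_sum_relayed T r).aestronglyMeasurable (Eventually.of_forall fun ω => ?_)
      rw [Real.norm_of_nonneg (hown0 ω)]
      exact sum_relayed_le T r ω
    unfold MeanLE
    rw [← ofReal_integral_eq_lintegral_ofReal hi (Eventually.of_forall hown0)]
    refine ENNReal.ofReal_le_ofReal (le_of_eq ?_)
    unfold Traffic.relayedNear
    congr!
  have hm1 : Measurable fun ω : Config => ∑ i,
      ∑ j with dist (ω.pos i) (ω.pos j) ≤ r,
        (1 - T.own ω.1 ω.pos i) * T.relayed ω.1 ω.pos i j := measurable_sum_relayed T r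
  have hn0 : 0 ≤ T.relayedNear ρ dens r := by
    refine integral_nonneg fun ω => ?_
    convert! hown0 ω
  refine ((h2.add h1 hm1 hn0 (mul_nonneg (poissonMean_nonneg hd) (by positivity))).mono
    (fun ω => ?_) (le_of_eq ?_))
  · rw [← Finset.sum_add_distrib]
    exact Finset.sum_le_sum fun i _ => (nearProb_le T r ω i).trans (add_comm _ _).le
  · field_simp; ring

end Local

/-! ### Interference from the other secondary nodes -/

theorem abs_exp_neg_sub_le {a b : ℝ} (ha : 0 ≤ a) (hb : 0 ≤ b) :
    |Real.exp (-a) - Real.exp (-b)| ≤ |a - b| := by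
  wlog h : a ≤ b generalizing a b
  · rw [abs_sub_comm, abs_sub_comm a]
    exact this hb ha (not_le.1 h).le
  · have h1 : Real.exp (-b) ≤ Real.exp (-a) := Real.exp_le_exp.2 (by linarith)
    have h2 : Real.exp (-b) = Real.exp (-a) * Real.exp (a - b) := by
      rw [← Real.exp_add]; congr 1; ring
    have h3 := Real.add_one_le_exp (a - b)
    have h4 : Real.exp (-a) ≤ 1 := Real.exp_le_one_iff.2 (by linarith)
    have h5 := Real.exp_pos (-a)
    rw [abs_of_nonneg (by linarith), abs_of_nonpos (by linarith), h2]
    nlinarith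

/-- Each factor 1 - q differs from exp(-q) by at most q², and x ↦ exp(-x) is 1-Lipschitz on x ≥ 0.
The random exponent N thus enters only through its mean and its mean deviation. -/
theorem abs_pow_sub_exp_le {q m : ℝ} (hq0 : 0 ≤ q) (hq1 : q ≤ 1) (hm : 0 ≤ m) (N : ℕ) :
    |(1 - q) ^ N - Real.exp (-(q * m))| ≤ q ^ 2 * N + q * |N - m| := by
  have h1 : |(1 - q) ^ N - Real.exp (-q) ^ N| ≤ q ^ 2 * N := by
    refine (abs_pow_sub_pow_le _ _ _).trans ?_
    have e1 : |1 - q - Real.exp (-q)| ≤ q ^ 2 := by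
      have := Real.abs_exp_sub_one_sub_id_le (x := -q) (by rw [abs_neg, abs_of_nonneg hq0]; exact hq1)
      rw [abs_sub_comm]
      convert! this using 1 <;> [congr 1; skip] <;> ring
    have e2 : max |1 - q| |Real.exp (-q)| ≤ 1 := by
      rw [max_le_iff, abs_of_nonneg (by linarith), abs_of_pos (Real.exp_pos _)]
      exact ⟨by linarith, Real.exp_le_one_iff.2 (by linarith)⟩
    calc _ ≤ q ^ 2 * N * 1 ^ (N - 1) := by gcongr
      _ = _ := by simp
  have h2 : |Real.exp (-q) ^ N - Real.exp (-(q * m))| ≤ q * |N - m| := by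
    rw [← Real.exp_nat_mul]
    have := abs_exp_neg_sub_le (a := q * N) (b := q * m) (by positivity) (by positivity)
    rw [← mul_sub, abs_mul, abs_of_nonneg hq0] at this
    convert! this using 4; ring
  calc _ ≤ _ := abs_sub_le _ (Real.exp (-q) ^ N) _
    _ ≤ _ := add_le_add h1 h2

/-- The exponents differ by at most one, and one more factor 1 - q changes a power by at most q. -/
theorem abs_pow_sub_pow_le_of_add_eq {q : ℝ} (hq0 : 0 ≤ q) (hq1 : q ≤ 1) {a b s t : ℕ}
    (h : a + s = b + t) (hs : s ≤ 1) (ht : t ≤ 1) : |(1 - q) ^ a - (1 - q) ^ b| ≤ q := by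
  have key : ∀ c : ℕ, |(1 - q) ^ (c + 1) - (1 - q) ^ c| ≤ q := by
    intro c
    have : (1 - q) ^ (c + 1) - (1 - q) ^ c = -(q * (1 - q) ^ c) := by ring
    rw [this, abs_neg, abs_of_nonneg (mul_nonneg hq0 (pow_nonneg (by linarith) _))]
    exact mul_le_of_le_one_right hq0 (pow_le_one₀ (by linarith) (by linarith))
  interval_cases s <;> interval_cases t
  · have : a = b := by omega
    subst this; simpa using hq0
  · have : a = b + 1 := by omega
    subst this; exact key b
  · have : b = a + 1 := by omega
    subst this; rw [abs_sub_comm]; exact key a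
  · have : a = b := by omega
    subst this; simpa using hq0

open Classical in
/-- The indicator that a node at `y` is free to transmit and in the interference range of `z`. -/
def nearFree (ωp : Config) (qp RD RI : ℝ) (z y : Plane) : ℕ :=
  if dist y z ≤ RI ∧ primaryFree ωp qp RD y then 1 else 0

/-- The number of nodes that are free to transmit and in the interference range of `z`. -/
def freeCount (ωp : Config) (qp RD RI : ℝ) (z : Plane) (ω : Config) : ℕ :=
  ∑ m, nearFree ωp qp RD RI z (ω.2 m).1

theorem nearFree_le_one (ωp : Config) (qp RD RI : ℝ) (z y : Plane) :
    nearFree ωp qp RD RI z y ≤ 1 := by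
  unfold nearFree; split_ifs <;> simp

theorem cast_nearFree (ωp : Config) (qp RD RI : ℝ) (z y : Plane) :
    (nearFree ωp qp RD RI z y : ℝ) = diskInd RI z y * freeInd ωp qp RD y := by
  classical
  rw [diskInd_eq, nearFree, freeInd]
  by_cases h1 : dist y z ≤ RI <;> by_cases h2 : primaryFree ωp qp RD y <;> simp [h1, h2]

/-- The interferers exclude the transmitter `i` but may include the relay `k`, whereas Mecke's
formula at `k` counts the nodes other than `k`. Adding the missing node on each side gives the same
full count. -/
theorem interferers_add_eq (ωp : Config) (qp RD RI : ℝ) (ω : Config) (i k : Fin ω.1) :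
    interferers ωp qp RD RI ω.pos i k + nearFree ωp qp RD RI (ω.pos k) (ω.pos i) =
      freeCount ωp qp RD RI (ω.pos k) (rest ω k) + nearFree ωp qp RD RI (ω.pos k) (ω.pos k) := by
  classical
  have hall : ∀ l : Fin ω.1, (∑ m with m ≠ l, nearFree ωp qp RD RI (ω.pos k) (ω.pos m)) +
      nearFree ωp qp RD RI (ω.pos k) (ω.pos l) = ∑ m, nearFree ωp qp RD RI (ω.pos k) (ω.pos m) := by
    intro l
    rw [Finset.filter_ne', Finset.sum_erase_add _ _ (Finset.mem_univ l)]
  have h1 : interferers ωp qp RD RI ω.pos i k =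
      ∑ m with m ≠ i, nearFree ωp qp RD RI (ω.pos k) (ω.pos m) := by
    rw [interferers, Finset.card_filter, Finset.sum_filter]
    refine Finset.sum_congr rfl fun m _ => ?_
    unfold nearFree
    by_cases h1 : m = i
    · simp [h1]
    · simp [h1]
  have h2 : freeCount ωp qp RD RI (ω.pos k) (rest ω k) =
      ∑ m with m ≠ k, nearFree ωp qp RD RI (ω.pos k) (ω.pos m) :=
    sum_rest ω k fun z : Plane × ℝ => nearFree ωp qp RD RI (ω.pos k) z.1
  rw [h1, h2, hall, hall]

theorem measurable_nearFree (qp RD RI : ℝ) : Measurable fun p : (Config × (Plane × ℝ)) × (Plane × ℝ) =>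
    nearFree p.1.1 qp RD RI p.1.2.1 p.2.1 := by
  have h1 : MeasurableSet {p : (Config × (Plane × ℝ)) × (Plane × ℝ) | dist p.2.1 p.1.2.1 ≤ RI} :=
    measurableSet_le (by fun_prop) measurable_const
  have h2 : Measurable fun p : (Config × (Plane × ℝ)) × (Plane × ℝ) => (p.1.1, p.2.1) := by fun_prop
  have h3 := measurableSet_setOfPred.2 ((measurable_primaryFree qp RD).comp h2)
  exact Measurable.ite (h1.inter h3) measurable_const measurable_const

theorem measurable_freeCount (qp RD RI : ℝ) : Measurable fun p : (Config × (Plane × ℝ)) × Config =>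
    freeCount p.1.1 qp RD RI p.1.2.1 p.2 :=
  measurable_sum_conf_param (measurable_nearFree qp RD RI)

theorem measurable_freeCount_left (qp RD RI : ℝ) (z : Plane) :
    Measurable fun p : Config × Config => freeCount p.1 qp RD RI z p.2 := by
  have h : Measurable fun p : Config × Config =>
      (((p.1, ((z, 0) : Plane × ℝ)), p.2) : (Config × (Plane × ℝ)) × Config) := by fun_prop
  exact (measurable_freeCount qp RD RI).comp h

theorem freeCount_le (ωp : Config) (qp RD RI : ℝ) (z : Plane) (ω : Config) :
    freeCount ωp qp RD RI z ω ≤ ω.1 := by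
  refine (Finset.sum_le_card_nsmul Finset.univ _ 1 fun m _ => nearFree_le_one _ _ _ _ _ _).trans ?_
  simp

section

variable {ρ densP densS qp q RD RI RIps R : ℝ}

theorem setIntegral_nearFree (ωp : Config) {z : Plane} (hz : ‖z‖ + RI ≤ ρ) :
    ∫ y in region ρ, diskInd RI z y * freeInd ωp qp RD y = freeArea ωp qp RD RI z := by
  have h : ∀ y, diskInd RI z y * freeInd ωp qp RD y =
      (Metric.closedBall z RI).indicator (freeInd ωp qp RD) y := by
    intro y
    unfold diskInd
    by_cases hy : y ∈ Metric.closedBall z RI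
    · simp [Set.indicator_of_mem hy]
    · simp [Set.indicator_of_notMem hy]
  simp_rw [h]
  rw [setIntegral_indicator Metric.isClosed_closedBall.measurableSet,
    Set.inter_eq_self_of_subset_right (closedBall_subset_region hz), freeArea]

/-- The typical value of the probability that there is no interference from secondary nodes. -/
def quietProb (densP densS qp q RD RI : ℝ) : ℝ :=
  Real.exp (-(q * (densS * (Real.pi * RI ^ 2 * Real.exp (-(densP * qp * Real.pi * RD ^ 2))))))

theorem quietProb_pos : 0 < quietProb densP densS qp q RD RI := Real.exp_pos _

theorem quietProb_le_one (hd : 0 ≤ densS) (hq0 : 0 ≤ q) : quietProb densP densS qp q RD RI ≤ 1 := by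
  have := Real.pi_pos
  exact Real.exp_le_one_iff.2 (neg_nonpos.2 (by positivity))

/-- A bound for the fluctuations of the interference from secondary nodes. -/
def quietErr (densS q RD RI : ℝ) : ℝ :=
  q ^ 2 * (densS * (Real.pi * RI ^ 2)) + q * Real.sqrt (densS * (Real.pi * RI ^ 2)) +
    q * (densS * Real.sqrt (Real.pi * RI ^ 2 * (Real.pi * (2 * RD) ^ 2)))

theorem quietErr_nonneg (hd : 0 ≤ densS) (hq0 : 0 ≤ q) : 0 ≤ quietErr densS q RD RI := by
  have := Real.pi_pos
  unfold quietErr; positivity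

theorem meanLE_quiet (hρ : 0 < ρ) (hdP : 0 ≤ densP) (hdS : 0 ≤ densS) (hqp0 : 0 ≤ qp)
    (hqp1 : qp ≤ 1) (hq0 : 0 ≤ q) (hq1 : q ≤ 1) (hRD : 0 ≤ RD) (hRI : 0 ≤ RI) {z : Plane}
    (hz : ‖z‖ + (RI + RD) ≤ ρ) :
    MeanLE (poissonLaw ρ densS) (fun ω => ∫ ωp, |(1 - q) ^ freeCount ωp qp RD RI z ω -
      quietProb densP densS qp q RD RI| ∂(poissonLaw ρ densP)) (quietErr densS q RD RI) := by
  have := isProbabilityMeasure_poissonLaw hρ hdP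
  have := isProbabilityMeasure_poissonLaw hρ hdS
  have hpi := Real.pi_pos
  set m := Real.pi * RI ^ 2 * Real.exp (-(densP * qp * Real.pi * RD ^ 2)) with hm
  have hm0 : 0 ≤ m := by positivity
  set N : Config → Config → ℝ := fun ωp ω => freeCount ωp qp RD RI z ω with hN
  set F : Config → ℝ := fun ωp => freeArea ωp qp RD RI z with hF
  have hF0 : ∀ ωp, 0 ≤ F ωp := fun ωp => freeArea_nonneg _ _ _ _ _
  have hF1 : ∀ ωp, F ωp ≤ Real.pi * RI ^ 2 := fun ωp => freeArea_le _ _ _ hRI _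
  have hFm : Measurable F := measurable_freeArea qp RD RI z
  have hcm := measurable_freeCount_left qp RD RI z
  have hNm : Measurable fun p : Config × Config => N p.1 p.2 :=
    (measurable_of_countable (fun n : ℕ => (n : ℝ))).comp hcm
  have hZm : Measurable fun p : Config × Config =>
      |(1 - q) ^ freeCount p.1 qp RD RI z p.2 - quietProb densP densS qp q RD RI| :=
    (((measurable_of_countable (fun n : ℕ => (1 - q) ^ n)).comp hcm).sub_const _).abs
  have hN1 : ∀ ωp ω, N ωp ω ≤ ω.1 := fun ωp ω =>
    Nat.cast_le.2 (freeCount_le ωp qp RD RI z ω)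
  have hN0 : ∀ ωp ω, 0 ≤ N ωp ω := fun ωp ω => Nat.cast_nonneg _
  -- `F1` carries the error of the exponential approximation and the fluctuation of the count around
  -- its mean for a fixed primary network; `F2` carries the fluctuation of that mean, i.e. of the
  -- free area.
  set F1 : Config → Config → ℝ := fun ωp ω => q ^ 2 * N ωp ω + q * |N ωp ω - densS * F ωp| with hF1'
  set F2 : Config → ℝ := fun ωp => q * densS * |F ωp - m| with hF2'
  have hF1m : Measurable fun p : Config × Config => F1 p.1 p.2 :=
    (hNm.const_mul _).add (((hNm.sub ((hFm.comp measurable_fst).const_mul _)).abs).const_mul _)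
  have hF1i : ∀ ω, Integrable (fun ωp => F1 ωp ω) (poissonLaw ρ densP) := by
    intro ω
    refine Integrable.of_bound (hF1m.comp measurable_prodMk_right).aestronglyMeasurable
      (q ^ 2 * ω.1 + q * (ω.1 + densS * (Real.pi * RI ^ 2))) (Eventually.of_forall fun ωp => ?_)
    have h1 := hN1 ωp ω
    have h2 := hN0 ωp ω
    have h3 : densS * F ωp ≤ densS * (Real.pi * RI ^ 2) := mul_le_mul_of_nonneg_left (hF1 ωp) hdS
    have h3' : 0 ≤ densS * F ωp := mul_nonneg hdS (hF0 ωp)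
    have h4 : |N ωp ω - densS * F ωp| ≤ ω.1 + densS * (Real.pi * RI ^ 2) := by
      rw [abs_le]; constructor <;> linarith [show 0 ≤ densS * (Real.pi * RI ^ 2) by positivity]
    rw [Real.norm_of_nonneg (by simp only [hF1']; positivity)]
    simp only [hF1']
    gcongr
  have hF2i : Integrable F2 (poissonLaw ρ densP) := by
    refine Integrable.of_bound (((hFm.sub_const m).abs.const_mul _)).aestronglyMeasurable
      (q * densS * (Real.pi * RI ^ 2 + m)) (Eventually.of_forall fun ωp => ?_)
    have h4 : |F ωp - m| ≤ Real.pi * RI ^ 2 + m := by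
      rw [abs_le]; constructor <;> linarith [hF0 ωp, hF1 ωp]
    rw [Real.norm_of_nonneg (by simp only [hF2']; positivity)]
    simp only [hF2']
    gcongr
  have hpt : ∀ ωp ω, |(1 - q) ^ freeCount ωp qp RD RI z ω - quietProb densP densS qp q RD RI| ≤
      F1 ωp ω + F2 ωp := by
    intro ωp ω
    refine (abs_pow_sub_exp_le hq0 hq1 (mul_nonneg hdS hm0) _).trans ?_
    simp only [hF1', hF2', add_assoc]
    gcongr
    rw [mul_assoc, ← mul_add]
    gcongr
    have e : (N ωp ω) - densS * m = (N ωp ω - densS * F ωp) + densS * (F ωp - m) := by ring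
    change |N ωp ω - densS * m| ≤ _
    rw [e]
    refine (abs_add_le _ _).trans ?_
    rw [abs_mul, abs_of_nonneg hdS]
  have hZi : ∀ ω, Integrable (fun ωp => |(1 - q) ^ freeCount ωp qp RD RI z ω -
      quietProb densP densS qp q RD RI|) (poissonLaw ρ densP) := fun ω =>
    ((hF1i ω).add hF2i).mono' (hZm.comp measurable_prodMk_right).aestronglyMeasurable
      (Eventually.of_forall fun ωp => by rw [Real.norm_of_nonneg (abs_nonneg _)]; exact hpt ωp ω)
  have b2 : ∫ ωp, F2 ωp ∂(poissonLaw ρ densP) ≤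
      q * densS * Real.sqrt (Real.pi * RI ^ 2 * (Real.pi * (2 * RD) ^ 2)) := by
    have h := (meanLE_abs_freeArea_sub hρ hdP hqp0 hqp1 hRD hRI hz).const_mul
      (c := q * densS) (by positivity)
    refine (le_abs_self _).trans (h.abs_integral_le (Eventually.of_forall fun ωp => ?_)
      (by positivity))
    rw [abs_of_nonneg (by simp only [hF2']; positivity)]
  have b1 : MeanLE (poissonLaw ρ densS) (fun ω => ∫ ωp, F1 ωp ω ∂(poissonLaw ρ densP))
      (q ^ 2 * (densS * (Real.pi * RI ^ 2)) + q * Real.sqrt (densS * (Real.pi * RI ^ 2))) := by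
    -- The order of integration is exchanged: for a frozen primary network the count is a Poisson
    -- sum with mean `densS * F ωp`, to which the moment bounds apply.
    refine MeanLE.of_prod hF1m (fun ωp => ?_) (fun ωp ω => by
      have := hN0 ωp ω; simp only [hF1']; positivity) hF1i
    have hh : Measurable fun y => diskInd RI z y * freeInd ωp qp RD y :=
      (measurable_diskInd_right RI z).mul (measurable_freeInd_right qp RD ωp)
    have hh0 : ∀ y, 0 ≤ diskInd RI z y * freeInd ωp qp RD y := fun y =>
      mul_nonneg (diskInd_nonneg _ _ _) (freeInd_nonneg _ _ _ _)
    have hh1 : ∀ y, diskInd RI z y * freeInd ωp qp RD y ≤ 1 := fun y =>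
      mul_le_one₀ (diskInd_le_one _ _ _) (freeInd_nonneg _ _ _ _) (freeInd_le_one _ _ _ _)
    have hNs : ∀ ω : Config, ∑ i, diskInd RI z (ω.2 i).1 * freeInd ωp qp RD (ω.2 i).1 = N ωp ω := by
      intro ω
      simp only [hN, freeCount]
      push_cast
      exact Finset.sum_congr rfl fun i _ => (cast_nearFree _ _ _ _ _ _).symm
    have c1 := meanLE_poissonLaw_sum hρ hdS hh hh0 hh1
    have c2 := meanLE_poissonLaw_abs_sum_sub hρ hdS hh hh0 hh1
    simp_rw [hNs] at c1 c2
    rw [setIntegral_nearFree ωp (by linarith)] at c1 c2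
    have hle : densS * F ωp ≤ densS * (Real.pi * RI ^ 2) := mul_le_mul_of_nonneg_left (hF1 ωp) hdS
    have c1' := (c1.mono (fun _ => le_rfl) hle).const_mul (sq_nonneg q)
    have c2' := (c2.mono (fun _ => le_rfl) (Real.sqrt_le_sqrt hle)).const_mul hq0
    exact c1'.add c2' ((hNm.comp measurable_prodMk_left).const_mul _) (by positivity) (by positivity)
  have b3 := b1.add (meanLE_const (∫ ωp, F2 ωp ∂(poissonLaw ρ densP)))
    (hF1m.stronglyMeasurable.integral_prod_left').measurable (by positivity)
    (integral_nonneg fun ωp => by simp only [hF2']; positivity)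
  refine b3.mono (fun ω => ?_) ?_
  · rw [← integral_add (hF1i ω) hF2i]
    exact integral_mono (hZi ω) ((hF1i ω).add hF2i) fun ωp => hpt ωp ω
  · unfold quietErr
    linarith [b2]

/-- The typical value of the success probability, divided by the access probability. -/
def typicalReach (densP densS qp q RD RI RIps : ℝ) : ℝ :=
  Real.exp (-(densP * qp * Real.pi * (RD ^ 2 + RIps ^ 2))) * quietProb densP densS qp q RD RI

/-- The mean fluctuation of the interference at a receiver. -/
def quietDev (Pp : Measure Config) (r c qp q RD RI : ℝ) (z : Plane) (ω : Config) : ℝ :=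
  coreInd r z * ∫ ωp, |(1 - q) ^ freeCount ωp qp RD RI z ω - c| ∂Pp

/-- The three errors come from overlapping disks around transmitter and relay, from counting without
`k` instead of without `i`, and from the fluctuation of the interference at `k`. Once the silence
factor is replaced by its typical value, the remaining mean is a void probability of two disks. -/
theorem abs_meanReach_sub_le (hρ : 0 < ρ) (hdP : 0 ≤ densP) (hdS : 0 ≤ densS) (hqp0 : 0 ≤ qp)
    (hqp1 : qp ≤ 1) (hq0 : 0 ≤ q) (hq1 : q ≤ 1) (hRD : 0 ≤ RD) (hRIps : 0 ≤ RIps) (ω : Config)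
    (i k : Fin ω.1) (hi : ‖ω.pos i‖ + RD ≤ ρ) (hk : ‖ω.pos k‖ + RIps ≤ ρ)
    {r : ℝ} (hkr : ‖ω.pos k‖ ≤ r) :
    |meanReach (poissonLaw ρ densP) qp q RD RI RIps ω.pos i k -
      typicalReach densP densS qp q RD RI RIps| ≤
      diskInd (RD + RIps) (ω.pos i) (ω.pos k) + q + quietDev (poissonLaw ρ densP) r
        (quietProb densP densS qp q RD RI) qp q RD RI (ω.pos k) (rest ω k) := by
  have := isProbabilityMeasure_poissonLaw hρ hdP
  set z := quietProb densP densS qp q RD RI with hz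
  have hz0 : 0 < z := quietProb_pos
  have hz1 : z ≤ 1 := quietProb_le_one hdS hq0
  set a : Config → ℝ := fun ωp => freeInd ωp qp RD (ω.pos i) * freeInd ωp qp RIps (ω.pos k) with ha
  have ha0 : ∀ ωp, 0 ≤ a ωp := fun ωp => mul_nonneg (freeInd_nonneg _ _ _ _) (freeInd_nonneg _ _ _ _)
  have ha1 : ∀ ωp, a ωp ≤ 1 := fun ωp =>
    mul_le_one₀ (freeInd_le_one _ _ _ _) (freeInd_nonneg _ _ _ _) (freeInd_le_one _ _ _ _)
  have ham : Measurable a := (measurable_freeInd_left _ _ _).mul (measurable_freeInd_left _ _ _)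
  have hai : Integrable a (poissonLaw ρ densP) := Integrable.of_bound ham.aestronglyMeasurable 1
    (Eventually.of_forall fun ω => by rw [Real.norm_of_nonneg (ha0 _)]; exact ha1 _)
  have hrm : Measurable fun ωp : Config => reach ωp qp q RD RI RIps ω.pos i k :=
    (measurable_reach qp q RD RI RIps i k).comp (measurable_id.prodMk measurable_const)
  have hri : Integrable (fun ωp => reach ωp qp q RD RI RIps ω.pos i k) (poissonLaw ρ densP) :=
    Integrable.of_bound hrm.aestronglyMeasurable 1 (Eventually.of_forall fun ωp => by
      rw [Real.norm_of_nonneg (reach_nonneg hq1 _ _ _)]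
      exact (reach_le hq0 hq1 _ _ _).trans (freeInd_le_one _ _ _ _))
  set W : Config → ℝ := fun ωp =>
    |(1 - q) ^ freeCount ωp qp RD RI (ω.pos k) (rest ω k) - z| with hW
  have hWm : Measurable W :=
    (((measurable_of_countable (fun n : ℕ => (1 - q) ^ n)).comp
      ((measurable_freeCount_left qp RD RI (ω.pos k)).comp
        (measurable_id.prodMk measurable_const))).sub_const _).abs
  have hWi : Integrable W (poissonLaw ρ densP) := Integrable.of_bound hWm.aestronglyMeasurable 1
    (Eventually.of_forall fun ωp => by
      have h1 : 0 ≤ (1 - q) ^ freeCount ωp qp RD RI (ω.pos k) (rest ω k) :=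
        pow_nonneg (by linarith) _
      have h2 : (1 - q) ^ freeCount ωp qp RD RI (ω.pos k) (rest ω k) ≤ 1 :=
        pow_le_one₀ (by linarith) (by linarith)
      rw [Real.norm_of_nonneg (abs_nonneg _), abs_le]; constructor <;> linarith)
  have hpt : ∀ ωp, |reach ωp qp q RD RI RIps ω.pos i k - a ωp * z| ≤ q + W ωp := by
    intro ωp
    have h1 := abs_pow_sub_pow_le_of_add_eq hq0 hq1 (interferers_add_eq ωp qp RD RI ω i k)
      (nearFree_le_one _ _ _ _ _ _) (nearFree_le_one _ _ _ _ _ _)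
    have h2 : |(1 - q) ^ interferers ωp qp RD RI ω.pos i k - z| ≤ q + W ωp :=
      (abs_sub_le _ _ _).trans (add_le_add_left h1 _)
    rw [reach, ← mul_sub, abs_mul, abs_of_nonneg (ha0 ωp)]
    exact (mul_le_of_le_one_left (abs_nonneg _) (ha1 ωp)).trans h2
  have hint : |meanReach (poissonLaw ρ densP) qp q RD RI RIps ω.pos i k -
      (∫ ωp, a ωp ∂(poissonLaw ρ densP)) * z| ≤ q + ∫ ωp, W ωp ∂(poissonLaw ρ densP) := by
    rw [meanReach, ← integral_mul_const, ← integral_sub hri (hai.mul_const z)]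
    refine (abs_integral_le_integral_abs).trans ?_
    have h3 : ∫ ωp, (q + W ωp) ∂(poissonLaw ρ densP) = q + ∫ ωp, W ωp ∂(poissonLaw ρ densP) := by
      rw [integral_add (integrable_const q) hWi]; simp
    rw [← h3]
    exact integral_mono (hri.sub (hai.mul_const z)).abs ((integrable_const q).add hWi) hpt
  have hfree := abs_integral_freeInd_mul_sub_le hρ hdP hqp0 hqp1 hRD hRIps hi hk
  have hcore : coreInd r (ω.pos k) = 1 := by
    unfold coreInd; rw [Set.indicator_of_mem (by simpa using hkr)]; rfl
  rw [quietDev, hcore, one_mul, typicalReach]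
  set p := Real.exp (-(densP * qp * Real.pi * (RD ^ 2 + RIps ^ 2)))
  have h4 : |(∫ ωp, a ωp ∂(poissonLaw ρ densP)) * z - p * z| ≤
      diskInd (RD + RIps) (ω.pos i) (ω.pos k) := by
    rw [← sub_mul, abs_mul, abs_of_pos hz0]
    exact (mul_le_of_le_one_right (abs_nonneg _) hz1).trans hfree
  have := abs_sub_le (meanReach (poissonLaw ρ densP) qp q RD RI RIps ω.pos i k)
    ((∫ ωp, a ωp ∂(poissonLaw ρ densP)) * z) (p * z)
  linarith

end

/-! ### Mean fluctuations of the success probabilities and a crude bound -/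

section

variable {ρ densP densS qp q RD RI RIps R : ℝ}

theorem measurable_quietDev (hρ : 0 < ρ) (hdP : 0 ≤ densP) (r c : ℝ) :
    Measurable fun p : (Plane × ℝ) × Config =>
      quietDev (poissonLaw ρ densP) r c qp q RD RI p.1.1 p.2 := by
  have := isProbabilityMeasure_poissonLaw hρ hdP
  have h1 : Measurable fun p : Config × ((Plane × ℝ) × Config) =>
      (((p.1, p.2.1), p.2.2) : (Config × (Plane × ℝ)) × Config) := by fun_prop
  have h2 : Measurable fun p : Config × ((Plane × ℝ) × Config) =>
      |(1 - q) ^ freeCount p.1 qp RD RI p.2.1.1 p.2.2 - c| :=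
    (((measurable_of_countable (fun n : ℕ => (1 - q) ^ n)).comp
      ((measurable_freeCount qp RD RI).comp h1)).sub_const _).abs
  exact ((measurable_coreInd r).comp (measurable_fst.comp measurable_fst)).mul
    h2.stronglyMeasurable.integral_prod_left'.measurable

theorem quietDev_nonneg (Pp : Measure Config) (r c : ℝ) (z : Plane) (ω : Config) :
    0 ≤ quietDev Pp r c qp q RD RI z ω :=
  mul_nonneg (coreInd_nonneg r z) (integral_nonneg fun _ => abs_nonneg _)

theorem quietDev_le_one (Pp : Measure Config) [IsProbabilityMeasure Pp] (hq0 : 0 ≤ q) (hq1 : q ≤ 1)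
    (r : ℝ) {c : ℝ} (hc0 : 0 ≤ c) (hc1 : c ≤ 1) (z : Plane) (ω : Config) :
    quietDev Pp r c qp q RD RI z ω ≤ 1 := by
  refine mul_le_one₀ (coreInd_le_one r z) (integral_nonneg fun _ => abs_nonneg _) ?_
  have h : ∀ ωp, |(1 - q) ^ freeCount ωp qp RD RI z ω - c| ≤ 1 := by
    intro ωp
    have h1 : 0 ≤ (1 - q) ^ freeCount ωp qp RD RI z ω := pow_nonneg (by linarith) _
    have h2 : (1 - q) ^ freeCount ωp qp RD RI z ω ≤ 1 := pow_le_one₀ (by linarith) (by linarith)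
    rw [abs_le]; constructor <;> linarith
  have := norm_integral_le_of_norm_le_const (μ := Pp) (C := 1)
    (f := fun ωp => |(1 - q) ^ freeCount ωp qp RD RI z ω - c|)
    (Eventually.of_forall fun ωp => by rw [Real.norm_of_nonneg (abs_nonneg _)]; exact h ωp)
  rw [probReal_univ, mul_one] at this
  exact (le_abs_self _).trans this

theorem measurable_sum_degree (r : ℝ) : Measurable fun ω : Config => ∑ i, degree r ω.pos i := by
  refine measurable_of_sigma fun n => ?_
  have h : ∀ i k : Fin n, Measurable fun x : Fin n → Plane × ℝ => diskInd r (x i).1 (x k).1 := by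
    intro i k
    have hi : Measurable fun x : Fin n → Plane × ℝ => (x i).1 := by fun_prop
    have hk : Measurable fun x : Fin n → Plane × ℝ => (x k).1 := by fun_prop
    have hik := (measurable_diskInd r).comp (hi.prodMk hk)
    exact hik
  have h2 : ∀ i : Fin n, Measurable fun x : Fin n → Plane × ℝ =>
      degree r (fun m => (x m).1) i := fun i => Finset.measurable_sum _ fun k _ => h i k
  exact Finset.measurable_sum Finset.univ fun i _ => h2 i

/-- The mean fluctuation of the success probabilities within the transmission range. -/
theorem meanLE_sum_rangeDeviation (hρ : 0 < ρ) (hdP : 0 ≤ densP) (hdS : 0 ≤ densS) (hqp0 : 0 ≤ qp)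
    (hqp1 : qp ≤ 1) (hq0 : 0 ≤ q) (hq1 : q ≤ 1) (hRD : 0 ≤ RD) (hRI : 0 ≤ RI) (hRIps : 0 ≤ RIps)
    (hR : 0 ≤ R) :
    MeanLE (poissonLaw ρ densS) (fun ω => ∑ i, coreInd (ρ - (R + RI + RD + RIps)) (ω.pos i) *
      rangeDeviation R ω.pos i (meanReach (poissonLaw ρ densP) qp q RD RI RIps ω.pos i)
        (typicalReach densP densS qp q RD RI RIps))
      (densS * volume.real (region ρ) * (densS * (Real.pi * (RD + RIps) ^ 2) +
        q * (densS * (Real.pi * R ^ 2)) + densS * (Real.pi * R ^ 2) * quietErr densS q RD RI +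
          Real.sqrt (densS * (Real.pi * R ^ 2)))) := by
  classical
  have := isProbabilityMeasure_poissonLaw hρ hdP
  have hpi := Real.pi_pos
  have hΛ : 0 ≤ densS * volume.real (region ρ) := poissonMean_nonneg hdS
  have hqe : 0 ≤ quietErr densS q RD RI := quietErr_nonneg hdS hq0
  set z := quietProb densP densS qp q RD RI with hz
  -- The core radius here is larger than that of the transmitters: every relay within R of a core
  -- transmitter lies in this core.
  set D : Plane → Config → ℝ := quietDev (poissonLaw ρ densP) (ρ - (RI + RD)) z qp q RD RI with hD
  have hD0 : ∀ y ω, 0 ≤ D y ω := fun y ω => quietDev_nonneg _ _ _ _ _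
  have hD1 : ∀ y ω, D y ω ≤ 1 := fun y ω =>
    quietDev_le_one _ hq0 hq1 _ quietProb_pos.le (quietProb_le_one hdS hq0) _ _
  have hDm : Measurable fun p : (Plane × ℝ) × Config => D p.1.1 p.2 := measurable_quietDev hρ hdP _ _
  set m : Plane → ℝ := fun y => densS * ∫ y' in region ρ, diskInd R y y' with hm
  have hmm : Measurable m := ((measurable_diskInd R).stronglyMeasurable.integral_prod_right'
    (ν := volume.restrict (region ρ))).measurable.const_mul _
  have hm1 : ∀ y, m y ≤ densS * (Real.pi * R ^ 2) := fun y =>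
    mul_le_mul_of_nonneg_left (setIntegral_diskInd_le hR y) hdS
  -- Fluctuation and degree at a relay are correlated. As 0 ≤ D ≤ 1, the product of D with the
  -- degree is at most m D plus the absolute deviation of the degree from its mean m, so first
  -- moments suffice.
  set e : Plane × ℝ → Config → ℝ := fun w ω => densS * (Real.pi * R ^ 2) * D w.1 ω +
    |∑ k, diskInd R w.1 (ω.2 k).1 - m w.1| with he
  have hem : Measurable (Function.uncurry e) :=
    (hDm.const_mul _).add ((measurable_sum_diskInd R).sub
      (hmm.comp (measurable_fst.comp measurable_fst))).abs
  have hb : ∀ w, MeanLE (poissonLaw ρ densS) (e w) (densS * (Real.pi * R ^ 2) *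
      quietErr densS q RD RI + Real.sqrt (densS * (Real.pi * R ^ 2))) := by
    intro w
    have b1 : MeanLE (poissonLaw ρ densS) (D w.1) (quietErr densS q RD RI) := by
      rcases coreInd_eq (ρ - (RI + RD)) w.1 with h | h
      · simp [MeanLE, hD, quietDev, h]
      · have := meanLE_quiet (densP := densP) (qp := qp) hρ hdP hdS hqp0 hqp1 hq0 hq1 hRD hRI
          (z := w.1) (by linarith [h.2])
        refine this.mono (fun ω => ?_) le_rfl
        rw [hD, quietDev, h.1, one_mul]
    have b2 := meanLE_poissonLaw_abs_sum_sub hρ hdS (measurable_diskInd_right R w.1)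
      (diskInd_nonneg R w.1) (diskInd_le_one R w.1)
    have b2' := b2.mono (fun _ => le_rfl) (Real.sqrt_le_sqrt (hm1 w.1))
    exact (b1.const_mul (by positivity)).add b2' ((hDm.comp measurable_prodMk_left).const_mul _)
      (by positivity) (by positivity)
  have c3 := meanLE_poissonLaw_sum_rest hρ hdS hem hb
  have c1 := meanLE_sum_degree hρ hdS (r := RD + RIps) (by positivity)
  have c2 := (meanLE_sum_degree hρ hdS hR).const_mul hq0
  have hdegm := measurable_sum_degree
  have c12 := c1.add c2 (hdegm _) (by positivity) (by positivity)
  have c := c12.add c3 ((hdegm _).add ((hdegm _).const_mul _)) (by positivity) (by positivity)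
  refine c.mono (fun ω => ?_) (le_of_eq (by ring))
  -- The fluctuation belongs to the relay, so the pairs are summed by relay, with its degree as
  -- weight, before Mecke's formula is applied there.
  have hswap : ∑ i, ∑ k with k ≠ i, diskInd R (ω.pos i) (ω.pos k) * D (ω.pos k) (rest ω k) =
      ∑ k, D (ω.pos k) (rest ω k) * degree R ω.pos k := by
    have hsymm : ∀ i k : Fin ω.1, diskInd R (ω.pos i) (ω.pos k) = diskInd R (ω.pos k) (ω.pos i) := by
      intro i k; rw [diskInd_eq, diskInd_eq, dist_comm]
    simp_rw [degree, Finset.mul_sum, Finset.sum_filter]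
    rw [Finset.sum_comm]
    refine Finset.sum_congr rfl fun k _ => Finset.sum_congr rfl fun i _ => ?_
    rw [hsymm i k]
    by_cases h : k = i
    · simp [h]
    · have h' : i ≠ k := fun h' => h h'.symm
      simp [h, h', mul_comm]
  have hthird : ∑ k, D (ω.pos k) (rest ω k) * degree R ω.pos k ≤ ∑ k, e (ω.2 k) (rest ω k) := by
    refine Finset.sum_le_sum fun k _ => ?_
    rw [degree_eq_rest]
    simp only [he]
    change D (ω.2 k).1 (rest ω k) * _ ≤ _
    set d := ∑ k_1, diskInd R (ω.2 k).1 ((rest ω k).2 k_1).1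
    set y := (ω.2 k).1
    have h1 := hD0 y (rest ω k)
    have h2 := hD1 y (rest ω k)
    have h3 : D y (rest ω k) * d = D y (rest ω k) * m y + D y (rest ω k) * (d - m y) := by ring
    rw [h3]
    refine add_le_add ?_ ?_
    · rw [mul_comm]; exact mul_le_mul_of_nonneg_right (hm1 y) h1
    · calc _ ≤ D y (rest ω k) * |d - m y| := mul_le_mul_of_nonneg_left (le_abs_self _) h1
        _ ≤ _ := mul_le_of_le_one_left (abs_nonneg _) h2
  refine le_trans ?_ (add_le_add_right hthird _)
  rw [← hswap, Finset.mul_sum, ← Finset.sum_add_distrib, ← Finset.sum_add_distrib]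
  refine Finset.sum_le_sum fun i _ => ?_
  rw [degree, degree, Finset.mul_sum, ← Finset.sum_add_distrib, ← Finset.sum_add_distrib]
  have hnn : ∀ k, 0 ≤ diskInd (RD + RIps) (ω.pos i) (ω.pos k) +
      q * diskInd R (ω.pos i) (ω.pos k) + diskInd R (ω.pos i) (ω.pos k) * D (ω.pos k) (rest ω k) := by
    intro k
    have h1 := diskInd_nonneg (RD + RIps) (ω.pos i) (ω.pos k)
    have h2 := diskInd_nonneg R (ω.pos i) (ω.pos k)
    have h3 := hD0 (ω.pos k) (rest ω k)
    positivity
  rcases coreInd_eq (ρ - (R + RI + RD + RIps)) (ω.pos i) with h | h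
  · rw [h, zero_mul]
    exact Finset.sum_nonneg fun k _ => hnn k
  · rw [h.1, one_mul, rangeDeviation, Finset.sum_filter, Finset.sum_filter]
    refine Finset.sum_le_sum fun k _ => ?_
    by_cases hki : k ≠ i
    · by_cases hd : dist (ω.pos k) (ω.pos i) ≤ R
      · rw [if_pos ⟨hki, hd⟩, if_pos hki]
        have hone : diskInd R (ω.pos i) (ω.pos k) = 1 := by rw [diskInd_eq, if_pos hd]
        have hk : ‖ω.pos k‖ ≤ ρ - (RI + RD + RIps) := by
          have h1 := norm_le_norm_add_norm_sub' (ω.pos k) (ω.pos i)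
          rw [← dist_eq_norm] at h1
          linarith [h.2]
        rw [hone, one_mul, mul_one]
        exact abs_meanReach_sub_le hρ hdP hdS hqp0 hqp1 hq0 hq1 hRD hRIps ω i k
          (by linarith [h.2]) (by linarith) (by linarith)
      · rw [if_neg (fun h => hd h.2), if_pos hki]
        exact hnn k
    · rw [if_neg (fun h => hki h.1), if_neg hki]

theorem meanReach_nonneg (Pp : Measure Config) (hq1 : q ≤ 1) {n : ℕ} (x : Fin n → Plane)
    (i k : Fin n) : 0 ≤ meanReach Pp qp q RD RI RIps x i k :=
  integral_nonneg fun _ => reach_nonneg hq1 _ _ _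

theorem meanReach_le (Pp : Measure Config) [IsProbabilityMeasure Pp] (hq0 : 0 ≤ q) (hq1 : q ≤ 1)
    {n : ℕ} (x : Fin n → Plane) (i k : Fin n) :
    meanReach Pp qp q RD RI RIps x i k ≤ ∫ ωp, freeInd ωp qp RD (x i) ∂Pp := by
  have hrm : Measurable fun ωp : Config => reach ωp qp q RD RI RIps x i k :=
    (measurable_reach qp q RD RI RIps i k).comp (measurable_id.prodMk measurable_const)
  refine integral_mono (Integrable.of_bound hrm.aestronglyMeasurable 1
    (Eventually.of_forall fun ωp => ?_)) (Integrable.of_bound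
      (measurable_freeInd_left _ _ _).aestronglyMeasurable 1 (Eventually.of_forall fun ωp => ?_))
    fun ωp => reach_le hq0 hq1 _ _ _
  · rw [Real.norm_of_nonneg (reach_nonneg hq1 _ _ _)]
    exact (reach_le hq0 hq1 _ _ _).trans (freeInd_le_one _ _ _ _)
  · rw [Real.norm_of_nonneg (freeInd_nonneg _ _ _ _)]
    exact freeInd_le_one _ _ _ _

theorem weightedProgress_const_mul (T : Traffic) (R c : ℝ) {n : ℕ} (x : Fin n → Plane)
    (s : Fin n → Fin n → ℝ) :
    weightedProgress T R x (fun i k => c * s i k) = c * weightedProgress T R x s := by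
  unfold weightedProgress
  rw [Finset.mul_sum]
  refine Finset.sum_congr rfl fun i _ => ?_
  rw [Finset.mul_sum]
  refine Finset.sum_congr rfl fun j _ => ?_
  have h : ∑ k ∈ candidates x R i j, progress x i j k * (c * s i k) =
      c * ∑ k ∈ candidates x R i j, progress x i j k * s i k := by
    rw [Finset.mul_sum]
    exact Finset.sum_congr rfl fun k _ => by ring
  rw [h]; ring

theorem integral_freeInd_nonneg (Pp : Measure Config) (qp RD : ℝ) (y : Plane) :
    0 ≤ ∫ ωp, freeInd ωp qp RD y ∂Pp := integral_nonneg fun _ => freeInd_nonneg _ _ _ _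

theorem integral_freeInd_le_one (Pp : Measure Config) [IsProbabilityMeasure Pp] (qp RD : ℝ)
    (y : Plane) : ∫ ωp, freeInd ωp qp RD y ∂Pp ≤ 1 := by
  have := norm_integral_le_of_norm_le_const (μ := Pp) (C := 1)
    (f := fun ωp => freeInd ωp qp RD y) (Eventually.of_forall fun ωp => by
      rw [Real.norm_of_nonneg (freeInd_nonneg _ _ _ _)]; exact freeInd_le_one _ _ _ _)
  rw [probReal_univ, mul_one] at this
  exact (le_abs_self _).trans this

/-- The order of magnitude of the secondary throughput. -/
theorem abs_secondaryThroughput_le (hρ : 0 < ρ) (hdP : 0 ≤ densP) (hdS : 0 ≤ densS) (hq0 : 0 ≤ q)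
    (hq1 : q ≤ 1) (hR : 0 ≤ R) (T : Traffic) {v : ℝ} (hv0 : 0 ≤ v)
    (hv : ∀ y ∈ region ρ, ∫ ωp, freeInd ωp qp RD y ∂(poissonLaw ρ densP) ≤ v) :
    |secondaryThroughput ρ densP densS T R RI RIps RD qp q| ≤
      R * q * v * (densS * volume.real (region ρ)) := by
  have := isProbabilityMeasure_poissonLaw hρ hdP
  have hΛ : 0 ≤ densS * volume.real (region ρ) := poissonMean_nonneg hdS
  rw [(secondaryThroughput_eq hρ hdP hdS hR hq0 hq1 T).2]
  set h : Plane → ℝ := fun y => ∫ ωp, freeInd ωp qp RD y ∂(poissonLaw ρ densP) with hh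
  have hm : Measurable h := (measurable_freeInd qp RD).stronglyMeasurable.integral_prod_left'.measurable
  have h0 : ∀ y, 0 ≤ h y := integral_freeInd_nonneg _ qp RD
  have h1 : ∀ y, h y ≤ 1 := integral_freeInd_le_one _ qp RD
  have hint : ∫ y in region ρ, h y ≤ v * volume.real (region ρ) := by
    have hi : IntegrableOn h (region ρ) := Measure.integrableOn_of_bounded (M := 1)
      (volume_region_ne_top ρ) hm.aestronglyMeasurable (Eventually.of_forall fun y => by
        rw [Real.norm_of_nonneg (h0 y)]; exact h1 y)
    refine (setIntegral_mono_on hi (integrableOn_const (C := v) (volume_region_ne_top ρ))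
      (measurableSet_region ρ) hv).trans (le_of_eq ?_)
    rw [setIntegral_const, smul_eq_mul, mul_comm]
  have hsum := (meanLE_poissonLaw_sum hρ hdS hm h0 h1).const_mul (c := R * q) (by positivity)
  refine (hsum.mono (fun _ => le_rfl) ?_ : MeanLE _ _ _).abs_integral_le
    (Eventually.of_forall fun ω => ?_) (by positivity)
  · calc _ ≤ R * q * (densS * (v * volume.real (region ρ))) := by gcongr
      _ = _ := by ring
  · have hw := abs_weightedProgress_le T hR ω.pos (c := fun i => q * h (ω.pos i))
      (s := fun i k => q * meanReach (poissonLaw ρ densP) qp q RD RI RIps ω.pos i k)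
      (fun i => mul_nonneg hq0 (h0 _)) fun i k => by
        rw [abs_of_nonneg (mul_nonneg hq0 (meanReach_nonneg _ hq1 _ _ _))]
        exact mul_le_mul_of_nonneg_left (meanReach_le _ hq0 hq1 _ _ _) hq0
    rw [← Finset.mul_sum, ← mul_assoc] at hw
    exact hw

end

/-! ### Quantitative estimate of the throughput -/

theorem measurable_sum_pos {F : (n : ℕ) → (Fin n → Plane) → Fin n → ℝ}
    (hF : ∀ n i, Measurable fun x => F n x i) :
    Measurable fun ω : Config => ∑ i, F ω.1 ω.pos i := by
  refine measurable_of_sigma fun n => ?_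
  have hx : Measurable fun z : Fin n → Plane × ℝ => fun i => (z i).1 := by fun_prop
  exact Finset.measurable_sum Finset.univ fun i _ => (hF n i).comp hx

theorem measurable_nearProb (T : Traffic) (r : ℝ) {n : ℕ} (i : Fin n) :
    Measurable fun x : Fin n → Plane => nearProb T r x i := by
  unfold nearProb
  simp_rw [Finset.sum_filter]
  exact Finset.measurable_sum _ fun j _ => Measurable.ite
    (measurableSet_le (by fun_prop) measurable_const) (T.measurable_destProb n i j) measurable_const

theorem measurable_localSum (R : ℝ) {g : Plane → ℝ} (hg : Measurable g) {n : ℕ} (i : Fin n) :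
    Measurable fun x : Fin n → Plane => localSum R x i g := by
  have h : ∀ k : Fin n, Measurable fun x : Fin n → Plane => R⁻¹ • (x k - x i) := fun k => by
    fun_prop
  exact Finset.measurable_sum _ fun k _ => hg.comp (h k)

theorem measurable_coreInd_pos (r : ℝ) {n : ℕ} (i : Fin n) :
    Measurable fun x : Fin n → Plane => coreInd r (x i) :=
  (measurable_coreInd r).comp (measurable_pi_apply i)

theorem integrable_card_poissonLaw {ρ dens : ℝ} (hρ : 0 < ρ) (hd : 0 ≤ dens) :
    Integrable (fun ω : Config => (ω.1 : ℝ)) (poissonLaw ρ dens) := by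
  have := isProbabilityMeasure_nodeLaw hρ
  exact integrable_card (ν := nodeLaw ρ) (poissonMean_nonneg hd)

theorem integral_card_poissonLaw {ρ dens : ℝ} (hρ : 0 < ρ) (hd : 0 ≤ dens) :
    ∫ ω : Config, (ω.1 : ℝ) ∂(poissonLaw ρ dens) = dens * volume.real (region ρ) := by
  have := isProbabilityMeasure_nodeLaw hρ
  exact integral_card (ν := nodeLaw ρ) (poissonMean_nonneg hd)

theorem meanLE_card {ρ dens : ℝ} (hρ : 0 < ρ) (hd : 0 ≤ dens) :
    MeanLE (poissonLaw ρ dens) (fun ω => (ω.1 : ℝ)) (dens * volume.real (region ρ)) := by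
  unfold MeanLE
  rw [← ofReal_integral_eq_lintegral_ofReal (integrable_card_poissonLaw hρ hd)
    (Eventually.of_forall fun ω => by positivity), integral_card_poissonLaw hρ hd]

/-- Bookkeeping of the mean bounds: with L = densS R², a standard deviation of order √L divided by L
becomes 1 / √L, and close pairs become (D / R)². K majorizes every coefficient, so a single constant
multiplies all errors. -/
theorem error_terms_le {ρ densS R V η k N e q S D δ M K : ℝ} (hρ : 0 < ρ) (hdS : 0 < densS)
    (hR : 0 < R) (hV : 0 < V) (hη : 0 < η) (hk : 0 ≤ k) (hN : 0 ≤ N) (he : 0 ≤ e) (hq : 0 ≤ q)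
    (hS : 0 ≤ S) (hK : 1 + 2 * (Real.pi * M ^ 2) + 2 + 4 * Real.pi * ρ +
      2 / η * (k * (V * Real.sqrt Real.pi)) + 2 / capInt * (V * Real.sqrt Real.pi) +
      2 / capInt * (V * Real.pi) ≤ K) :
    1 + 2 * (densS * (Real.pi * (M * R) ^ 2) + N) + 2 * (densS * (2 * Real.pi * ρ * S)) +
        2 / (densS * R ^ 2 * η) * (k * (densS * V * Real.sqrt (densS * R ^ 2 * Real.pi))) +
        δ / V * (densS * V) + 2 / (capInt * (densS * R ^ 2)) * (densS * V *
        (densS * (Real.pi * D ^ 2) + q * (densS * (Real.pi * R ^ 2)) +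
          densS * (Real.pi * R ^ 2) * e + Real.sqrt (densS * (Real.pi * R ^ 2)))) ≤
      densS * (δ + K * (1 / densS + R ^ 2 + N / densS + S + 1 / Real.sqrt (densS * R ^ 2) +
        (D / R) ^ 2 + q + e)) := by
  have hpi := Real.pi_pos
  have hb := capInt_pos
  have hL0 : 0 < densS * R ^ 2 := by positivity
  set a := Real.sqrt (densS * R ^ 2) with ha
  have ha0 : 0 < a := Real.sqrt_pos.2 hL0
  have haL : a / (densS * R ^ 2) = 1 / a := by
    rw [div_eq_div_iff hL0.ne' ha0.ne', one_mul, ha, Real.mul_self_sqrt hL0.le]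
  have e1 : Real.sqrt (densS * R ^ 2 * Real.pi) = a * Real.sqrt Real.pi := Real.sqrt_mul hL0.le _
  have e2 : Real.sqrt (densS * (Real.pi * R ^ 2)) = a * Real.sqrt Real.pi := by
    rw [← e1]; congr 1; ring
  rw [e1, e2]
  have hu : 0 ≤ Real.sqrt Real.pi := Real.sqrt_nonneg _
  set u := Real.sqrt Real.pi
  clear_value u a
  have h1 : 2 / (densS * R ^ 2 * η) * (k * (densS * V * (a * u))) =
      densS * (2 / η * (k * (V * u)) * (1 / a)) := by
    rw [← haL]; field_simp
  have h2 : 2 / (capInt * (densS * R ^ 2)) * (densS * V * (densS * (Real.pi * D ^ 2) +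
      q * (densS * (Real.pi * R ^ 2)) + densS * (Real.pi * R ^ 2) * e + a * u)) =
      densS * (2 / capInt * (V * Real.pi) * (D / R) ^ 2 +
        2 / capInt * (V * Real.pi) * q + 2 / capInt * (V * Real.pi) * e +
        2 / capInt * (V * u) * (1 / a)) := by
    rw [← haL]; field_simp
  rw [h1, h2]
  have h3 : 1 + 2 * (densS * (Real.pi * (M * R) ^ 2) + N) + 2 * (densS *
      (2 * Real.pi * ρ * S)) + δ / V * (densS * V) = densS * (δ + 1 * (1 / densS) +
        2 * (Real.pi * M ^ 2) * R ^ 2 + 2 * (N / densS) + 4 * Real.pi * ρ * S) := by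
    field_simp; ring
  have p1 : (0 : ℝ) ≤ 2 * (Real.pi * M ^ 2) := by positivity
  have p2 : (0 : ℝ) ≤ 4 * Real.pi * ρ := by positivity
  have p3 : (0 : ℝ) ≤ 2 / η * (k * (V * u)) := by positivity
  have p4 : (0 : ℝ) ≤ 2 / capInt * (V * u) := by positivity
  have p5 : (0 : ℝ) ≤ 2 / capInt * (V * Real.pi) := by positivity
  have t1 : 1 * (1 / densS) ≤ K * (1 / densS) :=
    mul_le_mul_of_nonneg_right (by linarith) (by positivity)
  have t2 : 2 * (Real.pi * M ^ 2) * R ^ 2 ≤ K * R ^ 2 :=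
    mul_le_mul_of_nonneg_right (by linarith) (by positivity)
  have t3 : 2 * (N / densS) ≤ K * (N / densS) :=
    mul_le_mul_of_nonneg_right (by linarith) (by positivity)
  have t4 : 4 * Real.pi * ρ * S ≤ K * S := mul_le_mul_of_nonneg_right (by linarith) hS
  have t5 : (2 / η * (k * (V * u)) + 2 / capInt * (V * u)) * (1 / a) ≤ K * (1 / a) :=
    mul_le_mul_of_nonneg_right (by linarith) (by positivity)
  have t6 : 2 / capInt * (V * Real.pi) * (D / R) ^ 2 ≤ K * (D / R) ^ 2 :=
    mul_le_mul_of_nonneg_right (by linarith) (by positivity)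
  have t7 : 2 / capInt * (V * Real.pi) * q ≤ K * q := mul_le_mul_of_nonneg_right (by linarith) hq
  have t8 : 2 / capInt * (V * Real.pi) * e ≤ K * e := mul_le_mul_of_nonneg_right (by linarith) he
  have t := mul_le_mul_of_nonneg_left (add_le_add (add_le_add (add_le_add (add_le_add
    (add_le_add (add_le_add (add_le_add t1 t2) t3) t4) t5) t6) t7) t8) hdS.le
  linarith [h3]

set_option maxHeartbeats 800000 in
/-- The throughput is close to its typical value. -/
theorem exists_abs_secondaryThroughput_sub_le {ρ : ℝ} (hρ : 0 < ρ) {δ : ℝ} (hδ : 0 < δ) :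
    ∃ K M : ℝ, 0 < K ∧ 0 < M ∧ ∀ (densP densS qp q RD RI RIps R : ℝ) (T : Traffic),
      0 ≤ densP → 0 < densS → 0 ≤ qp → qp ≤ 1 → 0 ≤ q → q ≤ 1 → 0 ≤ RD → 0 ≤ RI → 0 ≤ RIps →
      0 < R → R + RI + RD + RIps ≤ ρ → 0 ≤ T.relayedNear ρ densS (M * R) →
      |secondaryThroughput ρ densP densS T R RI RIps RD qp q -
        q * (typicalReach densP densS qp q RD RI RIps * (meanProgress * R)) *
          (densS * volume.real (region ρ))| ≤
        R * q * densS * (δ + K * (1 / densS + R ^ 2 + T.relayedNear ρ densS (M * R) / densS +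
          (R + RI + RD + RIps) + 1 / Real.sqrt (densS * R ^ 2) + ((RD + RIps) / R) ^ 2 + q +
            quietErr densS q RD RI)) := by
  classical
  have hpi := Real.pi_pos
  have hV : 0 < volume.real (region ρ) := volume_real_region_pos hρ
  set V := volume.real (region ρ) with hVdef
  -- The error δ / V is paid once per node, and the mean number of nodes is densS V.
  obtain ⟨G, η, M, hη, hM, hG, H⟩ := exists_testFns_weightedProgress (δ := δ / V) (by positivity)
  have hb := capInt_pos
  set K := 1 + 2 * (Real.pi * M ^ 2) + 2 + 4 * Real.pi * ρ + 2 / η * (G.card * (V * Real.sqrt Real.pi)) +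
    2 / capInt * (V * Real.sqrt Real.pi) + 2 / capInt * (V * Real.pi) with hK
  refine ⟨K, M, by positivity, by linarith, ?_⟩
  intro densP densS qp q RD RI RIps R T hdP hdS hqp0 hqp1 hq0 hq1 hRD hRI hRIps hR hρR hnear
  have := isProbabilityMeasure_poissonLaw hρ hdP
  have hPs := isProbabilityMeasure_poissonLaw hρ hdS.le
  have hc0 : 0 ≤ typicalReach densP densS qp q RD RI RIps :=
    mul_nonneg (Real.exp_pos _).le quietProb_pos.le
  have hc1 : typicalReach densP densS qp q RD RI RIps ≤ 1 :=
    mul_le_one₀ (Real.exp_le_one_iff.2 (neg_nonpos.2 (by positivity))) quietProb_pos.le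
      (quietProb_le_one hdS.le hq0)
  set c := typicalReach densP densS qp q RD RI RIps with hcdef
  set L := densS * R ^ 2 with hL
  have hL0 : 0 < L := by positivity
  -- From a node in this core, one hop to a relay, its interference disk and the detection or
  -- primary interference disks all stay inside the region, so no area is truncated by the boundary.
  set r := ρ - (R + RI + RD + RIps) with hr
  set s : (ω : Config) → Fin ω.1 → Fin ω.1 → ℝ := fun ω i k =>
    meanReach (poissonLaw ρ densP) qp q RD RI RIps ω.pos i k with hs
  have hs1 : ∀ ω i k, s ω i k ≤ 1 := fun ω i k =>
    (meanReach_le _ hq0 hq1 _ _ _).trans (integral_freeInd_le_one _ _ _ _)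
  obtain ⟨hint, heq⟩ := secondaryThroughput_eq (densP := densP) (RI := RI) (RIps := RIps)
    (RD := RD) (qp := qp) hρ hdP hdS.le hR.le hq0 hq1 T
  have hcard := integrable_card_poissonLaw hρ hdS.le
  rw [heq, ← integral_card_poissonLaw hρ hdS.le, ← integral_const_mul,
    ← integral_sub hint (hcard.const_mul _)]
  have m1 := (meanLE_sum_nearProb hρ hdS.le T (r := M * R) (by positivity)).const_mul
    (c := 2) zero_le_two
  have m2 := (meanLE_sum_one_sub_coreInd hρ hdS.le (r := r) (by linarith)
    (by linarith)).const_mul (c := 2) zero_le_two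
  have m3 := (MeanLE.finset_sum (P := poissonLaw ρ densS) G (fun g hg =>
    meanLE_localSum (r := r) hρ hdS.le (hG g hg) hR (by linarith))
    (fun g hg => measurable_sum_pos fun n i => (measurable_coreInd_pos r i).mul
      ((measurable_localSum R (hG g hg).measurable i).sub_const _).abs)
    (fun g _ => by positivity)).const_mul (c := 2 / (L * η)) (by positivity)
  have m4 := (meanLE_card hρ hdS.le).const_mul (c := δ / V) (by positivity)
  have m5 := (meanLE_sum_rangeDeviation (densP := densP) (qp := qp) (q := q) hρ hdP hdS.le hqp0 hqp1
    hq0 hq1 hRD hRI hRIps hR.le).const_mul (c := 2 / (capInt * L)) (by positivity)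
  have hqe : 0 ≤ quietErr densS q RD RI := quietErr_nonneg hdS.le hq0
  have k1 : Measurable fun ω : Config => 2 * ∑ i, nearProb T (M * R) ω.pos i :=
    (measurable_sum_pos fun n i => measurable_nearProb T (M * R) i).const_mul 2
  have k2 : Measurable fun ω : Config => 2 * ∑ i, (1 - coreInd r (ω.pos i)) :=
    (measurable_sum_pos fun n i => (measurable_coreInd_pos r i).const_sub 1).const_mul 2
  have k3 : Measurable fun ω : Config => 2 / (L * η) * ∑ g ∈ G, ∑ i, coreInd r (ω.pos i) *
      |localSum R ω.pos i g - L * ∫ y, g y| :=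
    (Finset.measurable_sum _ fun g hg => measurable_sum_pos fun n i =>
      (measurable_coreInd_pos r i).mul
        ((measurable_localSum R (hG g hg).measurable i).sub_const _).abs).const_mul _
  have k4 : Measurable fun ω : Config => δ / V * (ω.1 : ℝ) := measurable_card.const_mul _
  have hρr : 0 ≤ ρ - r := by rw [hr]; linarith
  have a1 := (meanLE_const (P := poissonLaw ρ densS) 1).add m1 measurable_const zero_le_one
    (by positivity)
  have a2 := a1.add m2 (k1.const_add 1) (by positivity) (by positivity)
  have a3 := a2.add m3 ((k1.const_add 1).add k2) (by positivity) (by positivity)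
  have a4 := a3.add m4 (((k1.const_add 1).add k2).add k3) (by positivity) (by positivity)
  have a5 := a4.add m5 ((((k1.const_add 1).add k2).add k3).add k4) (by positivity) (by positivity)
  have a6 := a5.const_mul (c := q * R) (by positivity)
  refine (a6.mono (fun _ => le_rfl) ?_ : MeanLE _ _ _).abs_integral_le
    (Eventually.of_forall fun ω => ?_) (by positivity)
  · have hρr' : ρ - r = R + RI + RD + RIps := by rw [hr]; ring
    rw [hρr', Finset.sum_const, nsmul_eq_mul]
    have hb := error_terms_le (V := V) (k := G.card) (K := K) (δ := δ) (M := M) (η := η)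
      (N := T.relayedNear ρ densS (M * R)) (e := quietErr densS q RD RI) (q := q)
      (S := R + RI + RD + RIps) (D := RD + RIps) hρ hdS hR hV hη (by positivity) hnear hqe hq0
      (by positivity) le_rfl
    calc q * R * _ ≤ q * R * _ := mul_le_mul_of_nonneg_left hb (by positivity)
      _ = _ := by ring
  · have hw := H T ω.1 ω.pos R L c r (s ω) hR hL0 hc0 hc1
      (fun i k => meanReach_nonneg _ hq1 _ _ _) (hs1 ω)
    rw [weightedProgress_const_mul]
    have e1 : q * weightedProgress T R ω.pos (s ω) - q * (c * (meanProgress * R)) * ω.1 =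
        q * (weightedProgress T R ω.pos (s ω) - ω.1 * (c * (meanProgress * R))) := by ring
    rw [e1, abs_mul, abs_of_nonneg hq0, mul_assoc]
    refine mul_le_mul_of_nonneg_left (hw.trans (le_of_eq ?_)) hq0
    congr 1
    rw [Finset.sum_add_distrib, Finset.sum_add_distrib, Finset.sum_add_distrib,
      Finset.sum_add_distrib, ← Finset.mul_sum, ← Finset.mul_sum, ← Finset.mul_sum,
      ← Finset.mul_sum, Finset.sum_comm]
    simp only [Finset.sum_const, Finset.card_univ, Fintype.card_fin, nsmul_eq_mul, hL, hcdef, hs,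
      hr]
    ring

theorem Traffic.relayedNear_nonneg (T : Traffic) (ρ dens r : ℝ) : 0 ≤ T.relayedNear ρ dens r := by
  classical
  unfold Traffic.relayedNear
  refine integral_nonneg fun ω => Finset.sum_nonneg fun i _ => Finset.sum_nonneg fun j _ => ?_
  exact mul_nonneg (by linarith [(T.own_mem ω.1 ω.pos i).2]) (T.relayed_nonneg _ _ _ _)

/-- The quantity q densS R², which bounds the mean number of attempts in range up to a constant,
stays at most B. All three parts of the error then vanish as q → 0 and RD / R → 0. -/
theorem quietErr_le {densS q RD RI R k B : ℝ} (hdS : 0 ≤ densS) (hq0 : 0 ≤ q) (hRD : 0 ≤ RD)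
    (hRI : 0 ≤ RI) (hR : 0 < R) (hk : RI ≤ k * R) (hB : q * (densS * R ^ 2) ≤ B) :
    quietErr densS q RD RI ≤ q * (Real.pi * k ^ 2 * B) + Real.sqrt (q * (Real.pi * k ^ 2 * B)) +
      2 * Real.pi * k * B * (RD / R) := by
  have hpi := Real.pi_pos
  have hk0 : 0 ≤ k := by
    by_contra h
    nlinarith
  have hB0 : 0 ≤ B := le_trans (by positivity) hB
  have h1 : q ^ 2 * (densS * (Real.pi * RI ^ 2)) ≤ q * (Real.pi * k ^ 2 * B) := by
    calc q ^ 2 * (densS * (Real.pi * RI ^ 2)) ≤ q ^ 2 * (densS * (Real.pi * (k * R) ^ 2)) := by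
          gcongr
      _ = q * (Real.pi * k ^ 2 * (q * (densS * R ^ 2))) := by ring
      _ ≤ _ := by gcongr
  have h2 : q * Real.sqrt (densS * (Real.pi * RI ^ 2)) ≤ Real.sqrt (q * (Real.pi * k ^ 2 * B)) := by
    refine Real.le_sqrt_of_sq_le ?_
    rw [mul_pow, Real.sq_sqrt (by positivity)]
    exact h1
  have h3 : q * (densS * Real.sqrt (Real.pi * RI ^ 2 * (Real.pi * (2 * RD) ^ 2))) ≤
      2 * Real.pi * k * B * (RD / R) := by
    have e : Real.pi * RI ^ 2 * (Real.pi * (2 * RD) ^ 2) = (Real.pi * RI * (2 * RD)) ^ 2 := by ring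
    rw [e, Real.sqrt_sq (by positivity)]
    calc q * (densS * (Real.pi * RI * (2 * RD))) ≤ q * (densS * (Real.pi * (k * R) * (2 * RD))) := by
          gcongr
      _ = 2 * Real.pi * k * (q * (densS * R ^ 2)) * (RD / R) := by field_simp
      _ ≤ _ := by gcongr
  exact add_le_add (add_le_add h1 h2) h3

/-- The throughput is asymptotic to its typical value. -/
theorem eventually_abs_secondaryThroughput_sub_le {ρ k B : ℝ} (hρ : 0 < ρ)
    {densP densS qp q RD RI RIps R : ℝ → ℝ} {T : ℝ → Traffic}
    (hdP : ∀ᶠ t in atTop, 0 ≤ densP t) (hdS : Tendsto densS atTop atTop)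
    (hqp : ∀ᶠ t in atTop, 0 ≤ qp t ∧ qp t ≤ 1) (hq : ∀ᶠ t in atTop, 0 ≤ q t ∧ q t ≤ 1)
    (hq' : Tendsto q atTop (𝓝 0)) (hR : ∀ᶠ t in atTop, 0 < R t) (hR' : Tendsto R atTop (𝓝 0))
    (hL : Tendsto (fun t => densS t * R t ^ 2) atTop atTop)
    (hB : ∀ᶠ t in atTop, q t * (densS t * R t ^ 2) ≤ B)
    (hRI : ∀ᶠ t in atTop, 0 ≤ RI t ∧ RI t ≤ k * R t)
    (hRD : ∀ᶠ t in atTop, 0 ≤ RD t) (hRD' : Tendsto (fun t => RD t / R t) atTop (𝓝 0))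
    (hRIps : ∀ᶠ t in atTop, 0 ≤ RIps t) (hRIps' : Tendsto (fun t => RIps t / R t) atTop (𝓝 0))
    (hT : MultiHop ρ T densS R) {ε : ℝ} (hε : 0 < ε) :
    ∀ᶠ t in atTop, |secondaryThroughput ρ (densP t) (densS t) (T t) (R t) (RI t) (RIps t) (RD t)
        (qp t) (q t) - q t * (typicalReach (densP t) (densS t) (qp t) (q t) (RD t) (RI t) (RIps t) *
          (meanProgress * R t)) * (densS t * volume.real (region ρ))| ≤
        ε * (R t * q t * densS t) := by
  obtain ⟨K, M, hK, hM, H⟩ := exists_abs_secondaryThroughput_sub_le hρ (half_pos hε)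
  have l0 : Tendsto (fun t => 1 / densS t) atTop (𝓝 0) := hdS.const_div_atTop 1
  have l1 : Tendsto (fun t => R t ^ 2) atTop (𝓝 0) := by simpa using hR'.pow 2
  have l2 := hT M hM
  -- The ranges RD and RIps are known only relative to R, so the boundary width is expressed through
  -- these ratios.
  have l3 : Tendsto (fun t => R t + k * R t + RD t / R t * R t + RIps t / R t * R t) atTop (𝓝 0) := by
    simpa using ((hR'.add (hR'.const_mul k)).add (hRD'.mul hR')).add (hRIps'.mul hR')
  have l4 : Tendsto (fun t => 1 / Real.sqrt (densS t * R t ^ 2)) atTop (𝓝 0) :=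
    (Real.tendsto_sqrt_atTop.comp hL).const_div_atTop 1
  have l5 : Tendsto (fun t => (RD t / R t + RIps t / R t) ^ 2) atTop (𝓝 0) := by
    simpa using (hRD'.add hRIps').pow 2
  have l6a : Tendsto (fun t => q t * (Real.pi * k ^ 2 * B)) atTop (𝓝 0) := by
    simpa using hq'.mul_const (Real.pi * k ^ 2 * B)
  have l6b : Tendsto (fun t => Real.sqrt (q t * (Real.pi * k ^ 2 * B))) atTop (𝓝 0) := by
    simpa using l6a.sqrt
  have l6c : Tendsto (fun t => 2 * Real.pi * k * B * (RD t / R t)) atTop (𝓝 0) := by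
    simpa using hRD'.const_mul (2 * Real.pi * k * B)
  have l := (((((((l0.add l1).add l2).add l3).add l4).add l5).add hq').add
    ((l6a.add l6b).add l6c)).const_mul K
  simp only [add_zero, mul_zero] at l
  filter_upwards [hdP, hdS.eventually_gt_atTop 0, hqp, hq, hR, hB, hRI, hRD, hRIps,
    l.eventually_le_const (half_pos hε), l3.eventually_le_const hρ] with
    t hdP hdS hqp hq hR hB hRI hRD hRIps hl hlρ
  have e1 : RD t / R t * R t = RD t := div_mul_cancel₀ _ hR.ne'
  have e2 : RIps t / R t * R t = RIps t := div_mul_cancel₀ _ hR.ne'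
  rw [e1, e2] at hl hlρ
  have h := H (densP t) (densS t) (qp t) (q t) (RD t) (RI t) (RIps t) (R t) (T t) hdP hdS hqp.1 hqp.2
    hq.1 hq.2 hRD hRI.1 hRIps hR (by linarith [hRI.2]) ((T t).relayedNear_nonneg _ _ _)
  refine h.trans ?_
  rw [mul_comm ε]
  refine mul_le_mul_of_nonneg_left ?_ (mul_nonneg (mul_nonneg hR.le hq.1) hdS.le)
  have hqe := quietErr_le hdS.le hq.1 hRD hRI.1 hR hRI.2 hB
  rw [add_div]
  have : K * (1 / densS t + R t ^ 2 + (T t).relayedNear ρ (densS t) (M * R t) / densS t +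
      (R t + RI t + RD t + RIps t) + 1 / Real.sqrt (densS t * R t ^ 2) +
      (RD t / R t + RIps t / R t) ^ 2 + q t + quietErr (densS t) (q t) (RD t) (RI t)) ≤ ε / 2 := by
    refine le_trans (mul_le_mul_of_nonneg_left ?_ hK.le) hl
    linarith [hRI.2]
  linarith

/-! ### The network alone in the region -/

/-- With primary access probability 0 almost surely no primary node transmits, whatever the primary
density. The single network thus falls under the same estimates. -/
theorem singleThroughput_eq {ρ densP densS R RI q : ℝ} (hρ : 0 < ρ) (hdP : 0 ≤ densP)
    (hdS : 0 ≤ densS) (T : Traffic) :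
    singleThroughput ρ densS T R RI q = secondaryThroughput ρ densP densS T R RI 0 0 0 q := by
  have hPp := isProbabilityMeasure_poissonLaw hρ hdP
  have hPs := isProbabilityMeasure_poissonLaw hρ hdS
  have hv := poissonLaw_void hρ hdP le_rfl zero_le_one MeasurableSet.univ
  have h0 : ∀ᵐ ωp ∂(poissonLaw ρ densP), ∀ k, ¬ Config.attempts ωp 0 k := by
    have hm : Measurable fun ωp : Config => ∀ k, ¬ ωp.attempts 0 k := by
      refine measurable_of_sigma fun n => ?_
      have h : ∀ k : Fin n, Measurable fun x : Fin n → Plane × ℝ => ¬ (x k).2 < 0 := fun k =>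
        (measurableSet_setOfPred.1 (measurableSet_lt (by fun_prop) measurable_const)).not
      exact Measurable.forall h
    refine (mem_ae_iff_prob_eq_one (measurableSet_setOfPred.2 hm)).2 ?_
    simpa using hv
  have h1 : ∀ᵐ ω ∂((poissonLaw ρ densP).prod (poissonLaw ρ densS)),
      totalProgress T R ω.2.pos (secondarySuccess ω.1 ω.2 0 q 0 RI 0) =
        totalProgress T R ω.2.pos (tierSuccess ω.2.pos (ω.2.attempts q) RI) := by
    filter_upwards [Measure.quasiMeasurePreserving_fst.ae h0] with ω hω
    have hf : ∀ r y, primaryFree ω.1 0 r y := fun r y k hk => absurd hk (hω k)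
    congr 1
    ext i k
    simp [secondarySuccess, tierSuccess, secondaryTransmits, hf]
  unfold singleThroughput secondaryThroughput
  rw [integral_congr_ae h1, integral_fun_snd (fun ω : Config =>
    totalProgress T R ω.pos (tierSuccess ω.pos (ω.attempts q) RI))]
  simp

/-! ### A large detection range -/

/-- The centre moves from y towards the origin by the fraction `min r ρ / (2 * ρ)`. The minimum
covers both nodes at the boundary and detection ranges exceeding the region. -/
theorem exists_closedBall_subset {ρ r : ℝ} (hρ : 0 < ρ) (hr : 0 ≤ r) {y : Plane}
    (hy : y ∈ region ρ) :
    ∃ z, Metric.closedBall z (min r ρ / 2) ⊆ region ρ ∩ Metric.closedBall y r := by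
  have hy' : ‖y‖ ≤ ρ := by simpa [region] using hy
  have hs0 : 0 ≤ min r ρ := le_min hr hρ.le
  have hs1 : min r ρ ≤ ρ := min_le_right _ _
  set a := min r ρ / (2 * ρ) with ha
  have ha0 : 0 ≤ a := by positivity
  have ha1 : a ≤ 1 := by rw [ha, div_le_one (by positivity)]; linarith
  have haρ : a * ρ = min r ρ / 2 := by rw [ha]; field_simp
  refine ⟨(1 - a) • y, Set.subset_inter (closedBall_subset_region ?_)
    (Metric.closedBall_subset_closedBall' ?_)⟩
  · rw [norm_smul, Real.norm_of_nonneg (by linarith)]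
    nlinarith
  · have e : (1 - a) • y - y = (-a) • y := by module
    rw [dist_eq_norm, e, norm_smul, norm_neg, Real.norm_of_nonneg ha0]
    have := min_le_left r ρ
    nlinarith

theorem integral_freeInd_le {ρ dens q r : ℝ} (hρ : 0 < ρ) (hd : 0 ≤ dens) (hq0 : 0 ≤ q)
    (hq1 : q ≤ 1) (hr : 0 ≤ r) {y : Plane} (hy : y ∈ region ρ) :
    ∫ ωp, freeInd ωp q r y ∂(poissonLaw ρ dens) ≤
      Real.exp (-(dens * q * (Real.pi * (min r ρ / 2) ^ 2))) := by
  rw [integral_eq_lintegral_of_nonneg_ae (Eventually.of_forall fun _ => freeInd_nonneg _ _ _ _)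
    (measurable_freeInd_left q r y).aestronglyMeasurable, lintegral_freeInd hρ hd hq0 hq1,
    ENNReal.toReal_ofReal (Real.exp_pos _).le]
  obtain ⟨z, hz⟩ := exists_closedBall_subset hρ hr hy
  have h : Real.pi * (min r ρ / 2) ^ 2 ≤ volume.real (region ρ ∩ Metric.closedBall y r) := by
    have hm := measureReal_mono (μ := volume) hz
      (measure_ne_top_of_subset Set.inter_subset_left (volume_region_ne_top ρ))
    rwa [volume_real_closedBall _ (div_nonneg (le_min hr hρ.le) zero_le_two)] at hm
  refine Real.exp_le_exp.2 (neg_le_neg (mul_le_mul_of_nonneg_left h (mul_nonneg hd hq0)))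

/-! ### The transmission ranges -/

theorem txRange_sq (K : ℝ) {d : ℝ} (hd : 1 ≤ d) : txRange K d ^ 2 = K ^ 2 * (Real.log d / d) := by
  rw [txRange, mul_pow, Real.sq_sqrt (div_nonneg (Real.log_nonneg hd) (by linarith))]

theorem mul_txRange_sq (K : ℝ) {d : ℝ} (hd : 1 ≤ d) :
    d * txRange K d ^ 2 = K ^ 2 * Real.log d := by
  rw [txRange_sq K hd]; field_simp

theorem txRange_pos {K d : ℝ} (hK : 0 < K) (hd : 1 < d) : 0 < txRange K d :=
  mul_pos hK (Real.sqrt_pos.2 (div_pos (Real.log_pos hd) (by linarith)))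

theorem intRange_sq {l : ℝ} (hl : 0 ≤ l) (K d : ℝ) :
    intRange l K d ^ 2 = (1 + l) * txRange K d ^ 2 := by
  rw [intRange, mul_pow, Real.sq_sqrt (by linarith)]

theorem scaling_pos {d : ℝ} (hd : 1 < d) : 0 < scaling d :=
  Real.sqrt_pos.2 (div_pos (by linarith) (Real.log_pos hd))

/-- This converts errors measured in R q λ into the scaling: R q λ = K (q log λ) f, with q log λ
bounded. -/
theorem txRange_mul (K : ℝ) {d : ℝ} (hd : 1 < d) :
    txRange K d * d = K * Real.log d * scaling d := by
  have hl := Real.log_pos hd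
  have hd0 : 0 < d := by linarith
  have h1 := Real.mul_self_sqrt hl.le
  have h2 := Real.mul_self_sqrt hd0.le
  have h3 := Real.sqrt_pos.2 hl
  have h4 := Real.sqrt_pos.2 hd0
  rw [txRange, scaling, Real.sqrt_div hl.le, Real.sqrt_div hd0.le]
  field_simp
  linear_combination K * d * h1 - K * Real.log d * h2

theorem tendsto_txRange (K : ℝ) : Tendsto (txRange K) atTop (𝓝 0) := by
  have h : Tendsto (fun d : ℝ => Real.log d / d) atTop (𝓝 0) :=
    Real.isLittleO_log_id_atTop.tendsto_div_nhds_zero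
  have h2 := h.sqrt.const_mul K
  rw [Real.sqrt_zero, mul_zero] at h2
  exact h2

/-- Since log(t ^ β) = β log t, the logarithms cancel. The remaining power t ^ (β - 1) is where β <
1 separates the scales of the two networks. -/
theorem txRange_div {Kp Ks β t : ℝ} (hβ : 0 < β) (ht : 1 < t) :
    txRange Kp t / txRange Ks (t ^ β) = Kp / Ks * Real.sqrt (t ^ (β - 1) / β) := by
  have ht0 : 0 < t := by linarith
  have hl := Real.log_pos ht
  rw [txRange, txRange, mul_div_mul_comm, ← Real.sqrt_div (div_nonneg hl.le ht0.le),
    Real.log_rpow ht0, Real.rpow_sub ht0, Real.rpow_one]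
  congr 2
  have := Real.rpow_pos_of_pos ht0 β
  field_simp

theorem tendsto_txRange_div (Kp Ks : ℝ) {β : ℝ} (hβ0 : 0 < β) (hβ1 : β < 1) :
    Tendsto (fun t => txRange Kp t / txRange Ks (t ^ β)) atTop (𝓝 0) := by
  have h1 : Tendsto (fun t : ℝ => t ^ (β - 1)) atTop (𝓝 0) := by
    have := tendsto_rpow_neg_atTop (sub_pos.2 hβ1)
    simpa using this
  have h2 := (h1.div_const β).sqrt.const_mul (Kp / Ks)
  simp only [zero_div, Real.sqrt_zero, mul_zero] at h2
  refine h2.congr' ?_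
  filter_upwards [eventually_gt_atTop 1] with t ht
  exact (txRange_div hβ0 ht).symm

theorem tendsto_div_of_isBigO {g RP RS : ℝ → ℝ} (h : g =O[atTop] RP)
    (hR : Tendsto (fun t => RP t / RS t) atTop (𝓝 0)) :
    Tendsto (fun t => g t / RS t) atTop (𝓝 0) :=
  ((h.mul (isBigO_refl (fun t => (RS t)⁻¹) atTop)).trans_tendsto (by simpa [div_eq_mul_inv] using hR)).congr
    fun t => by rw [div_eq_mul_inv]

/-- The mean number of nodes in a secondary interference disk is proportional to log `dS`, so the
access probability enters only through `q * log dS`. -/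
theorem typicalReach_eq {densP dS qp q RD RIps ls Ks : ℝ} (hls : 0 ≤ ls) (hd : 1 ≤ dS) :
    typicalReach densP dS qp q RD (intRange ls Ks dS) RIps =
      Real.exp (-(densP * qp * Real.pi * (RD ^ 2 + RIps ^ 2)) - Real.pi * (1 + ls) * Ks ^ 2 *
        (q * Real.log dS) * Real.exp (-(densP * qp * Real.pi * RD ^ 2))) := by
  have h : dS * intRange ls Ks dS ^ 2 = (1 + ls) * (Ks ^ 2 * Real.log dS) := by
    rw [intRange_sq hls, ← mul_txRange_sq Ks hd]; ring
  rw [typicalReach, quietProb, ← Real.exp_add]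
  congr 1
  linear_combination -(q * Real.pi * Real.exp (-(densP * qp * Real.pi * RD ^ 2))) * h

/-- The limit of the normalized throughput in terms of the access probabilities. -/
theorem tendsto_secondaryThroughput_div {ρ β Kp Ks lp ls : ℝ} (hρ : 0 < ρ) (hβ0 : 0 < β)
    (hβ1 : β < 1) (hKs : 0 < Ks) {RIps RD qp q : ℝ → ℝ} {T : ℝ → Traffic}
    (hRIps : ∀ᶠ t in atTop, 0 ≤ RIps t ∧ RIps t ≤ intRange lp Kp t)
    (hRD : ∀ᶠ t in atTop, 0 ≤ RD t) (hRD' : RD =O[atTop] fun t => txRange Kp t)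
    (hT : MultiHop ρ T (fun t => t ^ β) fun t => txRange Ks (t ^ β))
    (hqp : ∀ᶠ t in atTop, 0 ≤ qp t ∧ qp t ≤ 1) (hq : ∀ᶠ t in atTop, 0 ≤ q t ∧ q t ≤ 1)
    (hq' : q =O[atTop] fun t => 1 / Real.log (t ^ β)) :
    Tendsto (fun t => secondaryThroughput ρ t (t ^ β) (T t) (txRange Ks (t ^ β))
        (intRange ls Ks (t ^ β)) (RIps t) (RD t) (qp t) (q t) / scaling (t ^ β) -
      meanProgress * volume.real (region ρ) * Ks * (q t * Real.log (t ^ β)) *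
        typicalReach t (t ^ β) (qp t) (q t) (RD t) (intRange ls Ks (t ^ β)) (RIps t))
      atTop (𝓝 0) := by
  have hd : Tendsto (fun t : ℝ => t ^ β) atTop atTop := tendsto_rpow_atTop hβ0
  have hd1 := hd.eventually_gt_atTop 1
  have hlog : Tendsto (fun t : ℝ => Real.log (t ^ β)) atTop atTop := Real.tendsto_log_atTop.comp hd
  have hdiv := tendsto_txRange_div Kp Ks hβ0 hβ1
  have hRIpsO : RIps =O[atTop] fun t => txRange Kp t := by
    refine IsBigO.of_bound (Real.sqrt (1 + lp)) ?_
    filter_upwards [hRIps] with t ht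
    rw [Real.norm_of_nonneg ht.1]
    exact ht.2.trans (mul_le_mul_of_nonneg_left (le_abs_self _) (Real.sqrt_nonneg _))
  obtain ⟨W, hW, hbd⟩ := hq'.exists_pos
  have hw : ∀ᶠ t in atTop, q t * Real.log (t ^ β) ≤ W := by
    filter_upwards [hbd.bound, hlog.eventually_gt_atTop 0] with t ht hl
    rw [Real.norm_of_nonneg (one_div_pos.2 hl).le, mul_one_div] at ht
    exact (le_div_iff₀ hl).1 ((le_abs_self _).trans ht)
  have hq0 : Tendsto q atTop (𝓝 0) := hq'.trans_tendsto (hlog.const_div_atTop 1)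
  rw [Metric.tendsto_nhds]
  intro ε hε
  -- The error is a small multiple of R q λ ≤ Ks W f; the multiple ε / (2 Ks W) leaves ε / 2 after
  -- division by f.
  have hmain := eventually_abs_secondaryThroughput_sub_le (densP := fun t => t)
    (densS := fun t => t ^ β) (R := fun t => txRange Ks (t ^ β))
    (RI := fun t => intRange ls Ks (t ^ β)) (k := Real.sqrt (1 + ls)) (B := Ks ^ 2 * W) hρ
    (eventually_ge_atTop 0) hd hqp hq hq0
    (hd1.mono fun t ht => txRange_pos hKs ht) ((tendsto_txRange Ks).comp hd)
    ((hlog.const_mul_atTop (by positivity : 0 < Ks ^ 2)).congr' (hd1.mono fun t ht =>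
      (mul_txRange_sq Ks ht.le).symm))
    (by
      filter_upwards [hw, hd1] with t ht h1
      rw [mul_txRange_sq Ks h1.le, mul_left_comm]
      exact mul_le_mul_of_nonneg_left ht (sq_nonneg _))
    (hd1.mono fun t ht => ⟨mul_nonneg (Real.sqrt_nonneg _) (txRange_pos hKs ht).le, le_rfl⟩)
    hRD (tendsto_div_of_isBigO hRD' hdiv) (hRIps.mono fun t ht => ht.1)
    (tendsto_div_of_isBigO hRIpsO hdiv) hT (ε := ε / (2 * (Ks * W))) (by positivity)
  filter_upwards [hmain, hd1, hw, hq] with t ht h1 hwt hqt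
  have hs := scaling_pos h1
  have hRf := txRange_mul Ks h1
  set C := secondaryThroughput ρ t (t ^ β) (T t) (txRange Ks (t ^ β))
        (intRange ls Ks (t ^ β)) (RIps t) (RD t) (qp t) (q t)
  set c := typicalReach t (t ^ β) (qp t) (q t) (RD t) (intRange ls Ks (t ^ β)) (RIps t)
  have e1 : q t * (c * (meanProgress * txRange Ks (t ^ β))) * (t ^ β * volume.real (region ρ)) =
      (meanProgress * volume.real (region ρ) * Ks * (q t * Real.log (t ^ β)) * c) *
        scaling (t ^ β) := by
    linear_combination q t * c * meanProgress * volume.real (region ρ) * hRf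
  have e2 : txRange Ks (t ^ β) * q t * t ^ β = Ks * (q t * Real.log (t ^ β)) * scaling (t ^ β) := by
    linear_combination q t * hRf
  rw [e1, e2] at ht
  rw [Real.dist_eq, sub_zero]
  have e3 : ∀ X : ℝ, C / scaling (t ^ β) - X = (C - X * scaling (t ^ β)) / scaling (t ^ β) := by
    intro X; field_simp
  rw [e3, abs_div, abs_of_pos hs, div_lt_iff₀ hs]
  refine ht.trans_lt ?_
  have h5 : ε / (2 * (Ks * W)) * (Ks * (q t * Real.log (t ^ β)) * scaling (t ^ β)) ≤
      ε / (2 * (Ks * W)) * (Ks * W * scaling (t ^ β)) := by gcongr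
  have h6 : ε / (2 * (Ks * W)) * (Ks * W * scaling (t ^ β)) = ε / 2 * scaling (t ^ β) := by
    field_simp
  have h7 : ε / 2 * scaling (t ^ β) < ε * scaling (t ^ β) :=
    mul_lt_mul_of_pos_right (half_lt_self hε) hs
  linarith

/-! ### Large and moderate detection ranges -/

section Parts

variable {ρ β Kp Ks lp ls : ℝ} {RIps RD qp q : ℝ → ℝ} {T : ℝ → Traffic}

theorem tendsto_rpow_log (hβ0 : 0 < β) : Tendsto (fun t : ℝ => Real.log (t ^ β)) atTop atTop :=
  Real.tendsto_log_atTop.comp (tendsto_rpow_atTop hβ0)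

theorem exists_mul_log_le {p l : ℝ → ℝ} (hl : Tendsto l atTop atTop)
    (h : p =O[atTop] fun t => 1 / l t) : ∃ W, 0 < W ∧ ∀ᶠ t in atTop, p t * l t ≤ W := by
  obtain ⟨W, hW, hbd⟩ := h.exists_pos
  refine ⟨W, hW, ?_⟩
  filter_upwards [hbd.bound, hl.eventually_gt_atTop 0] with t ht hl
  rw [Real.norm_of_nonneg (one_div_pos.2 hl).le, mul_one_div] at ht
  exact (le_div_iff₀ hl).1 ((le_abs_self _).trans ht)

theorem exists_le_mul_log {p l : ℝ → ℝ} (hl : Tendsto l atTop atTop)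
    (hp : ∀ᶠ t in atTop, 0 ≤ p t) (h : (fun t => 1 / l t) =O[atTop] p) :
    ∃ w, 0 < w ∧ ∀ᶠ t in atTop, w ≤ p t * l t := by
  obtain ⟨W, hW, hbd⟩ := h.exists_pos
  refine ⟨W⁻¹, inv_pos.2 hW, ?_⟩
  filter_upwards [hbd.bound, hl.eventually_gt_atTop 0, hp] with t ht hl hp
  rw [Real.norm_of_nonneg (one_div_pos.2 hl).le, Real.norm_of_nonneg hp, div_le_iff₀ hl] at ht
  rw [inv_le_iff_one_le_mul₀ hW]
  linarith

/-- The mean number of primary transmitters in a detection disk tends to infinity if the detection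
range is large. -/
theorem tendsto_detection (hρ : 0 < ρ) (hKp : 0 < Kp)
    (hRD' : (fun t => txRange Kp t) =o[atTop] RD) (hRD : ∀ᶠ t in atTop, 0 ≤ RD t)
    (hqp : ∀ᶠ t in atTop, 0 ≤ qp t ∧ qp t ≤ 1)
    (hqp' : (fun t => 1 / Real.log t) =O[atTop] qp) :
    Tendsto (fun t => t * qp t * (Real.pi * (min (RD t) ρ / 2) ^ 2)) atTop atTop := by
  have hpi := Real.pi_pos
  obtain ⟨w, hw, hwt⟩ := exists_le_mul_log Real.tendsto_log_atTop (hqp.mono fun t h => h.1) hqp'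
  refine tendsto_atTop.2 fun A => ?_
  -- Eventually min(RD, ρ) ≥ N `txRange Kp t`, since RD is of larger order and the transmission
  -- range tends to 0. The expression is then at least (π / 4) Kp² N² (qp log t), where qp log t ≥
  -- w.
  obtain ⟨N, hN, hNA⟩ : ∃ N : ℝ, 0 < N ∧ A ≤ Real.pi / 4 * (w * Kp ^ 2) * N ^ 2 := by
    have hc : 0 < Real.pi / 4 * (w * Kp ^ 2) := by positivity
    have h : Tendsto (fun N : ℝ => Real.pi / 4 * (w * Kp ^ 2) * N ^ 2) atTop atTop :=
      (tendsto_pow_atTop two_ne_zero).const_mul_atTop hc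
    obtain ⟨N, h1, h2⟩ := ((h.eventually_ge_atTop A).and (eventually_gt_atTop 0)).exists
    exact ⟨N, h2, h1⟩
  filter_upwards [hRD'.bound (inv_pos.2 hN), hRD, hwt, eventually_gt_atTop 1, hqp,
    (tendsto_txRange Kp).eventually_le_const (div_pos hρ hN)] with t h1 h2 h3 h4 h5 h6
  have hR := txRange_pos hKp h4
  rw [Real.norm_of_nonneg hR.le, Real.norm_of_nonneg h2, inv_mul_eq_div, le_div_iff₀ hN] at h1
  rw [le_div_iff₀ hN] at h6
  have hmin : txRange Kp t * N ≤ min (RD t) ρ := le_min h1 h6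
  have hsq := mul_txRange_sq Kp h4.le
  calc A ≤ Real.pi / 4 * (w * Kp ^ 2) * N ^ 2 := hNA
    _ ≤ Real.pi / 4 * (qp t * Real.log t * Kp ^ 2) * N ^ 2 := by gcongr
    _ = t * qp t * (Real.pi * (txRange Kp t * N / 2) ^ 2) := by
        linear_combination -(Real.pi / 4 * qp t * N ^ 2) * hsq
    _ ≤ _ := by
        have : 0 ≤ txRange Kp t * N := by positivity
        have : 0 ≤ t * qp t := mul_nonneg (by linarith) h5.1
        gcongr

/-- A detection range of larger order than the primary transmission range ruins the secondary
throughput. -/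
theorem isLittleO_secondaryThroughput {RIS : ℝ → ℝ} (hρ : 0 < ρ) (hβ0 : 0 < β) (hKp : 0 < Kp)
    (hKs : 0 < Ks) (hRD' : (fun t => txRange Kp t) =o[atTop] RD) (hRD : ∀ᶠ t in atTop, 0 ≤ RD t)
    (hqp : ∀ᶠ t in atTop, 0 ≤ qp t ∧ qp t ≤ 1) (hq : ∀ᶠ t in atTop, 0 ≤ q t ∧ q t ≤ 1)
    (hqp' : (fun t => 1 / Real.log t) =O[atTop] qp)
    (hq' : q =O[atTop] fun t => 1 / Real.log (t ^ β)) :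
    (fun t => secondaryThroughput ρ t (t ^ β) (T t) (txRange Ks (t ^ β)) (RIS t) (RIps t) (RD t)
      (qp t) (q t)) =o[atTop] fun t => scaling (t ^ β) := by
  obtain ⟨W, hW, hWt⟩ := exists_mul_log_le (tendsto_rpow_log hβ0) hq'
  have hV := volume_real_region_pos hρ
  have hdet := tendsto_detection hρ hKp hRD' hRD hqp hqp'
  have hv := (Real.tendsto_exp_neg_atTop_nhds_zero.comp hdet).const_mul
    (Ks * W * volume.real (region ρ))
  rw [mul_zero] at hv
  refine IsLittleO.of_bound fun ε hε => ?_
  filter_upwards [hv.eventually_le_const hε, hWt, hRD, hqp, hq, eventually_ge_atTop 0,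
    (tendsto_rpow_atTop hβ0).eventually_gt_atTop 1] with t h1 h2 h3 h4 h5 h6 h7
  have hs := scaling_pos h7
  -- Only the sensing condition at the transmitter is kept. The bound on its probability is uniform
  -- over the region, including the boundary.
  have hb := abs_secondaryThroughput_le (RI := RIS t) (RIps := RIps t) hρ h6
    (by linarith : (0 : ℝ) ≤ t ^ β) h5.1 h5.2 (txRange_pos hKs h7).le (T t) (Real.exp_pos _).le
    fun y hy => integral_freeInd_le hρ h6 h4.1 h4.2 h3 hy
  rw [Real.norm_eq_abs, Real.norm_of_nonneg hs.le]
  set v := Real.exp (-(t * qp t * (Real.pi * (min (RD t) ρ / 2) ^ 2))) with hvdef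
  have hv0 : 0 < v := Real.exp_pos _
  change _ * v ≤ ε at h1
  calc _ ≤ _ := hb
    _ = Ks * (q t * Real.log (t ^ β)) * volume.real (region ρ) * v * scaling (t ^ β) := by
        linear_combination q t * v * volume.real (region ρ) * txRange_mul Ks h7
    _ ≤ Ks * W * volume.real (region ρ) * v * scaling (t ^ β) := by gcongr
    _ ≤ ε * scaling (t ^ β) := by gcongr

/-- A detection range of the order of the primary transmission range preserves the order of the
throughput. -/
theorem isTheta_secondaryThroughput (hρ : 0 < ρ) (hβ0 : 0 < β) (hβ1 : β < 1) (hKp : 0 < Kp)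
    (hKs : 0 < Ks) (hlp : 0 ≤ lp) (hls : 0 ≤ ls)
    (hRIps : ∀ᶠ t in atTop, 0 ≤ RIps t ∧ RIps t ≤ intRange lp Kp t)
    (hRD : ∀ᶠ t in atTop, 0 ≤ RD t) (hRD' : RD =O[atTop] fun t => txRange Kp t)
    (hT : MultiHop ρ T (fun t => t ^ β) fun t => txRange Ks (t ^ β))
    (hqp : ∀ᶠ t in atTop, 0 ≤ qp t ∧ qp t ≤ 1) (hq : ∀ᶠ t in atTop, 0 ≤ q t ∧ q t ≤ 1)
    (hqp' : qp =O[atTop] fun t => 1 / Real.log t)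
    (hq' : q =Θ[atTop] fun t => 1 / Real.log (t ^ β)) {C : ℝ → ℝ}
    (hC : C = fun t => secondaryThroughput ρ t (t ^ β) (T t) (txRange Ks (t ^ β))
      (intRange ls Ks (t ^ β)) (RIps t) (RD t) (qp t) (q t)) :
    C =Θ[atTop] (fun t => scaling (t ^ β)) ∧ ∀ᶠ t in atTop, 0 < C t := by
  have hpi := Real.pi_pos
  have hV := volume_real_region_pos hρ
  have hκ := meanProgress_pos
  have hlim := tendsto_secondaryThroughput_div (ls := ls) hρ hβ0 hβ1 hKs hRIps hRD hRD' hT hqp hq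
    hq'.1
  obtain ⟨W, hW, hWt⟩ := exists_mul_log_le (tendsto_rpow_log hβ0) hq'.1
  obtain ⟨w, hw, hwt⟩ := exists_le_mul_log (tendsto_rpow_log hβ0) (hq.mono fun t h => h.1) hq'.2
  obtain ⟨A, hA, hAt⟩ := exists_mul_log_le Real.tendsto_log_atTop hqp'
  obtain ⟨k, hk, hkt⟩ := hRD'.exists_pos
  set b := meanProgress * volume.real (region ρ) * Ks with hb
  have hb0 : 0 < b := by positivity
  -- X majorizes the exponent of `typicalReach`: the first part uses qp log t ≤ A and RD² + RIps² ≤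
  -- (k² + 1 + lp) `txRange Kp t`², the second qs log(t ^ β) ≤ W and exp ≤ 1.
  set X := Real.pi * (A * Kp ^ 2 * (k ^ 2 + (1 + lp))) + Real.pi * (1 + ls) * Ks ^ 2 * W with hX
  have hd := tendsto_rpow_atTop hβ0
  have key : ∀ᶠ t in atTop, b * w * Real.exp (-X) ≤ b * (q t * Real.log (t ^ β)) *
      typicalReach t (t ^ β) (qp t) (q t) (RD t) (intRange ls Ks (t ^ β)) (RIps t) ∧
      b * (q t * Real.log (t ^ β)) *
        typicalReach t (t ^ β) (qp t) (q t) (RD t) (intRange ls Ks (t ^ β)) (RIps t) ≤ b * W := by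
    filter_upwards [hWt, hwt, hAt, hkt.bound, hRIps, hRD, hqp, hq, hd.eventually_gt_atTop 1,
      eventually_gt_atTop 1] with t h1 h2 h3 h4 h5 h6 h7 h8 h9 h10
    rw [typicalReach_eq hls h9.le]
    have hR := txRange_pos hKp h10
    rw [Real.norm_of_nonneg h6, Real.norm_of_nonneg hR.le] at h4
    have hl := Real.log_pos h9
    have ht0 : 0 ≤ t * qp t := mul_nonneg (by linarith) h7.1
    have e1 : RD t ^ 2 + RIps t ^ 2 ≤ (k ^ 2 + (1 + lp)) * txRange Kp t ^ 2 := by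
      have a1 : RD t ^ 2 ≤ (k * txRange Kp t) ^ 2 := by gcongr
      have a2 : RIps t ^ 2 ≤ intRange lp Kp t ^ 2 := by
        have := h5.1
        gcongr
        exact h5.2
      rw [intRange_sq hlp] at a2
      nlinarith
    have e2 : t * qp t * Real.pi * (RD t ^ 2 + RIps t ^ 2) ≤
        Real.pi * (A * Kp ^ 2 * (k ^ 2 + (1 + lp))) := by
      calc _ ≤ t * qp t * Real.pi * ((k ^ 2 + (1 + lp)) * txRange Kp t ^ 2) := by gcongr
        _ = Real.pi * (qp t * Real.log t * Kp ^ 2 * (k ^ 2 + (1 + lp))) := by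
          linear_combination qp t * Real.pi * (k ^ 2 + (1 + lp)) * mul_txRange_sq Kp h10.le
        _ ≤ _ := by gcongr
    have e3 : Real.exp (-(t * qp t * Real.pi * RD t ^ 2)) ≤ 1 :=
      Real.exp_le_one_iff.2 (neg_nonpos.2 (by positivity))
    have e4 : 0 ≤ Real.pi * (1 + ls) * Ks ^ 2 * (q t * Real.log (t ^ β)) := by
      have := h8.1
      positivity
    have e5 : Real.pi * (1 + ls) * Ks ^ 2 * (q t * Real.log (t ^ β)) *
        Real.exp (-(t * qp t * Real.pi * RD t ^ 2)) ≤ Real.pi * (1 + ls) * Ks ^ 2 * W :=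
      (mul_le_of_le_one_right e4 e3).trans (by gcongr)
    have e6 : 0 ≤ t * qp t * Real.pi * (RD t ^ 2 + RIps t ^ 2) := by positivity
    have e7 : 0 ≤ Real.pi * (1 + ls) * Ks ^ 2 * (q t * Real.log (t ^ β)) *
        Real.exp (-(t * qp t * Real.pi * RD t ^ 2)) := mul_nonneg e4 (Real.exp_pos _).le
    have e8 : 0 ≤ b * (q t * Real.log (t ^ β)) := mul_nonneg hb0.le (mul_nonneg h8.1 hl.le)
    constructor
    · gcongr
      rw [hX]; linarith
    · calc _ ≤ b * (q t * Real.log (t ^ β)) * 1 := by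
            exact mul_le_mul_of_nonneg_left (Real.exp_le_one_iff.2 (by linarith)) e8
        _ ≤ b * W := by rw [mul_one]; gcongr
  -- The typical normalized throughput is at least c₁; half of it is reserved for the o(1) error,
  -- which also yields positivity.
  set c₁ := b * w * Real.exp (-X) with hc₁
  have hc0 : 0 < c₁ := by positivity
  have hfin : ∀ᶠ t in atTop, 0 < scaling (t ^ β) ∧ c₁ / 2 * scaling (t ^ β) ≤ C t ∧
      C t ≤ (b * W + c₁ / 2) * scaling (t ^ β) := by
    filter_upwards [key, hd.eventually_gt_atTop 1, hlim.eventually_le_const (half_pos hc0),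
      hlim.eventually_const_le (neg_lt_zero.2 (half_pos hc0))] with t h1 h2 h3 h4
    have hs := scaling_pos h2
    rw [hC]
    refine ⟨hs, ?_, ?_⟩
    · rw [← le_div_iff₀ hs]; linarith [h1.1]
    · rw [← div_le_iff₀ hs]; linarith [h1.2]
  refine ⟨⟨IsBigO.of_bound (b * W + c₁ / 2) ?_, IsBigO.of_bound (c₁ / 2)⁻¹ ?_⟩, ?_⟩
  · filter_upwards [hfin] with t ht
    have : 0 < C t := lt_of_lt_of_le (mul_pos (half_pos hc0) ht.1) ht.2.1
    rw [Real.norm_of_nonneg this.le, Real.norm_of_nonneg ht.1.le]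
    exact ht.2.2
  · filter_upwards [hfin] with t ht
    have : 0 < C t := lt_of_lt_of_le (mul_pos (half_pos hc0) ht.1) ht.2.1
    rw [Real.norm_of_nonneg this.le, Real.norm_of_nonneg ht.1.le,
      le_inv_mul_iff₀ (half_pos hc0)]
    exact ht.2.1
  · exact hfin.mono fun t ht => lt_of_lt_of_le (mul_pos (half_pos hc0) ht.1) ht.2.1

end Parts

/-! ### Asymptotic multiplexing gain -/

section Gain

variable {ρ β Kp Ks lp ls : ℝ} {RIps RD qp q : ℝ → ℝ} {T : ℝ → Traffic}

theorem optAccess_intRange {l K d : ℝ} (hl : 0 ≤ l) (hd : 1 < d) :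
    optAccess d (intRange l K d) = 1 / (Real.pi * (1 + l) * K ^ 2) / Real.log d := by
  have h : d * Real.pi * intRange l K d ^ 2 = Real.pi * (1 + l) * K ^ 2 * Real.log d := by
    rw [intRange_sq hl]; linear_combination Real.pi * (1 + l) * mul_txRange_sq K hd.le
  rw [optAccess, h, div_div]

theorem tendsto_optAccess {l K : ℝ} (hl : 0 ≤ l) {d : ℝ → ℝ} (hd : Tendsto d atTop atTop) :
    Tendsto (fun t => optAccess (d t) (intRange l K (d t))) atTop (𝓝 0) := by
  refine ((Real.tendsto_log_atTop.comp hd).const_div_atTop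
    (1 / (Real.pi * (1 + l) * K ^ 2))).congr' ?_
  filter_upwards [hd.eventually_gt_atTop 1] with t ht
  exact (optAccess_intRange hl ht).symm

theorem isBigO_optAccess {l K : ℝ} (hl : 0 ≤ l) {d : ℝ → ℝ} (hd : Tendsto d atTop atTop) :
    (fun t => optAccess (d t) (intRange l K (d t))) =O[atTop] fun t => 1 / Real.log (d t) := by
  refine ((isBigO_refl (fun t => 1 / Real.log (d t)) atTop).const_mul_left
    (1 / (Real.pi * (1 + l) * K ^ 2))).congr' ?_ EventuallyEq.rfl
  filter_upwards [hd.eventually_gt_atTop 1] with t ht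
  rw [optAccess_intRange hl ht, mul_one_div]

/-- The asymptotic multiplexing gain of the network that is alone in the region. -/
def singleGain (ρ Ks ls : ℝ) : ℝ :=
  meanProgress * volume.real (region ρ) * Ks * (1 / (Real.pi * (1 + ls) * Ks ^ 2)) * Real.exp (-1)

theorem singleGain_pos (hρ : 0 < ρ) (hKs : 0 < Ks) (hls : 0 ≤ ls) : 0 < singleGain ρ Ks ls := by
  have := Real.pi_pos
  have := volume_real_region_pos hρ
  have := meanProgress_pos
  unfold singleGain; positivity

/-- At the optimal access probability π (1 + ls) Ks² (q log λ) = 1, so the probability that the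
interferers are silent tends to exp(-1). -/
theorem isAMG_singleThroughput (hρ : 0 < ρ) (hβ0 : 0 < β) (hβ1 : β < 1) (hKs : 0 < Ks)
    (hls : 0 ≤ ls) (hT : MultiHop ρ T (fun t => t ^ β) fun t => txRange Ks (t ^ β)) :
    IsAMG (fun t => singleThroughput ρ (t ^ β) (T t) (txRange Ks (t ^ β)) (intRange ls Ks (t ^ β))
      (optAccess (t ^ β) (intRange ls Ks (t ^ β)))) (fun t => scaling (t ^ β))
      (singleGain ρ Ks ls) := by
  have hpi := Real.pi_pos
  have hd : Tendsto (fun t : ℝ => t ^ β) atTop atTop := tendsto_rpow_atTop hβ0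
  have hd1 := hd.eventually_gt_atTop 1
  have hopt : Tendsto (fun t : ℝ => optAccess (t ^ β) (intRange ls Ks (t ^ β))) atTop (𝓝 0) :=
    tendsto_optAccess hls hd
  -- The primary parameters are arbitrary here, as `RIps`, `RD` and `qp` vanish.
  have hlim := tendsto_secondaryThroughput_div (Kp := 1) (lp := 0) (ls := ls)
    (RIps := fun _ => 0) (RD := fun _ => 0) (qp := fun _ => 0) (T := T)
    (q := fun t : ℝ => optAccess (t ^ β) (intRange ls Ks (t ^ β))) hρ hβ0 hβ1 hKs
    ((eventually_gt_atTop 1).mono fun t ht =>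
      ⟨le_rfl, mul_nonneg (Real.sqrt_nonneg _) (txRange_pos one_pos ht).le⟩)
    (Eventually.of_forall fun _ => le_rfl) (isBigO_zero _ _) hT
    (Eventually.of_forall fun _ => ⟨le_rfl, zero_le_one⟩)
    (by
      filter_upwards [hopt.eventually_le_const one_pos, hd1] with t ht h1
      refine ⟨?_, ht⟩
      have : (0 : ℝ) ≤ t ^ β := by linarith
      unfold optAccess; positivity) (isBigO_optAccess hls hd)
  have h2 := hlim.add_const (singleGain ρ Ks ls)
  rw [zero_add] at h2
  refine h2.congr' ?_
  filter_upwards [hd1, eventually_ge_atTop 0] with t h1 ht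
  have hl := Real.log_pos h1
  rw [singleThroughput_eq hρ ht (by linarith), typicalReach_eq hls h1.le,
    optAccess_intRange hls h1, singleGain]
  have e1 : 1 / (Real.pi * (1 + ls) * Ks ^ 2) / Real.log (t ^ β) * Real.log (t ^ β) =
      1 / (Real.pi * (1 + ls) * Ks ^ 2) := div_mul_cancel₀ _ hl.ne'
  have e2 : Real.pi * (1 + ls) * Ks ^ 2 * (1 / (Real.pi * (1 + ls) * Ks ^ 2)) = 1 :=
    mul_one_div_cancel (by positivity)
  rw [e1, e2]
  simp

/-- The shape of the asymptotic throughput relative to a network that is alone. -/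
structure IsGainFn (g : ℝ → ℝ → ℝ) : Prop where
  continuous : Continuous fun p : ℝ × ℝ => g p.1 p.2
  le : ∀ x y, g x y ≤ Real.exp (-x ^ 2)
  ge : ∀ x y, Real.exp (-(x ^ 2 + y ^ 2)) ≤ g x y

/-- The case of the effective access probability: more frequent attempts compensate exactly for the
silence imposed by detection, and the detection range disappears from the gain. -/
theorem isGainFn_left : IsGainFn fun x _ => Real.exp (-x ^ 2) where
  continuous := by fun_prop
  le _ _ := le_rfl
  ge x y := Real.exp_le_exp.2 (by linarith [sq_nonneg y])

/-- The case of the fixed access probability: detection silences transmitters, but also interferers,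
whose exponent drops from 1 to exp(-y²). The relief 1 - exp(-y²) lies between 0 and y², hence both
bounds. -/
theorem isGainFn_both :
    IsGainFn fun x y => Real.exp (-(x ^ 2 + y ^ 2) + (1 - Real.exp (-y ^ 2))) where
  continuous := by fun_prop
  le x y := Real.exp_le_exp.2 (by linarith [Real.add_one_le_exp (-y ^ 2)])
  ge x y := Real.exp_le_exp.2 (by
    have : Real.exp (-y ^ 2) ≤ 1 := Real.exp_le_one_iff.2 (by linarith [sq_nonneg y])
    linarith)

theorem IsGainFn.exp_add_sq_le {g : ℝ → ℝ → ℝ} (hg : IsGainFn g) {x y : ℝ} (hx : 0 ≤ x)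
    (hy : 0 ≤ y) : Real.exp (-(x + y) ^ 2) ≤ g x y :=
  (Real.exp_le_exp.2 (by nlinarith [mul_nonneg hx hy])).trans (hg.ge x y)

/-- The factor 2 is pure slack, as the gain is already at most exp(-x²). -/
theorem IsGainFn.le_two_mul {g : ℝ → ℝ → ℝ} (hg : IsGainFn g) (x y : ℝ) :
    g x y ≤ 2 * Real.exp (-x ^ 2) := by
  linarith [hg.le x y, Real.exp_pos (-x ^ 2)]

/-- The throughput at the optimal access probabilities. -/
theorem exists_isGainFn (hρ : 0 < ρ) (hβ0 : 0 < β) (hβ1 : β < 1) (hKp : 0 < Kp)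
    (hKs : 0 < Ks) (hlp : 0 ≤ lp) (hls : 0 ≤ ls)
    (hRIps : ∀ᶠ t in atTop, 0 ≤ RIps t ∧ RIps t ≤ intRange lp Kp t)
    (hRD : ∀ᶠ t in atTop, 0 ≤ RD t) (hRD' : RD =O[atTop] fun t => txRange Kp t)
    (hT : MultiHop ρ T (fun t => t ^ β) fun t => txRange Ks (t ^ β))
    (hqp : ∀ᶠ t in atTop, 0 ≤ qp t ∧ qp t ≤ 1) (hq : ∀ᶠ t in atTop, 0 ≤ q t ∧ q t ≤ 1)
    (hqp' : qp =ᶠ[atTop] fun t => optAccess t (intRange lp Kp t))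
    (hq' : q =ᶠ[atTop] (fun t => optAccess (t ^ β) (intRange ls Ks (t ^ β))) ∨
      (fun t => q t * Real.exp (-(t * qp t * Real.pi * RD t ^ 2))) =ᶠ[atTop]
        fun t => optAccess (t ^ β) (intRange ls Ks (t ^ β))) :
    ∃ g, IsGainFn g ∧ Tendsto (fun t => secondaryThroughput ρ t (t ^ β) (T t)
      (txRange Ks (t ^ β)) (intRange ls Ks (t ^ β)) (RIps t) (RD t) (qp t) (q t) /
        scaling (t ^ β) / singleGain ρ Ks ls - g (RIps t / intRange lp Kp t)
          (RD t / intRange lp Kp t)) atTop (𝓝 0) := by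
  have hpi := Real.pi_pos
  have hχ := singleGain_pos hρ hKs hls
  have hd : Tendsto (fun t : ℝ => t ^ β) atTop atTop := tendsto_rpow_atTop hβ0
  have hd1 := hd.eventually_gt_atTop 1
  have hIpos : ∀ t, 1 < t → 0 < intRange lp Kp t := fun t ht =>
    mul_pos (Real.sqrt_pos.2 (by linarith)) (txRange_pos hKp ht)
  -- At the optimal primary access probability t qp π = 1 / RIP², so the primary exponents become
  -- squares of ratios of ranges.
  have hexp : ∀ᶠ t in atTop, ∀ z, t * qp t * Real.pi * z = z / intRange lp Kp t ^ 2 := by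
    filter_upwards [hqp', eventually_gt_atTop 1] with t h1 h2 z
    have := hIpos t h2
    rw [h1, optAccess]
    field_simp
  set a := 1 / (Real.pi * (1 + ls) * Ks ^ 2) with ha
  have ha1 : Real.pi * (1 + ls) * Ks ^ 2 * a = 1 := mul_one_div_cancel (by positivity)
  have ha0 : 0 < a := by positivity
  -- If only the effective access probability is prescribed, q exceeds it by the factor exp((RD /
  -- RIP)²). This is at most exp(k²), because RD ≤ k `txRange Kp t` and RIP is at least `txRange Kp
  -- t`.
  have hO : q =O[atTop] fun t => 1 / Real.log (t ^ β) := by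
    rcases hq' with h | h
    · exact (isBigO_optAccess hls hd).congr' h.symm EventuallyEq.rfl
    · obtain ⟨k, hk, hkt⟩ := hRD'.exists_pos
      refine IsBigO.trans (IsBigO.of_bound (Real.exp (k ^ 2)) ?_)
        (isBigO_optAccess (l := ls) (K := Ks) hls hd)
      filter_upwards [h, hexp, hkt.bound, eventually_gt_atTop 1, hRD, hq] with t h1 h2 h3 h4 h5 h6
      rw [← h1, h2, norm_mul, Real.norm_of_nonneg h6.1, Real.norm_of_nonneg (Real.exp_pos _).le]
      have hR := txRange_pos hKp h4
      rw [Real.norm_of_nonneg h5, Real.norm_of_nonneg hR.le] at h3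
      have h7 : RD t ^ 2 / intRange lp Kp t ^ 2 ≤ k ^ 2 := by
        rw [div_le_iff₀ (pow_pos (hIpos t h4) 2), intRange_sq hlp]
        calc RD t ^ 2 ≤ (k * txRange Kp t) ^ 2 := by gcongr
          _ = k ^ 2 * (1 * txRange Kp t ^ 2) := by ring
          _ ≤ _ := by gcongr; linarith
      calc q t = q t * (Real.exp (k ^ 2) * Real.exp (-k ^ 2)) := by
            rw [← Real.exp_add, add_neg_cancel, Real.exp_zero, mul_one]
        _ = Real.exp (k ^ 2) * (q t * Real.exp (-k ^ 2)) := by ring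
        _ ≤ _ := by
          have := h6.1
          gcongr
  have hlim := (tendsto_secondaryThroughput_div (ls := ls) hρ hβ0 hβ1 hKs hRIps hRD hRD' hT hqp hq
    hO).div_const (singleGain ρ Ks ls)
  rw [zero_div] at hlim
  -- Division by the single gain removes all geometric constants; the + 1 in the exponent comes from
  -- its factor exp(-1).
  have hred : ∀ c X : ℝ, meanProgress * volume.real (region ρ) * Ks * c *
      Real.exp X / singleGain ρ Ks ls = c / a * Real.exp (X + 1) := by
    intro c X
    have := volume_real_region_pos hρ
    have := meanProgress_pos
    have h1 : Real.exp X = Real.exp (X + 1) * Real.exp (-1) := by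
      rw [← Real.exp_add]; congr 1; ring
    rw [h1, singleGain, ← ha]
    field_simp
  rcases hq' with h | h
  · refine ⟨_, isGainFn_both, hlim.congr' ?_⟩
    filter_upwards [h, hexp, hd1] with t h1 h2 h3
    have hw : q t * Real.log (t ^ β) = a := by
      rw [h1, optAccess_intRange hls h3, div_mul_cancel₀ _ (Real.log_pos h3).ne']
    rw [sub_div, typicalReach_eq hls h3.le, hw, ha1, one_mul, h2, h2, hred, div_self ha0.ne',
      one_mul, div_pow, div_pow]
    congr 2
    ring_nf
  · refine ⟨_, isGainFn_left, hlim.congr' ?_⟩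
    filter_upwards [h, hexp, hd1] with t h1 h2 h3
    rw [h2, optAccess_intRange hls h3] at h1
    have hw : q t * Real.log (t ^ β) * Real.exp (-(RD t ^ 2 / intRange lp Kp t ^ 2)) = a := by
      rw [mul_right_comm, h1, div_mul_cancel₀ _ (Real.log_pos h3).ne']
    have hw2 : q t * Real.log (t ^ β) / a = Real.exp (RD t ^ 2 / intRange lp Kp t ^ 2) := by
      rw [div_eq_iff ha0.ne', ← hw, mul_left_comm, ← Real.exp_add, add_neg_cancel, Real.exp_zero,
        mul_one]
    rw [sub_div, typicalReach_eq hls h3.le, mul_assoc (Real.pi * (1 + ls) * Ks ^ 2), h2, h2, hw,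
      ha1, hred, hw2, ← Real.exp_add, div_pow]
    congr 2
    ring

end Gain

end OverlaidNetwork

end

/-! ### The three claims -/

open OverlaidNetwork in
theorem mainTheorem5
    -- the region, the densities `t` and `t ^ β` and the ranges of the two networks
    (ρ β Kp Ks lp ls : ℝ) (hρ : 0 < ρ) (hβ0 : 0 < β) (hβ1 : β < 1)
    (hKp : 0 < Kp) (hKs : 0 < Ks) (hlp : 0 ≤ lp) (hls : 0 ≤ ls)
    (densS RrP RIP RrS RIS : ℝ → ℝ)
    (hdensS : densS = fun t => t ^ β)
    (hRrP : RrP = fun t => txRange Kp t)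
    (hRIP : RIP = fun t => intRange lp Kp t)
    (hRrS : RrS = fun t => txRange Ks (densS t))
    (hRIS : RIS = fun t => intRange ls Ks (densS t))
    (RIps RD : ℝ → ℝ)
    (hRIps : ∀ᶠ t in atTop, 0 ≤ RIps t ∧ RIps t ≤ RIP t)
    (hRD : ∀ᶠ t in atTop, 0 ≤ RD t)
    -- the packets of the secondary network
    (T : ℝ → Traffic) (hT : MultiHop ρ T densS RrS)
    -- the access probabilities
    (qp qs : ℝ → ℝ)
    (hqp : ∀ᶠ t in atTop, 0 ≤ qp t ∧ qp t ≤ 1)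
    (hqs : ∀ᶠ t in atTop, 0 ≤ qs t ∧ qs t ≤ 1)
    -- the secondary throughput, overlaid and single-tier
    (C C₀ f : ℝ → ℝ)
    (hC : C = fun t =>
      secondaryThroughput ρ t (densS t) (T t) (RrS t) (RIS t) (RIps t) (RD t) (qp t) (qs t))
    (hC₀ : C₀ = fun t =>
      singleThroughput ρ (densS t) (T t) (RrS t) (RIS t) (optAccess (densS t) (RIS t)))
    (hf : f = fun t => scaling (densS t)) :
    -- the detection range is of larger order than the primary transmission range
    (RrP =o[atTop] RD →
      qp =Θ[atTop] (fun t => 1 / Real.log t) →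
      qs =O[atTop] (fun t => 1 / Real.log (densS t)) →
      C =o[atTop] f) ∧
    -- the detection range is at most of the order of the primary transmission range
    (RD =O[atTop] RrP →
      qp =O[atTop] (fun t => 1 / Real.log t) →
      qs =Θ[atTop] (fun t => 1 / Real.log (densS t)) →
      C =Θ[atTop] f ∧ ∀ᶠ t in atTop, 0 < C t) ∧
    -- the asymptotic multiplexing gain
    (RD =O[atTop] RrP →
      qp =ᶠ[atTop] (fun t => optAccess t (RIP t)) →
      (qs =ᶠ[atTop] (fun t => optAccess (densS t) (RIS t)) ∨
        (fun t => qs t * Real.exp (-(t * qp t * Real.pi * RD t ^ 2))) =ᶠ[atTop]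
          (fun t => optAccess (densS t) (RIS t))) →
      ∃ χ : ℝ, 0 < χ ∧ IsAMG C₀ f χ ∧
        (∀ ε > 0, ∀ᶠ t in atTop,
          Real.exp (-((RIps t + RD t) ^ 2 / RIP t ^ 2)) - ε ≤ C t / f t / χ ∧
          C t / f t / χ ≤ 2 * Real.exp (-(RIps t / RIP t) ^ 2) + ε) ∧
        (∀ a d : ℝ, Tendsto (fun t => RIps t / RIP t) atTop (𝓝 a) →
          Tendsto (fun t => RD t / RIP t) atTop (𝓝 d) →
          ∃ χs : ℝ, IsAMG C f χs ∧
            Real.exp (-(a + d) ^ 2) ≤ χs / χ ∧ χs / χ ≤ 2 * Real.exp (-a ^ 2))) := by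
  subst hdensS hRrP hRIP hRrS hRIS hC₀ hf
  refine ⟨fun h1 h2 h3 => ?_, fun h1 h2 h3 => ?_, fun h1 h2 h3 => ?_⟩
  · subst hC
    exact isLittleO_secondaryThroughput hρ hβ0 hKp hKs h1 hRD hqp hqs h2.2 h3
  · exact isTheta_secondaryThroughput hρ hβ0 hβ1 hKp hKs hlp hls hRIps hRD h1 hT hqp hqs h2 h3 hC
  · obtain ⟨g, hg, hlim⟩ := exists_isGainFn hρ hβ0 hβ1 hKp hKs hlp hls hRIps hRD h1 hT hqp hqs h2 h3
    have hχ := singleGain_pos (Ks := Ks) (ls := ls) hρ hKs hls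
    have hI : ∀ᶠ t in atTop, 0 < intRange lp Kp t := (eventually_gt_atTop 1).mono fun t ht =>
      mul_pos (Real.sqrt_pos.2 (by linarith)) (txRange_pos hKp ht)
    have hx : ∀ᶠ t in atTop, 0 ≤ RIps t / intRange lp Kp t := by
      filter_upwards [hI, hRIps] with t h h'
      exact div_nonneg h'.1 h.le
    have hy : ∀ᶠ t in atTop, 0 ≤ RD t / intRange lp Kp t := by
      filter_upwards [hI, hRD] with t h h'
      exact div_nonneg h' h.le
    subst hC
    refine ⟨singleGain ρ Ks ls, hχ, isAMG_singleThroughput hρ hβ0 hβ1 hKs hls hT, fun ε hε => ?_,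
      fun a d ha hd => ⟨g a d * singleGain ρ Ks ls, ?_, ?_⟩⟩
    · filter_upwards [hx, hy, hlim.eventually_le_const hε,
        hlim.eventually_const_le (neg_lt_zero.2 hε)] with t hx hy h4 h5
      rw [← div_pow, add_div]
      have h6 := hg.exp_add_sq_le hx hy
      have h7 := hg.le_two_mul (RIps t / intRange lp Kp t) (RD t / intRange lp Kp t)
      constructor <;> linarith
    -- The normalized throughput is asymptotic to the gain function at the ratios of ranges, so
    -- continuity identifies the limit as g(a, d).
    · have hg2 := (hg.continuous.tendsto (a, d)).comp (ha.prodMk_nhds hd)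
      have h4 := (hlim.add hg2).mul_const (singleGain ρ Ks ls)
      rw [zero_add] at h4
      refine h4.congr fun t => ?_
      simp only [Function.comp_apply, sub_add_cancel]
      exact div_mul_cancel₀ _ hχ.ne'
    · rw [mul_div_cancel_right₀ _ hχ.ne']
      exact ⟨hg.exp_add_sq_le (ge_of_tendsto ha hx) (ge_of_tendsto hd hy), hg.le_two_mul a d⟩
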